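/- Let $M$ be a closed (compact, without boundary) connected smooth Riemannian manifold of dimension $d\ge 2$ with distance $d(\cdot,\cdot)$, endowed with a smooth volume form, and let $\mu$ be the associated Lebesgue measure. Let $\mathrm{Diff}^1_\mu(M)$ be the set of $C^1$ diffeomorphisms of $M$ that preserve $\mu$, with the $C^1$ Whitney topology. A sequence $(x_i)_{i\in\mathbb Z}$ in $M$ is a $\delta$-pseudo-orbit of $g$ if $d(g(x_i),x_{i+1})<\delta$ for all $i\in\mathbb Z$. The map $g$ is weakly shadowable if for every $\epsilon>0$ there is $\delta>0$ such that for every $\delta$-pseudo-orbit $(x_i)_{i\in\mathbb Z}$ of $g$ there is $y\in M$ with $\{x_i\}_{i\in\mathbb Z}\subset\bigcup_{j\in\mathbb Z}B(g^j(y),\epsilon)$. A periodic point $p$ of $g$, of least period $\pi$, has trivial real spectrum if all (complex) eigenvalues of $Dg^\pi(p)$ are equal to $1$ or $-1$, that is, for some $0\le k\le d$ the eigenvalue $1$ has algebraic multiplicity $k$ and the eigenvalue $-1$ has algebraic multiplicity $d-k$. Let $f\in\mathrm{Diff}^1_\mu(M)$ be $C^1$-stably weakly shadowable, and let $U$ be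 an open neighbourhood of $f$ in $\mathrm{Diff}^1_\mu(M)$ such that every $g\in U$ is weakly shadowable. Then no $g\in U$ has a periodic point with trivial real spectrum. -/

import Mathlib

open Set Filter Topology MeasureTheory
open scoped Manifold ContDiff Bundle

namespace WeakShadowing

/-- A (smooth, nowhere vanishing) volume form on a `d`-dimensional manifold. -/
structure VolumeForm (d : ℕ) (M : Type*) [TopologicalSpace M]
    [ChartedSpace (EuclideanSpace ℝ (Fin d)) M] where
  /-- the alternating `d`-form on each tangent space -/
  form : ∀ x : M, TangentSpace (𝓡 d) x [⋀^Fin d]→ₗ[ℝ] ℝ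
  form_ne_zero : ∀ x, form x ≠ 0
  /-- the coefficient `Ω(∂₁, …, ∂_d)` is smooth in every chart -/
  smooth : ∀ e ∈ atlas (EuclideanSpace ℝ (Fin d)) M,
    ContDiffOn ℝ ∞ (fun y => form (e.symm y) fun i =>
      mfderiv (𝓡 d) (𝓡 d) e.symm y (EuclideanSpace.single i (1 : ℝ))) e.target

section

variable {d : ℕ} {M : Type*} [TopologicalSpace M] [ChartedSpace (EuclideanSpace ℝ (Fin d)) M]

/-- The coefficient `Ω(∂₁, …, ∂_d)` of a volume form in the chart `e`, at the point with
coordinates `y`. -/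
noncomputable def VolumeForm.coeff (Ω : VolumeForm d M)
    (e : OpenPartialHomeomorph M (EuclideanSpace ℝ (Fin d))) (y : EuclideanSpace ℝ (Fin d)) : ℝ :=
  Ω.form (e.symm y) fun i =>
    mfderiv (𝓡 d) (𝓡 d) e.symm y (EuclideanSpace.single i (1 : ℝ))

/-- `μ` is the Lebesgue measure of the volume form `Ω`: for a Borel set `A` inside the domain of
a chart `e`, `μ(A)` is the integral of `|Ω|` over `A`, computed in that chart. As countably many
charts cover a second countable manifold, this determines `μ`. -/
def VolumeForm.IsLebesgueMeasure [MeasurableSpace M] (Ω : VolumeForm d M) (μ : Measure M) : Prop :=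
  ∀ e ∈ atlas (EuclideanSpace ℝ (Fin d)) M, ∀ A : Set M, MeasurableSet A → A ⊆ e.source →
    μ A = ∫⁻ y in e '' A, ENNReal.ofReal |Ω.coeff e y|

/-- The set of `C¹` diffeomorphisms of `M` that preserve the measure `μ`. -/
def VolDiff (d : ℕ) {M : Type*} [TopologicalSpace M] [ChartedSpace (EuclideanSpace ℝ (Fin d)) M]
    [MeasurableSpace M] (μ : Measure M) : Type _ :=
  {f : M ≃ₘ^1⟮𝓡 d, 𝓡 d⟯ M // MeasurePreserving f μ μ}

variable [MeasurableSpace M] {μ : Measure M}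

/-- The underlying permutation of `M`; its integer powers give the orbits. -/
def VolDiff.toPerm (f : VolDiff d μ) : Equiv.Perm M := f.1.toEquiv

variable [IsManifold (𝓡 d) ∞ M]

/-- The tangent map `TM → TM`, as a continuous map. -/
noncomputable def VolDiff.tangent (f : VolDiff d μ) :
    C(TangentBundle (𝓡 d) M, TangentBundle (𝓡 d) M) where
  toFun := tangentMap (𝓡 d) (𝓡 d) f.toPerm
  continuous_toFun :=
    haveI : IsManifold (𝓡 d) 1 M := IsManifold.of_le (n := ∞) (by simp)
    f.1.contMDiff_toFun.continuous_tangentMap le_rfl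

/-- The `C¹` topology: `g` is close to `f` iff the tangent map of `g` is close to that of `f`,
uniformly on compact subsets of `TM`. For compact `M` this is the `C¹` Whitney topology. -/
noncomputable instance : TopologicalSpace (VolDiff d μ) :=
  TopologicalSpace.induced VolDiff.tangent inferInstance

/-- The derivative `Df^π(p)` of the first return map, for a point `p` of least period `π`.
In Mathlib each tangent space is a copy of the model space `ℝ^d`, via the preferred chart at the
base point; as `f^π(p) = p`, the tangent spaces at `p` and `f^π(p)` are the same copy. -/
noncomputable def VolDiff.returnDeriv (f : VolDiff d μ) (p : M) :
    EuclideanSpace ℝ (Fin d) →L[ℝ] EuclideanSpace ℝ (Fin d) :=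
  mfderiv (𝓡 d) (𝓡 d) (f.toPerm^[Function.minimalPeriod f.toPerm p]) p

/-- `p` is a periodic point of `f`, and the only (complex) eigenvalues of `Df^π(p)` are `1` and
`-1`, with algebraic multiplicities `k` and `d - k` for some `0 ≤ k ≤ d`. -/
def VolDiff.IsPeriodicWithTrivialRealSpectrum (f : VolDiff d μ) (p : M) : Prop :=
  p ∈ Function.periodicPts f.toPerm ∧
    ∃ k ≤ d, (f.returnDeriv p).toLinearMap.charpoly =
      (Polynomial.X - 1) ^ k * (Polynomial.X + 1) ^ (d - k)

end

/-- A `δ`-pseudo-orbit of `f`. -/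
def IsPseudoOrbit {M : Type*} [MetricSpace M] (f : Equiv.Perm M) (δ : ℝ) (x : ℤ → M) : Prop :=
  ∀ i, dist (f (x i)) (x (i + 1)) < δ

/-- The weak shadowing property on all of `M`: every `δ`-pseudo-orbit is, as a set, contained in
the `ε`-neighbourhood of some orbit of `f`. -/
def HasWeakShadowing {M : Type*} [MetricSpace M] (f : Equiv.Perm M) : Prop :=
  ∀ ε > 0, ∃ δ > 0, ∀ x : ℤ → M, IsPseudoOrbit f δ x →
    ∃ y : M, ∀ i : ℤ, ∃ j : ℤ, x i ∈ Metric.ball ((f ^ j) y) ε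

end WeakShadowing

namespace WeakShadowing

/-! ### Near-identity maps and volume preserving perturbations of a normed space -/

section NearIdentity

variable {E : Type*} [NormedAddCommGroup E] [NormedSpace ℝ E]

/-! Weak shadowing of a volume preserving map yields a form of transitivity. By Poincaré recurrence
and connectedness any two points are joined by finite chains (`chain_of_measurePreserving`).
Shadowing the resulting pseudo-orbits gives, for any two nonempty open sets, an orbit meeting both
(`HasWeakShadowing.exists_orbit`). So it suffices to turn a periodic point with trivial real
spectrum, by a perturbation inside `U`, into a nonempty open set `V` with `h^m(V) = V` whose
iterates miss some nonempty open set `Z` (`exists_periodic_isOpen`, `not_exists_orbit_of_image_eq`).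

The work is done in `C¹` charts where `μ` is Lebesgue measure (`exists_isVolumeChart`). There a
`C¹`-small volume preserving map with compact support lifts to a perturbation of the diffeomorphism
(`exists_perturbation_mem`).

Linear step. Composing the return derivative with a small transvection is realized by such a
perturbation. A double eigenvalue `1` or `-1` can thus be replaced by a pair of conjugate roots of
unity close to it. The roots are chosen to avoid all earlier eigenvalues, so repeating this leaves
an endomorphism of finite order `N` (`StableUnderTransvections.exists_pow_eq_one`).

Island step. If `n` is the period, the `n * N`-th iterate now has the identity as derivative at the
point. Blown up around a nearby point `r • q`, it becomes a map `G` that is `C¹`-close to the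
identity on a ball of fixed radius. The direction `q` is chosen so that this small ball does not
meet its own earlier iterates (`exists_island`, `exists_rescaled_near`).

Cube step. It is not necessary to turn `G` into the identity: it is enough that some open set be
mapped onto itself. After a small volume preserving perturbation, `G` maps the unit cube onto itself
(`exists_preserving_unitCube`). The preimage of each face is a graph over the face, which shears
with explicit generating functions push back to the face. These shears lose no derivatives, because
the height functions do not depend on the sheared coordinate. For the last pair of faces, shears
that respect the side faces only remove the parts of zero average, leaving two constants.
Conservation of volume makes the constants equal, and a flux localized at one side face cancels
them. The cube is then `V`, and `Z` lies in the same island outside the cube. -/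

theorem det_comp (A B : E →L[ℝ] E) : (A.comp B).det = A.det * B.det :=
  LinearMap.det_comp _ _

/-- `G` is a `C¹` map whose derivative is everywhere `ε`-close to the identity. -/
structure NearId (ε : ℝ) (G : E → E) : Prop where
  contDiff : ContDiff ℝ 1 G
  norm_fderiv_sub_le : ∀ x, ‖fderiv ℝ G x - ContinuousLinearMap.id ℝ E‖ ≤ ε

namespace NearId

variable {ε δ : ℝ} {F G : E → E}

theorem nonneg (hG : NearId ε G) : 0 ≤ ε := (norm_nonneg _).trans (hG.norm_fderiv_sub_le 0)

theorem mono (hG : NearId ε G) (h : ε ≤ δ) : NearId δ G :=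
  ⟨hG.contDiff, fun x => (hG.norm_fderiv_sub_le x).trans h⟩

theorem differentiable (hG : NearId ε G) : Differentiable ℝ G := hG.contDiff.differentiable (by simp)

theorem hasFDerivAt (hG : NearId ε G) (x : E) : HasFDerivAt G (fderiv ℝ G x) x :=
  (hG.differentiable x).hasFDerivAt

theorem norm_sub_sub_le (hG : NearId ε G) (x y : E) :
    ‖(G x - x) - (G y - y)‖ ≤ ε * ‖x - y‖ := by
  refine Convex.norm_image_sub_le_of_norm_hasFDerivWithin_le (f := fun z => G z - z)
    (f' := fun z => fderiv ℝ G z - ContinuousLinearMap.id ℝ E) (s := univ)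
    (fun z _ => ((hG.hasFDerivAt z).sub (hasFDerivAt_id z)).hasFDerivWithinAt)
    (fun z _ => hG.norm_fderiv_sub_le z) convex_univ (mem_univ _) (mem_univ _)

protected theorem id : NearId 0 (id : E → E) :=
  ⟨contDiff_id, fun x => by simp [fderiv_id]⟩

theorem comp (hF : NearId ε F) (hG : NearId δ G) : NearId (ε + δ + ε * δ) (F ∘ G) := by
  refine ⟨hF.contDiff.comp hG.contDiff, fun x => ?_⟩
  rw [((hF.hasFDerivAt (G x)).comp x (hG.hasFDerivAt x)).fderiv]
  set A := fderiv ℝ F (G x)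
  set B := fderiv ℝ G x
  have hA := hF.norm_fderiv_sub_le (G x)
  have hB := hG.norm_fderiv_sub_le x
  have : A.comp B - ContinuousLinearMap.id ℝ E = (A - ContinuousLinearMap.id ℝ E) +
      (B - ContinuousLinearMap.id ℝ E) +
      (A - ContinuousLinearMap.id ℝ E).comp (B - ContinuousLinearMap.id ℝ E) := by
    ext v
    simp only [sub_apply, add_apply,
      ContinuousLinearMap.comp_apply, ContinuousLinearMap.id_apply, map_sub]
    abel
  rw [this]
  refine (norm_add_le _ _).trans (add_le_add ((norm_add_le _ _).trans (add_le_add hA hB)) ?_)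
  exact (ContinuousLinearMap.opNorm_comp_le _ _).trans
    (mul_le_mul hA hB (norm_nonneg _) hF.nonneg)

theorem injective (hG : NearId ε G) (hε : ε < 1) : Function.Injective G := by
  intro x y hxy
  have := hG.norm_sub_sub_le x y
  rw [hxy, show G y - x - (G y - y) = -(x - y) by abel, norm_neg] at this
  have h0 : ‖x - y‖ ≤ 0 := by nlinarith [norm_nonneg (x - y)]
  exact sub_eq_zero.1 (norm_le_zero_iff.1 h0)

theorem approximatesLinearOn (hG : NearId ε G) :
    ApproximatesLinearOn G ((ContinuousLinearEquiv.refl ℝ E : E ≃L[ℝ] E) : E →L[ℝ] E) univ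
      ⟨ε, hG.nonneg⟩ := by
  intro x _ y _
  have := hG.norm_sub_sub_le x y
  simp only [ContinuousLinearEquiv.coe_refl, ContinuousLinearMap.coe_id', id_eq]
  rwa [show G x - G y - (x - y) = G x - x - (G y - y) by abel]

variable [CompleteSpace E]

/-- A near-identity map is a homeomorphism. -/
noncomputable def toHomeomorph (hG : NearId ε G) (hε : ε < 1) : E ≃ₜ E :=
  hG.approximatesLinearOn.toHomeomorph G (by
    rcases subsingleton_or_nontrivial E with h | h
    · exact Or.inl h
    · refine Or.inr ?_
      have : ‖((ContinuousLinearEquiv.refl ℝ E).symm : E →L[ℝ] E)‖₊ = 1 := by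
        ext; simp
      rw [this, inv_one]
      exact hε)

theorem surjective (hG : NearId ε G) (hε : ε < 1) : Function.Surjective G :=
  (hG.toHomeomorph hε).surjective

theorem exists_fderivEquiv (hG : NearId ε G) (hε : ε < 1) (x : E) :
    ∃ A : E ≃L[ℝ] E, (A : E →L[ℝ] E) = fderiv ℝ G x := by
  have h : ‖ContinuousLinearMap.id ℝ E - fderiv ℝ G x‖ < 1 := by
    rw [norm_sub_rev]; exact (hG.norm_fderiv_sub_le x).trans_lt hε
  refine ⟨ContinuousLinearEquiv.unitsEquiv ℝ E (Units.oneSub _ h), ?_⟩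
  ext v
  simp

theorem contDiff_symm (hG : NearId ε G) (hε : ε < 1) :
    ContDiff ℝ 1 (hG.toHomeomorph hε).symm := by
  choose A hA using hG.exists_fderivEquiv hε
  exact (hG.toHomeomorph hε).contDiff_symm (f₀' := A)
    (fun a => by rw [hA]; exact hG.hasFDerivAt a) hG.contDiff

theorem fderiv_comp_fderiv_symm (hG : NearId ε G) (hε : ε < 1) (x : E) :
    (fderiv ℝ G ((hG.toHomeomorph hε).symm x)).comp (fderiv ℝ (hG.toHomeomorph hε).symm x) =
      ContinuousLinearMap.id ℝ E := by
  have h1 := (hG.hasFDerivAt ((hG.toHomeomorph hε).symm x)).comp x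
    (((hG.contDiff_symm hε).differentiable (by simp)) x).hasFDerivAt
  have h2 : G ∘ (hG.toHomeomorph hε).symm = id := by
    ext y; exact (hG.toHomeomorph hε).apply_symm_apply y
  rw [h2] at h1
  exact h1.unique (hasFDerivAt_id x)

/-- With `A` the derivative and `B` that of the inverse, `B - 1 = -(A - 1) - (A - 1)(B - 1)`. For `ε
≤ 1/2` the last term is absorbed at the price of a factor `2`. -/
theorem symm (hG : NearId ε G) (hε : ε ≤ 1 / 2) :
    NearId (2 * ε) (hG.toHomeomorph (hε.trans_lt (by norm_num))).symm := by
  have hε1 : ε < 1 := hε.trans_lt (by norm_num)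
  refine ⟨hG.contDiff_symm hε1, fun x => ?_⟩
  have key := hG.fderiv_comp_fderiv_symm hε1 x
  set B := fderiv ℝ (hG.toHomeomorph hε1).symm x
  set A := fderiv ℝ G ((hG.toHomeomorph hε1).symm x)
  have hA : ‖A - ContinuousLinearMap.id ℝ E‖ ≤ ε := hG.norm_fderiv_sub_le _
  have h1 : B - ContinuousLinearMap.id ℝ E =
      -(A - ContinuousLinearMap.id ℝ E) -
        (A - ContinuousLinearMap.id ℝ E).comp (B - ContinuousLinearMap.id ℝ E) := by
    ext v
    have := congrArg (fun L : E →L[ℝ] E => L v) key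
    simp only [ContinuousLinearMap.comp_apply, ContinuousLinearMap.id_apply] at this
    simp only [sub_apply, neg_apply,
      ContinuousLinearMap.comp_apply, ContinuousLinearMap.id_apply, map_sub, this]
    abel
  have h2 : ‖B - ContinuousLinearMap.id ℝ E‖ ≤ ε + ε * ‖B - ContinuousLinearMap.id ℝ E‖ := by
    conv_lhs => rw [h1]
    refine (norm_sub_le _ _).trans (add_le_add (by rwa [norm_neg]) ?_)
    exact (ContinuousLinearMap.opNorm_comp_le _ _).trans
      (mul_le_mul_of_nonneg_right hA (norm_nonneg _))
  nlinarith [norm_nonneg (B - ContinuousLinearMap.id ℝ E), hG.nonneg]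

end NearId

/-- `φ` is a `C¹` map with Jacobian `1`, equal to the identity outside `K` and `ε`-close to the
identity in the `C¹` sense. -/
structure VolPert (ε : ℝ) (K : Set E) (φ : E → E) : Prop extends NearId ε φ where
  eq_self : ∀ x ∉ K, φ x = x
  det_eq_one : ∀ x, (fderiv ℝ φ x).det = 1

namespace VolPert

variable {ε δ : ℝ} {K : Set E} {φ ψ : E → E}

protected theorem id : VolPert 0 K (id : E → E) :=
  { NearId.id with
    eq_self := fun _ _ => rfl
    det_eq_one := fun x => by rw [fderiv_id]; simp [ContinuousLinearMap.det] }

theorem mono (h : VolPert ε K φ) (hε : ε ≤ δ) : VolPert δ K φ :=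
  { h.toNearId.mono hε with eq_self := h.eq_self, det_eq_one := h.det_eq_one }

theorem mono_set {K' : Set E} (h : VolPert ε K φ) (hK : K ⊆ K') : VolPert ε K' φ :=
  { h.toNearId with eq_self := fun x hx => h.eq_self x fun h' => hx (hK h'),
                    det_eq_one := h.det_eq_one }

theorem comp (hφ : VolPert ε K φ) (hψ : VolPert δ K ψ) : VolPert (ε + δ + ε * δ) K (φ ∘ ψ) :=
  { hφ.toNearId.comp hψ.toNearId with
    eq_self := fun x hx => by rw [Function.comp_apply, hψ.eq_self x hx, hφ.eq_self x hx]
    det_eq_one := fun x => by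
      rw [((hφ.hasFDerivAt (ψ x)).comp x (hψ.hasFDerivAt x)).fderiv]
      rw [det_comp, hφ.det_eq_one, hψ.det_eq_one, one_mul] }

theorem mapsTo (hφ : VolPert ε K φ) (hε : ε < 1) {x : E} (hx : x ∈ K) : φ x ∈ K := by
  by_contra h
  have h' := hφ.injective hε (hφ.eq_self _ h)
  rw [h'] at h
  exact h hx

theorem mem_iff (hφ : VolPert ε K φ) (hε : ε < 1) {x : E} : φ x ∈ K ↔ x ∈ K := by
  refine ⟨fun h => ?_, hφ.mapsTo hε⟩
  by_contra h'
  exact h' (hφ.eq_self x h' ▸ h)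

/-- Compare `x` with a point of norm `R + 1`, which `φ` fixes. Hence `VolPert` only has to record
closeness of derivatives. -/
theorem norm_sub_le [Nontrivial E] {R : ℝ} (hR : 0 ≤ R) (hφ : VolPert ε (Metric.closedBall 0 R) φ)
    (x : E) : ‖φ x - x‖ ≤ ε * (2 * R + 1) := by
  by_cases hx : x ∈ Metric.closedBall (0 : E) R
  · obtain ⟨y, hy⟩ := exists_norm_eq E (show 0 ≤ R + 1 by linarith)
    have hy' : φ y = y := hφ.eq_self y (by simp [hy])
    have := hφ.norm_sub_sub_le x y
    rw [hy', sub_self, sub_zero] at this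
    refine this.trans (mul_le_mul_of_nonneg_left ?_ hφ.nonneg)
    have := _root_.norm_sub_le x y
    rw [mem_closedBall_zero_iff] at hx
    linarith
  · rw [hφ.eq_self x hx, sub_self, norm_zero]
    exact mul_nonneg hφ.nonneg (by linarith)

variable [FiniteDimensional ℝ E] [MeasurableSpace E] [BorelSpace E]

theorem measure_image (hφ : VolPert ε K φ) (hε : ε < 1) (ν : Measure E) [ν.IsAddHaarMeasure]
    {A : Set E} (hA : MeasurableSet A) : ν (φ '' A) = ν A := by
  rw [← lintegral_abs_det_fderiv_eq_addHaar_image ν hA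
    (fun x _ => (hφ.hasFDerivAt x).hasFDerivWithinAt) (hφ.injective hε).injOn]
  simp [hφ.det_eq_one]

end VolPert

/-- Two maps `x ↦ x + p x • v` and `x ↦ x + q x • u` have the same Jacobian when the derivative of
`p` along `v` is that of `q` along `u`, so that one composed with the inverse of the other
preserves the volume. -/
theorem exists_volPert_of_deriv_eq [FiniteDimensional ℝ E] {u v : E} {p q : E → ℝ} {K : Set E}
    {η : ℝ} (hη : η ≤ 1 / 2) (hp : ContDiff ℝ 1 p) (hq : ContDiff ℝ 1 q)
    (hpη : ∀ x, ‖fderiv ℝ p x‖ * ‖v‖ ≤ η) (hqη : ∀ x, ‖fderiv ℝ q x‖ * ‖u‖ ≤ η)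
    (hpK : ∀ x ∉ K, p x = 0) (hqK : ∀ x ∉ K, q x = 0)
    (hpq : ∀ x, fderiv ℝ p x v = fderiv ℝ q x u) :
    ∃ φ : E → E, VolPert (4 * η) K φ ∧ ∀ x, φ (x + q x • u) = x + p x • v := by
  have : CompleteSpace E := FiniteDimensional.complete ℝ E
  have aux : ∀ (p : E → ℝ) (v : E), ContDiff ℝ 1 p → (∀ x, ‖fderiv ℝ p x‖ * ‖v‖ ≤ η) →
      NearId η (fun x => x + p x • v) ∧
      ∀ x, (fderiv ℝ (fun x => x + p x • v) x).det = 1 + fderiv ℝ p x v := by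
    intro p v hp hpη
    have hd : ∀ x, HasFDerivAt (fun x => x + p x • v)
        (ContinuousLinearMap.id ℝ E + (fderiv ℝ p x).smulRight v) x := fun x =>
      (hasFDerivAt_id x).add
        ((hp.differentiable (by simp) x).hasFDerivAt.smul_const v)
    refine ⟨⟨contDiff_id.add (hp.smul contDiff_const), fun x => ?_⟩, fun x => ?_⟩
    · rw [(hd x).fderiv, add_sub_cancel_left, ContinuousLinearMap.norm_smulRight_apply]
      exact hpη x
    · rw [(hd x).fderiv]
      exact LinearMap.transvection.det (fderiv ℝ p x : E →ₗ[ℝ] ℝ) v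
  obtain ⟨hF, hFdet⟩ := aux p v hp hpη
  obtain ⟨hH, hHdet⟩ := aux q u hq hqη
  set F : E → E := fun x => x + p x • v
  set H : E → E := fun x => x + q x • u
  have hη1 : η < 1 := hη.trans_lt (by norm_num)
  set e := hH.toHomeomorph hη1
  have hφ := hF.comp (hH.symm hη)
  have hval : ∀ x, (F ∘ e.symm) (H x) = F x := fun x => by
    have : e.symm (H x) = x := e.symm_apply_apply x
    rw [Function.comp_apply, this]
  have hη0 := hF.nonneg
  -- The composition of the bounds `η` for `F` and `2 * η` for the inverse of `H` is `3 * η + 2 * η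
  -- ^ 2`, at most `4 * η`.
  refine ⟨F ∘ e.symm, { hφ.mono (δ := 4 * η) (by nlinarith) with
    eq_self := fun x hx => ?_, det_eq_one := fun x => ?_ }, hval⟩
  · have h1 : H x = x := by simp [H, hqK x hx]
    have h2 : F x = x := by simp [F, hpK x hx]
    have := hval x
    rwa [h1, h2] at this
  · rw [((hF.hasFDerivAt (e.symm x)).comp x ((hH.symm hη).hasFDerivAt x)).fderiv]
    have h1 := congrArg ContinuousLinearMap.det (hH.fderiv_comp_fderiv_symm hη1 x)
    rw [det_comp] at h1 ⊢
    rw [hFdet, hpq, ← hHdet]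
    refine h1.trans ?_
    simp [ContinuousLinearMap.det]

end NearIdentity

end WeakShadowing

namespace WeakShadowing

/-! ### Differentiation under the integral sign -/

section ParametricIntegral

variable {E : Type*} [NormedAddCommGroup E] [NormedSpace ℝ E] [FiniteDimensional ℝ E]

theorem hasFDerivAt_integral_of_contDiff {f : E × ℝ → ℝ} (hf : ContDiff ℝ 1 f) (x : E) :
    HasFDerivAt (fun x => ∫ s in (0 : ℝ)..1, f (x, s))
      (∫ s in (0 : ℝ)..1, (fderiv ℝ f (x, s)).comp (ContinuousLinearMap.inl ℝ E ℝ)) x := by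
  have hcont : Continuous fun z : E × ℝ =>
      (fderiv ℝ f z).comp (ContinuousLinearMap.inl ℝ E ℝ) :=
    (hf.continuous_fderiv (by simp)).clm_comp continuous_const
  have : ProperSpace E := FiniteDimensional.proper ℝ E
  obtain ⟨B, hB⟩ := ((isCompact_closedBall x 1).prod (isCompact_Icc (a := (0 : ℝ)) (b := 1))
    ).exists_bound_of_continuousOn hcont.continuousOn
  refine intervalIntegral.hasFDerivAt_integral_of_dominated_of_fderiv_le
    (F := fun x s => f (x, s))
    (F' := fun x s => (fderiv ℝ f (x, s)).comp (ContinuousLinearMap.inl ℝ E ℝ))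
    (bound := fun _ => B) (Metric.closedBall_mem_nhds x one_pos) ?_ ?_ ?_ ?_ ?_ ?_
  · exact Eventually.of_forall fun y =>
      (hf.continuous.comp (by fun_prop : Continuous fun s : ℝ => (y, s))).aestronglyMeasurable
  · exact (hf.continuous.comp (by fun_prop : Continuous fun s : ℝ => (x, s))).intervalIntegrable _ _
  · exact (hcont.comp (by fun_prop : Continuous fun s : ℝ => (x, s))).aestronglyMeasurable
  · refine Eventually.of_forall fun t ht y hy => hB (y, t) ⟨hy, ?_⟩
    rw [uIoc_of_le zero_le_one] at ht
    exact Ioc_subset_Icc_self ht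
  · exact intervalIntegrable_const
  · refine Eventually.of_forall fun t _ y _ => ?_
    exact HasFDerivAt.comp y (g := f) (f := fun y => (y, t))
      ((hf.differentiable (by simp) _).hasFDerivAt)
      ((hasFDerivAt_id y).prodMk (hasFDerivAt_const t y))

theorem contDiff_integral_of_contDiff {f : E × ℝ → ℝ} (hf : ContDiff ℝ 1 f) :
    ContDiff ℝ 1 (fun x => ∫ s in (0 : ℝ)..1, f (x, s)) := by
  rw [contDiff_one_iff_fderiv]
  refine ⟨fun x => (hasFDerivAt_integral_of_contDiff hf x).differentiableAt, ?_⟩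
  have : fderiv ℝ (fun x => ∫ s in (0 : ℝ)..1, f (x, s)) = fun x =>
      ∫ s in (0 : ℝ)..1, (fderiv ℝ f (x, s)).comp (ContinuousLinearMap.inl ℝ E ℝ) :=
    funext fun x => (hasFDerivAt_integral_of_contDiff hf x).fderiv
  rw [this]
  apply intervalIntegral.continuous_parametric_intervalIntegral_of_continuous'
  exact ((hf.continuous_fderiv (by simp)).clm_comp continuous_const)

theorem norm_fderiv_integral_le {f : E × ℝ → ℝ} (hf : ContDiff ℝ 1 f) {x : E} {B : ℝ}
    (hB : ∀ s ∈ Icc (0 : ℝ) 1,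
      ‖(fderiv ℝ f (x, s)).comp (ContinuousLinearMap.inl ℝ E ℝ)‖ ≤ B) :
    ‖fderiv ℝ (fun x => ∫ s in (0 : ℝ)..1, f (x, s)) x‖ ≤ B := by
  rw [(hasFDerivAt_integral_of_contDiff hf x).fderiv]
  refine (intervalIntegral.norm_integral_le_of_norm_le_const (C := B) fun s hs => hB s ?_).trans
    (by simp)
  rw [uIoc_of_le zero_le_one] at hs
  exact Ioc_subset_Icc_self hs

end ParametricIntegral

/-! ### Averages and primitives in one coordinate -/

section Primitive

variable {d : ℕ}

/-- The Euclidean space `ℝ^d`. -/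
abbrev Euc (d : ℕ) : Type := EuclideanSpace ℝ (Fin d)

/-- The `a`-th vector of the standard basis of `ℝ^d`. -/
noncomputable abbrev stdVec (a : Fin d) : Euc d := EuclideanSpace.single a (1 : ℝ)

/-- The average of `f` over the unit interval of the `a`-th coordinate. -/
noncomputable def avg (a : Fin d) (f : (Euc d) → ℝ) (x : Euc d) : ℝ :=
  ∫ s in (0 : ℝ)..1, f (x + (s - x a) • stdVec a)

/-- The primitive of `f` in the `a`-th coordinate that vanishes where that coordinate does. -/
noncomputable def prim (a : Fin d) (f : (Euc d) → ℝ) (x : Euc d) : ℝ :=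
  x a * ∫ s in (0 : ℝ)..1, f (x + (s * x a - x a) • stdVec a)

/-- `f` does not depend on the `a`-th coordinate. -/
def IndepOf (a : Fin d) (f : (Euc d) → ℝ) : Prop :=
  ∀ (x : Euc d) (t : ℝ), f (x + t • stdVec a) = f x

variable {a b : Fin d} {f g : (Euc d) → ℝ}

theorem abs_coord_le (x : Euc d) (a : Fin d) : |x a| ≤ ‖x‖ := PiLp.norm_apply_le x a

theorem norm_single_one (a : Fin d) : ‖stdVec a‖ = 1 := by simp

theorem hasFDerivAt_coord (a : Fin d) (x : Euc d) :
    HasFDerivAt (fun x : (Euc d) => x a) (EuclideanSpace.proj a : (Euc d) →L[ℝ] ℝ) x :=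
  (EuclideanSpace.proj a : (Euc d) →L[ℝ] ℝ).hasFDerivAt

theorem contDiff_coord (a : Fin d) {n : WithTop ℕ∞} : ContDiff ℝ n (fun x : (Euc d) => x a) :=
  (EuclideanSpace.proj a : (Euc d) →L[ℝ] ℝ).contDiff

theorem norm_coordProj_le (a : Fin d) : ‖(EuclideanSpace.proj a : (Euc d) →L[ℝ] ℝ)‖ ≤ 1 :=
  ContinuousLinearMap.opNorm_le_bound _ zero_le_one fun x => by
    simpa using abs_coord_le x a

theorem add_smul_single_self (x : Euc d) (a : Fin d) (t : ℝ) :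
    (x + t • stdVec a) a = x a + t := by simp

theorem add_smul_single_of_ne (x : Euc d) (h : b ≠ a) (t : ℝ) :
    (x + t • stdVec a) b = x b := by simp [h]

theorem IndepOf.fderiv_apply (hf : IndepOf a f) (hd : Differentiable ℝ f) (x : Euc d) :
    fderiv ℝ f x (stdVec a) = 0 := by
  have h1 : HasDerivAt (fun t : ℝ => x + t • stdVec a)
      (stdVec a) 0 := by
    simpa using ((hasDerivAt_id (0 : ℝ)).smul_const (stdVec a)).const_add x
  have h2 := HasFDerivAt.comp_hasDerivAt (l := f) (0 : ℝ)
    (by simpa using (hd x).hasFDerivAt) h1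
  have h3 : f ∘ (fun t : ℝ => x + t • stdVec a) = fun _ => f x := by
    ext t; exact hf x t
  rw [h3] at h2
  exact h2.unique (hasDerivAt_const _ _)

theorem IndepOf.sub (hf : IndepOf a f) (hg : IndepOf a g) : IndepOf a (fun x => f x - g x) :=
  fun x t => by simp only [hf x t, hg x t]

theorem avg_indepOf_self : IndepOf a (avg a f) := by
  intro x t
  unfold avg
  congr 1; ext s
  rw [add_smul_single_self, add_assoc, ← add_smul]
  congr 3; ring

theorem avg_indepOf (hf : IndepOf b f) : IndepOf b (avg a f) := by
  rcases eq_or_ne a b with rfl | h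
  · exact avg_indepOf_self
  intro x t
  unfold avg
  congr 1; ext s
  rw [add_smul_single_of_ne x h, add_right_comm, hf]

theorem prim_indepOf (h : a ≠ b) (hf : IndepOf b f) : IndepOf b (prim a f) := by
  intro x t
  unfold prim
  rw [add_smul_single_of_ne x h]
  congr 2; ext s
  rw [add_right_comm, hf]

theorem prim_eq_zero {x : Euc d} (hx : x a = 0) : prim a f x = 0 := by simp [prim, hx]

/-- Together with `prim_eq_zero`: the primitive of a function of zero average vanishes on both faces
of the cube transverse to `a`. -/
theorem prim_eq_avg {x : Euc d} (hx : x a = 1) : prim a f x = avg a f x := by simp [prim, avg, hx]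

theorem contDiff_slice_avg (hf : ContDiff ℝ 1 f) : ContDiff ℝ 1 fun z : (Euc d) × ℝ =>
    f (z.1 + (z.2 - z.1 a) • stdVec a) :=
  hf.comp (contDiff_fst.add ((contDiff_snd.sub ((contDiff_coord a).comp contDiff_fst)).smul
    contDiff_const))

theorem contDiff_slice_prim (hf : ContDiff ℝ 1 f) : ContDiff ℝ 1 fun z : (Euc d) × ℝ =>
    f (z.1 + (z.2 * z.1 a - z.1 a) • stdVec a) :=
  hf.comp (contDiff_fst.add (((contDiff_snd.mul ((contDiff_coord a).comp contDiff_fst)).sub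
    ((contDiff_coord a).comp contDiff_fst)).smul contDiff_const))

theorem contDiff_avg (hf : ContDiff ℝ 1 f) : ContDiff ℝ 1 (avg a f) :=
  contDiff_integral_of_contDiff (contDiff_slice_avg hf)

theorem contDiff_prim (hf : ContDiff ℝ 1 f) : ContDiff ℝ 1 (prim a f) :=
  (contDiff_coord a).mul (contDiff_integral_of_contDiff (contDiff_slice_prim hf))

theorem abs_avg_le {B : ℝ} (hB : ∀ x, |f x| ≤ B) (x : Euc d) : |avg a f x| ≤ B := by
  rw [avg]
  simpa using intervalIntegral.norm_integral_le_of_norm_le_const (a := (0 : ℝ)) (b := 1)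
    (f := fun s => f (x + (s - x a) • stdVec a)) fun s _ => hB _

/-- Serves both `avg` and `prim`: in each, the argument of `f` is moved along `stdVec a` by an
amount affine in `x a`, of slope `k` with `|k| ≤ 1`; whence the factor `2`. -/
theorem norm_fderiv_slice_le {B : ℝ} (hf : ContDiff ℝ 1 f)
    (hB : ∀ x, ‖fderiv ℝ f x‖ ≤ B) {c : ℝ → (Euc d) → ℝ} {s : ℝ} {x : Euc d} {k : ℝ} (hk : |k| ≤ 1)
    (hF : Differentiable ℝ fun z : (Euc d) × ℝ => f (z.1 + c z.2 z.1 • stdVec a))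
    (hc : HasFDerivAt (c s) (k • (EuclideanSpace.proj a : (Euc d) →L[ℝ] ℝ)) x) :
    ‖(fderiv ℝ (fun z : (Euc d) × ℝ => f (z.1 + c z.2 z.1 • stdVec a))
      (x, s)).comp (ContinuousLinearMap.inl ℝ (Euc d) ℝ)‖ ≤ 2 * B := by
  have h1 := HasFDerivAt.comp x
    (g := fun z : (Euc d) × ℝ => f (z.1 + c z.2 z.1 • stdVec a))
    (f := fun y : (Euc d) => (y, s)) (hF (x, s)).hasFDerivAt
    ((hasFDerivAt_id x).prodMk (hasFDerivAt_const s x))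
  have h2 := HasFDerivAt.comp x (g := f)
    (f := fun y : (Euc d) => y + c s y • stdVec a)
    (hf.differentiable (by simp) _).hasFDerivAt ((hasFDerivAt_id x).add (hc.smul_const _))
  have h3 := h1.unique h2
  have h4 : (ContinuousLinearMap.id ℝ (Euc d)).prod (0 : (Euc d) →L[ℝ] ℝ) = ContinuousLinearMap.inl ℝ (Euc d) ℝ := rfl
  rw [h4] at h3
  rw [h3]
  refine (ContinuousLinearMap.opNorm_comp_le _ _).trans ?_
  rw [mul_comm]
  have hB0 : 0 ≤ B := (norm_nonneg _).trans (hB 0)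
  refine mul_le_mul ?_ (hB _) (norm_nonneg _) zero_le_two
  refine (norm_add_le _ _).trans ?_
  rw [ContinuousLinearMap.norm_smulRight_apply, norm_single_one, mul_one, norm_smul, Real.norm_eq_abs]
  have := ContinuousLinearMap.norm_id_le (𝕜 := ℝ) (E := (Euc d))
  have := mul_le_mul hk (norm_coordProj_le a) (norm_nonneg _) zero_le_one
  linarith

theorem norm_fderiv_avg_le {B : ℝ} (hf : ContDiff ℝ 1 f) (hB : ∀ x, ‖fderiv ℝ f x‖ ≤ B) (x : Euc d) :
    ‖fderiv ℝ (avg a f) x‖ ≤ 2 * B := by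
  refine norm_fderiv_integral_le (contDiff_slice_avg hf) fun s _ => ?_
  refine norm_fderiv_slice_le (c := fun s x => s - x a) (k := -1) hf hB (by simp)
    ((contDiff_slice_avg hf).differentiable (by simp)) ?_
  simpa using (hasFDerivAt_coord a x).const_sub s

theorem abs_prim_le {B : ℝ} (hB : ∀ x, |f x| ≤ B) (x : Euc d) : |prim a f x| ≤ ‖x‖ * B := by
  rw [prim, abs_mul]
  refine mul_le_mul (abs_coord_le x a) ?_ (abs_nonneg _) (norm_nonneg _)
  simpa using intervalIntegral.norm_integral_le_of_norm_le_const (a := (0 : ℝ)) (b := 1)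
    (f := fun s => f (x + (s * x a - x a) • stdVec a)) fun s _ => hB _

theorem norm_fderiv_prim_le {B : ℝ} (hf : ContDiff ℝ 1 f) (hB0 : ∀ x, |f x| ≤ B)
    (hB : ∀ x, ‖fderiv ℝ f x‖ ≤ B) (x : Euc d) :
    ‖fderiv ℝ (prim a f) x‖ ≤ (1 + 2 * ‖x‖) * B := by
  have h1 := contDiff_integral_of_contDiff (contDiff_slice_prim (a := a) hf)
  have h2 := (hasFDerivAt_coord a x).mul ((h1.differentiable (by simp)) x).hasFDerivAt
  have h3 : fderiv ℝ (prim a f) x = _ := h2.fderiv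
  rw [h3]
  have hBnn : 0 ≤ B := (norm_nonneg _).trans (hB 0)
  have h4 : ‖fderiv ℝ (fun x : (Euc d) => ∫ s in (0 : ℝ)..1,
      f (x + (s * x a - x a) • stdVec a)) x‖ ≤ 2 * B := by
    refine norm_fderiv_integral_le (contDiff_slice_prim hf) fun s hs => ?_
    refine norm_fderiv_slice_le (c := fun s x => s * x a - x a) (k := s - 1) hf hB
      (abs_le.2 ⟨by linarith [hs.1], by linarith [hs.2]⟩)
      ((contDiff_slice_prim hf).differentiable (by simp)) ?_
    have := ((hasFDerivAt_coord a x).const_mul s).sub (hasFDerivAt_coord a x)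
    rw [sub_smul, one_smul]
    exact this
  have h5 : ‖∫ s in (0 : ℝ)..1, f (x + (s * x a - x a) • stdVec a)‖ ≤ B := by
    simpa using intervalIntegral.norm_integral_le_of_norm_le_const (a := (0 : ℝ)) (b := 1)
      (f := fun s => f (x + (s * x a - x a) • stdVec a)) fun s _ => hB0 _
  refine (norm_add_le _ _).trans ?_
  rw [norm_smul, norm_smul, Real.norm_eq_abs]
  have := mul_le_mul (abs_coord_le x a) h4 (norm_nonneg _) (norm_nonneg _)
  have := mul_le_mul h5 (norm_coordProj_le a) (norm_nonneg _) hBnn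
  linarith

/-- A substitution. The fixed interval in the definition of `prim` gives regularity in all
variables; the variable end point here gives the derivative along `stdVec a`. -/
theorem prim_eq_integral (f : (Euc d) → ℝ) (x : Euc d) :
    prim a f x = ∫ s in (0 : ℝ)..x a, f (x + (s - x a) • stdVec a) := by
  have := intervalIntegral.smul_integral_comp_mul_right (a := 0) (b := 1)
    (fun s => f (x + (s - x a) • stdVec a)) (x a)
  rw [zero_mul, one_mul] at this
  exact this

theorem fderiv_prim_apply (hf : ContDiff ℝ 1 f) (x : Euc d) :
    fderiv ℝ (prim a f) x (stdVec a) = f x := by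
  have h1 : HasDerivAt (fun t : ℝ => x + t • stdVec a)
      (stdVec a) 0 := by
    simpa using ((hasDerivAt_id (0 : ℝ)).smul_const (stdVec a)).const_add x
  have h2 := HasFDerivAt.comp_hasDerivAt (l := prim a f) (0 : ℝ)
    (by simpa using ((contDiff_prim hf).differentiable (by simp) x).hasFDerivAt) h1
  have h3 : prim a f ∘ (fun t : ℝ => x + t • stdVec a) =
      fun t => ∫ s in (0 : ℝ)..x a + t, f (x + (s - x a) • stdVec a) := by
    ext t
    rw [Function.comp_apply, prim_eq_integral, add_smul_single_self]
    congr 1; ext s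
    rw [add_assoc, ← add_smul]
    congr 3; ring
  rw [h3] at h2
  have hc : Continuous fun s : ℝ => f (x + (s - x a) • stdVec a) :=
    hf.continuous.comp (by fun_prop)
  have h4 := (intervalIntegral.integral_hasDerivAt_right (hc.intervalIntegrable 0 (x a + 0))
    (hc.stronglyMeasurableAtFilter _ _) hc.continuousAt).comp_const_add (x a) 0
  rw [h2.unique h4]
  simp

end Primitive

end WeakShadowing

namespace WeakShadowing

/-! ### Volume preserving maps from generating functions -/

section SmallFunctions

variable {E : Type*} [NormedAddCommGroup E] [NormedSpace ℝ E]

/-- `w` is `C¹` and bounded by `η`, together with its derivative, on the ball of radius `r`. -/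
def SmallOn (r η : ℝ) (w : E → ℝ) : Prop :=
  ContDiff ℝ 1 w ∧ ∀ x, ‖x‖ ≤ r → |w x| ≤ η ∧ ‖fderiv ℝ w x‖ ≤ η

theorem fderiv_eq_zero_of_eq_zero_off_closedBall {K : E → ℝ} {r : ℝ}
    (hK : ∀ x, r < ‖x‖ → K x = 0) {x : E} (hx : r < ‖x‖) : fderiv ℝ K x = 0 := by
  have h : K =ᶠ[𝓝 x] fun _ => 0 := by
    filter_upwards [(isOpen_lt continuous_const continuous_norm).mem_nhds hx] with y hy using hK y hy
  rw [h.fderiv_eq, fderiv_fun_const]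
  rfl

theorem exists_norm_fderiv_mul_le [FiniteDimensional ℝ E] {K : E → ℝ} {r : ℝ} (hr : 0 ≤ r)
    (hK : ContDiff ℝ 1 K) (hK0 : ∀ x, r < ‖x‖ → K x = 0) :
    ∃ C, 0 ≤ C ∧ ∀ (η : ℝ) (w : E → ℝ), SmallOn r η w →
      ∀ x, ‖fderiv ℝ (fun x => K x * w x) x‖ ≤ C * η := by
  have : ProperSpace E := FiniteDimensional.proper ℝ E
  obtain ⟨B, hB⟩ := (isCompact_closedBall (0 : E) r).exists_bound_of_continuousOn
    hK.continuous.continuousOn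
  obtain ⟨B', hB'⟩ := (isCompact_closedBall (0 : E) r).exists_bound_of_continuousOn
    (hK.continuous_fderiv (by simp)).continuousOn
  refine ⟨|B| + |B'|, by positivity, fun η w hw x => ?_⟩
  have h0 : 0 ≤ η := (abs_nonneg _).trans (hw.2 0 (by simpa using hr)).1
  have hd : fderiv ℝ (fun x => K x * w x) x = K x • fderiv ℝ w x + w x • fderiv ℝ K x :=
    ((hK.differentiable (by simp) x).hasFDerivAt.mul
      (hw.1.differentiable (by simp) x).hasFDerivAt).fderiv
  rw [hd]
  rcases le_or_gt ‖x‖ r with hx | hx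
  · refine (norm_add_le _ _).trans ?_
    rw [norm_smul, norm_smul, add_mul]
    have hx' : x ∈ Metric.closedBall (0 : E) r := by simpa using hx
    refine add_le_add (mul_le_mul ((hB x hx').trans (le_abs_self _)) (hw.2 x hx).2 (norm_nonneg _)
      (abs_nonneg _)) ?_
    rw [mul_comm]
    exact mul_le_mul ((hB' x hx').trans (le_abs_self _)) (hw.2 x hx).1 (norm_nonneg _)
      (abs_nonneg _)
  · rw [hK0 x hx, fderiv_eq_zero_of_eq_zero_off_closedBall hK0 hx]
    simp only [zero_smul, smul_zero, add_zero, norm_zero]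
    positivity

/-- The volume preserving map with generating function `K * w`, where `w` does not vary along
`v` and `∂ᵤ w = g`. -/
theorem exists_volPert_of_generating [FiniteDimensional ℝ E] {K : E → ℝ} {r : ℝ} (hr : 0 ≤ r)
    (hK : ContDiff ℝ ∞ K) (hK0 : ∀ x, r < ‖x‖ → K x = 0) (u v : E) :
    ∃ C, 0 ≤ C ∧ ∀ (η : ℝ) (w g : E → ℝ), C * η ≤ 1 / 2 → SmallOn r η w → SmallOn r η g →
      (∀ x, fderiv ℝ w x v = 0) → (∀ x, fderiv ℝ g x v = 0) → (∀ x, fderiv ℝ w x u = g x) →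
      (∀ x, ‖fderiv ℝ (fun x => fderiv ℝ K x v * w x) x‖ * ‖u‖ ≤ C * η) ∧
      ∃ φ : E → E, VolPert (4 * (C * η)) (Metric.closedBall 0 r) φ ∧
        ∀ x, φ (x + (fderiv ℝ K x v * w x) • u) =
          x + (fderiv ℝ K x u * w x + K x * g x) • v := by
  have hK1 : ContDiff ℝ 1 K := hK.of_le (by simp)
  have hKd : ∀ z : E, ContDiff ℝ 1 fun x => fderiv ℝ K x z := fun z =>
    (hK.fderiv_right (m := 1) (by norm_cast)).clm_apply contDiff_const
  have hKd0 : ∀ z x : E, r < ‖x‖ → fderiv ℝ K x z = 0 := fun z x hx => by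
    rw [fderiv_eq_zero_of_eq_zero_off_closedBall hK0 hx]; rfl
  obtain ⟨C1, hC1, h1⟩ := exists_norm_fderiv_mul_le hr hK1 hK0
  obtain ⟨C2, hC2, h2⟩ := exists_norm_fderiv_mul_le hr (hKd u) (hKd0 u)
  obtain ⟨C3, hC3, h3⟩ := exists_norm_fderiv_mul_le hr (hKd v) (hKd0 v)
  refine ⟨(C2 + C1) * ‖v‖ + C3 * ‖u‖, by positivity, fun η w g hη hw hg hwv hgv hwu => ?_⟩
  have h0 : 0 ≤ η := (abs_nonneg _).trans (hw.2 0 (by simpa using hr)).1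
  have hq : ∀ x, ‖fderiv ℝ (fun x => fderiv ℝ K x v * w x) x‖ * ‖u‖ ≤
      ((C2 + C1) * ‖v‖ + C3 * ‖u‖) * η := fun x => by
    have := mul_le_mul_of_nonneg_right (h3 η w hw x) (norm_nonneg u)
    have : 0 ≤ (C2 + C1) * ‖v‖ * η := by positivity
    nlinarith
  have hdiff : ∀ {k : E → ℝ}, ContDiff ℝ 1 k → Differentiable ℝ k :=
    fun h => h.differentiable (by simp)
  have hp1 := (hKd u).mul hw.1
  have hp2 := hK1.mul hg.1
  refine ⟨hq, exists_volPert_of_deriv_eq hη (hp1.add hp2) ((hKd v).mul hw.1) (fun x => ?_) hq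
    (fun x hx => ?_) (fun x hx => ?_) (fun x => ?_)⟩
  · have e1 : fderiv ℝ (fun x => fderiv ℝ K x u * w x + K x * g x) x =
        fderiv ℝ (fun x => fderiv ℝ K x u * w x) x + fderiv ℝ (fun x => K x * g x) x :=
      fderiv_add (hdiff hp1 x) (hdiff hp2 x)
    rw [e1]
    have := norm_add_le (fderiv ℝ (fun x => fderiv ℝ K x u * w x) x)
      (fderiv ℝ (fun x => K x * g x) x)
    have := mul_le_mul_of_nonneg_right (this.trans (add_le_add (h2 η w hw x) (h1 η g hg x)))
      (norm_nonneg v)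
    have : 0 ≤ C3 * ‖u‖ * η := by positivity
    nlinarith
  · have hx' : r < ‖x‖ := by simpa using hx
    simp [hKd0 u x hx', hK0 x hx']
  · have hx' : r < ‖x‖ := by simpa using hx
    simp [hKd0 v x hx']
  -- The identity to prove is `∂ᵥ∂ᵤ(K * w) = ∂ᵤ∂ᵥ(K * w)`. Although `w` is only `C¹`, it makes
  -- sense: `∂ᵥ w = ∂ᵥ g = 0` and `∂ᵤ w = g`, so the only second derivatives that occur are those of
  -- the smooth `K`.
  · have hsymm : fderiv ℝ (fun x => fderiv ℝ K x u) x v = fderiv ℝ (fun x => fderiv ℝ K x v) x u := by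
      have hd2 : DifferentiableAt ℝ (fderiv ℝ K) x :=
        (hK.fderiv_right (m := 1) (by norm_cast)).differentiable (by simp) x
      have key : ∀ z y : E, fderiv ℝ (fun x => fderiv ℝ K x z) x y =
          fderiv ℝ (fderiv ℝ K) x y z := fun z y => by
        rw [fderiv_clm_apply hd2 (differentiableAt_const z)]
        simp
      rw [key, key]
      exact (hK.contDiffAt (x := x)).isSymmSndFDerivAt
        (by rw [minSmoothness_of_isRCLikeNormedField]; exact WithTop.coe_le_coe.2 (le_top (a := (2 : ℕ∞)))) v u
    have d1 : ∀ k l : E → ℝ, ContDiff ℝ 1 k → ContDiff ℝ 1 l → ∀ z,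
        fderiv ℝ (fun x => k x * l x) x z = k x * fderiv ℝ l x z + l x * fderiv ℝ k x z := by
      intro k l hk hl z
      have := ((hdiff hk x).hasFDerivAt.mul (hdiff hl x).hasFDerivAt).fderiv
      exact congrArg (fun L : E →L[ℝ] ℝ => L z) this
    have e1 : fderiv ℝ (fun x => fderiv ℝ K x u * w x + K x * g x) x =
        fderiv ℝ (fun x => fderiv ℝ K x u * w x) x + fderiv ℝ (fun x => K x * g x) x :=
      fderiv_add (hdiff hp1 x) (hdiff hp2 x)
    change fderiv ℝ (fun x => fderiv ℝ K x u * w x + K x * g x) x v =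
      fderiv ℝ (fun x => fderiv ℝ K x v * w x) x u
    rw [e1, add_apply, d1 _ _ (hKd u) hw.1, d1 _ _ hK1 hg.1,
      d1 _ _ (hKd v) hw.1, hwv, hgv, hwu, hsymm]
    ring

end SmallFunctions

/-! ### Shears localized at a face of the cube -/

section FaceShear

variable {d : ℕ}

/-- A bump function on the line, localizing at a face of the unit cube. -/
noncomputable def faceBump : ContDiffBump (0 : ℝ) := ⟨3 / 8, 1 / 2, by norm_num, by norm_num⟩

theorem faceBump_one {t : ℝ} (ht : |t| ≤ 3 / 8) : faceBump t = 1 :=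
  faceBump.one_of_mem_closedBall (by simpa [faceBump] using ht)

theorem faceBump_zero {t : ℝ} (ht : 1 / 2 ≤ |t|) : faceBump t = 0 :=
  faceBump.zero_of_le_dist (by simpa [faceBump] using ht)

theorem contDiff_faceBump : ContDiff ℝ ∞ faceBump := faceBump.contDiff

theorem hasFDerivAt_faceBump_coord (b : Fin d) (s : ℝ) (x : Euc d) :
    HasFDerivAt (fun x : Euc d => faceBump (x b - s))
      (deriv faceBump (x b - s) • (EuclideanSpace.proj b : Euc d →L[ℝ] ℝ)) x :=
  HasDerivAt.comp_hasFDerivAt (h₂ := faceBump) (f := fun x : Euc d => x b - s) x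
    ((contDiff_faceBump.differentiable (by simp) (x b - s)).hasDerivAt)
    ((hasFDerivAt_coord b x).sub_const s)

theorem deriv_faceBump_of_lt {t : ℝ} (ht : |t| < 3 / 8) : deriv faceBump t = 0 := by
  have h : (faceBump : ℝ → ℝ) =ᶠ[𝓝 t] fun _ => 1 := by
    filter_upwards [(isOpen_lt continuous_abs continuous_const).mem_nhds ht] with y hy
      using faceBump_one (le_of_lt hy)
  rw [h.deriv_eq, deriv_const]

/-- A volume preserving perturbation which, inside the ball of radius `R`, shears in the direction
of the `b`-th coordinate near the face `x b = s`, sending the height `x b` to `x b + v x`. -/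
theorem exists_faceShear {a b : Fin d} (hab : a ≠ b) (s : ℝ) {R : ℝ} (hR : 0 < R) :
    ∃ C, 0 ≤ C ∧ ∀ (η : ℝ) (w v : Euc d → ℝ), C * η ≤ 1 / 2 → SmallOn (R + 1) η w →
      SmallOn (R + 1) η v → IndepOf b w → IndepOf b v → (∀ x, fderiv ℝ w x (stdVec a) = v x) →
      ∃ φ : Euc d → Euc d, VolPert (4 * (C * η)) (Metric.closedBall 0 (R + 1)) φ ∧
        (∀ x k, k ≠ a → k ≠ b → φ x k = x k) ∧
        (∀ x, ‖x‖ < R → |x b - s| < 3 / 8 → φ x = x + v x • stdVec b) ∧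
        (∀ x, 1 / 2 < |x b - s| → φ x = x) ∧
        (∀ σ, (∀ x, x a = σ → w x = 0) →
          ∀ x, (σ < φ x a ↔ σ < x a) ∧ (φ x a < σ ↔ x a < σ)) ∧
        (∀ c : ℝ, (∀ x, w x = c) → ∀ x,
          ‖x - (c * deriv faceBump (x b - s)) • stdVec a‖ < R →
          φ x = x - (c * deriv faceBump (x b - s)) • stdVec a) := by
  let κ : ContDiffBump (0 : Euc d) := ⟨R, R + 1, hR, by linarith⟩
  have hκ1 : ∀ x : Euc d, ‖x‖ ≤ R → κ x = 1 := fun x hx =>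
    κ.one_of_mem_closedBall (by simpa [κ] using hx)
  have hκ0 : ∀ x : Euc d, R + 1 ≤ ‖x‖ → κ x = 0 := fun x hx =>
    κ.zero_of_le_dist (by simpa [κ] using hx)
  set K : Euc d → ℝ := fun x => κ x * faceBump (x b - s) with hKdef
  have hK : ContDiff ℝ ∞ K := κ.contDiff.mul
    (contDiff_faceBump.comp ((contDiff_coord b).sub contDiff_const))
  have hK0 : ∀ x, R + 1 < ‖x‖ → K x = 0 := fun x hx => by simp [K, hκ0 x hx.le]
  -- In the ball `K` depends on `x b` only, and it is constantly `1` within `3/8` of the face.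
  have hKfd : ∀ x, ‖x‖ < R → fderiv ℝ K x =
      deriv faceBump (x b - s) • (EuclideanSpace.proj b : Euc d →L[ℝ] ℝ) := by
    intro x hx
    have h : K =ᶠ[𝓝 x] fun x => faceBump (x b - s) := by
      filter_upwards [(isOpen_lt continuous_norm continuous_const).mem_nhds hx] with y hy
      simp [K, hκ1 y (le_of_lt hy)]
    rw [h.fderiv_eq, (hasFDerivAt_faceBump_coord b s x).fderiv]
  have hKfar : ∀ x, 1 / 2 < |x b - s| → K x = 0 ∧ fderiv ℝ K x = 0 := by
    intro x hx
    have hK' : ∀ y : Euc d, 1 / 2 < |y b - s| → K y = 0 := fun y hy => by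
      simp [K, faceBump_zero hy.le]
    refine ⟨hK' x hx, ?_⟩
    have hc : Continuous fun y : Euc d => |y b - s| := by fun_prop
    have h : K =ᶠ[𝓝 x] fun _ => 0 := by
      filter_upwards [(isOpen_lt continuous_const hc).mem_nhds hx] with y hy using hK' y hy
    rw [h.fderiv_eq, fderiv_fun_const]; rfl
  obtain ⟨C, hC, H⟩ := exists_volPert_of_generating (by linarith) hK hK0
    (stdVec a) (stdVec b)
  refine ⟨C, hC, fun η w v hη hw hv hwb hvb hwa => ?_⟩
  obtain ⟨hq, φ, hφ, hφx⟩ := H η w v hη hw hv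
    (fun x => hwb.fderiv_apply (hw.1.differentiable (by simp)) x)
    (fun x => hvb.fderiv_apply (hv.1.differentiable (by simp)) x) hwa
  set q : Euc d → ℝ := fun x => fderiv ℝ K x (stdVec b) * w x with hqdef
  set p : Euc d → ℝ := fun x => fderiv ℝ K x (stdVec a) * w x + K x * v x with hpdef
  have hqC : ContDiff ℝ 1 q :=
    ((hK.fderiv_right (m := 1) (by norm_cast)).clm_apply contDiff_const).mul hw.1
  have hqη : ∀ x, ‖fderiv ℝ q x‖ * ‖stdVec a‖ ≤ 1 / 2 := fun x => (hq x).trans hη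
  have hqlip : ∀ x y, |q x - q y| ≤ 1 / 2 * ‖x - y‖ := fun x y =>
    Convex.norm_image_sub_le_of_norm_fderiv_le
      (fun z _ => hqC.differentiable (by simp) z)
      (fun z _ => by simpa [norm_single_one] using hqη z) convex_univ (mem_univ y) (mem_univ x)
  -- `φ` is known only at points of the form `z + q z • stdVec a`; these are all points.
  have hsurj : ∀ x, ∃ z, z + q z • stdVec a = x := by
    have hN : NearId (1 / 2) fun z => z + q z • stdVec a := by
      refine ⟨contDiff_id.add (hqC.smul contDiff_const), fun x => ?_⟩
      have := (hasFDerivAt_id x).add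
        ((hqC.differentiable (by simp) x).hasFDerivAt.smul_const (stdVec a))
      have h2 : fderiv ℝ (fun z => z + q z • stdVec a) x = _ := this.fderiv
      rw [h2, add_sub_cancel_left, ContinuousLinearMap.norm_smulRight_apply]
      exact hqη x
    exact hN.surjective (by norm_num)
  refine ⟨φ, hφ, fun x k hka hkb => ?_, fun x hx hxb => ?_, fun x hx => ?_, fun σ hσ x => ?_,
    fun c hc x hx => ?_⟩
  · obtain ⟨z, rfl⟩ := hsurj x
    rw [hφx, add_smul_single_of_ne _ hka, add_smul_single_of_ne _ hkb]
  · have h1 : fderiv ℝ K x = 0 := by rw [hKfd x hx, deriv_faceBump_of_lt hxb, zero_smul]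
    have h2 : K x = 1 := by simp [K, hκ1 x hx.le, faceBump_one hxb.le]
    simpa [h1, h2] using hφx x
  · have := hφx x
    simpa [(hKfar x hx).1, (hKfar x hx).2] using this
  · obtain ⟨z, rfl⟩ := hsurj x
    rw [hφx, add_smul_single_self, add_smul_single_of_ne _ hab]
    -- `q` is `1/2`-Lipschitz and vanishes with `w` on `x a = σ`, so displacing `z` by `q z • stdVec
    -- a` cannot carry it across that hyperplane.
    have hz : |q z| ≤ 1 / 2 * |z a - σ| := by
      have h0 : q (z + (σ - z a) • stdVec a) = 0 := by
        simp only [hqdef]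
        rw [hσ _ (by rw [add_smul_single_self]; ring), mul_zero]
      have := hqlip z (z + (σ - z a) • stdVec a)
      rw [h0, sub_zero, sub_add_cancel_left, norm_neg, norm_smul, norm_single_one, mul_one,
        Real.norm_eq_abs, abs_sub_comm] at this
      exact this
    have hz1 := abs_le.1 hz
    rcases lt_trichotomy (z a) σ with h | h | h
    · rw [abs_of_neg (by linarith)] at hz1
      constructor
      · constructor <;> intro <;> linarith [hz1.1, hz1.2]
      · constructor <;> intro <;> linarith [hz1.1, hz1.2]
    · rw [h, sub_self, abs_zero, mul_zero] at hz1
      have hq0 : q z = 0 := by linarith [hz1.1, hz1.2]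
      rw [hq0, add_zero]
      exact ⟨Iff.rfl, Iff.rfl⟩
    · rw [abs_of_pos (by linarith)] at hz1
      constructor
      · constructor <;> intro <;> linarith [hz1.1, hz1.2]
      · constructor <;> intro <;> linarith [hz1.1, hz1.2]
  -- With `w = c` and `v = 0`, the source point is displaced from `z` along `stdVec a` and the
  -- target is `z` itself; so `φ` subtracts the displacement.
  · set z := x - (c * deriv faceBump (x b - s)) • stdVec a with hz
    have hzb : z b = x b := by simp [z, hab.symm]
    have h1 := hKfd z hx
    have hv0 : v z = 0 := by
      have : w = fun _ => c := funext hc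
      rw [← hwa z, this, fderiv_fun_const]; rfl
    have h2 := hφx z
    rw [h1, hzb, hc, hv0] at h2
    have e1 : ((deriv faceBump (x b - s) • (EuclideanSpace.proj b : Euc d →L[ℝ] ℝ)) (stdVec b)) =
        deriv faceBump (x b - s) := by simp
    have e2 : ((deriv faceBump (x b - s) • (EuclideanSpace.proj b : Euc d →L[ℝ] ℝ)) (stdVec a)) =
        0 := by simp [hab.symm]
    rw [e1, e2, zero_mul, mul_zero, add_zero, zero_smul, add_zero] at h2
    rw [← h2]
    congr 1
    rw [hz, mul_comm c]
    abel

end FaceShear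

end WeakShadowing

namespace WeakShadowing

/-! ### Faces pulled back by near-identity maps, and the effect of shears on them -/

section Faces

variable {d : ℕ}

/-- `G` is `η`-close to the identity in the `C¹` sense. -/
structure Near (η : ℝ) (G : Euc d → Euc d) : Prop extends NearId η G where
  norm_sub_le : ∀ x, ‖G x - x‖ ≤ η

theorem Near.comp_volPert [NeZero d] {η ε R : ℝ} {G φ : Euc d → Euc d} (hR : 0 ≤ R)
    (hG : Near η G) (hφ : VolPert ε (Metric.closedBall 0 R) φ) :
    Near (η + ε + η * ε + ε * (2 * R + 1)) (G ∘ φ) := by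
  have hη := hG.nonneg
  have hε := hφ.nonneg
  refine { (hG.toNearId.comp hφ.toNearId).mono ?_ with norm_sub_le := fun x => ?_ }
  · have : 0 ≤ ε * (2 * R + 1) := by positivity
    linarith
  · have h1 := hG.norm_sub_le (φ x)
    have h2 := hφ.norm_sub_le hR x
    have := norm_add_le (G (φ x) - φ x) (φ x - x)
    rw [sub_add_sub_cancel] at this
    rw [Function.comp_apply]
    have : 0 ≤ η * ε := by positivity
    linarith

/-- `w` is `C¹` and bounded by `η`, together with its derivative. -/
def Small (η : ℝ) (w : Euc d → ℝ) : Prop :=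
  ContDiff ℝ 1 w ∧ ∀ x, |w x| ≤ η ∧ ‖fderiv ℝ w x‖ ≤ η

theorem Small.nonneg {η : ℝ} {w : Euc d → ℝ} (h : Small η w) : 0 ≤ η :=
  (abs_nonneg _).trans (h.2 0).1

theorem Small.mono {η δ : ℝ} {w : Euc d → ℝ} (h : Small η w) (hδ : η ≤ δ) : Small δ w :=
  ⟨h.1, fun x => ⟨(h.2 x).1.trans hδ, (h.2 x).2.trans hδ⟩⟩

theorem Small.smallOn {η : ℝ} {w : Euc d → ℝ} (h : Small η w) (r : ℝ) : SmallOn r η w :=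
  ⟨h.1, fun x _ => h.2 x⟩

theorem Small.avg {η : ℝ} {w : Euc d → ℝ} (h : Small η w) (a : Fin d) :
    Small (2 * η) (avg a w) :=
  ⟨contDiff_avg h.1, fun x => ⟨(abs_avg_le (fun y => (h.2 y).1) x).trans (by linarith [h.nonneg]),
    norm_fderiv_avg_le h.1 (fun y => (h.2 y).2) x⟩⟩

theorem SmallOn.mono {r η δ : ℝ} {w : Euc d → ℝ} (h : SmallOn r η w) (hδ : η ≤ δ) :
    SmallOn r δ w :=
  ⟨h.1, fun x hx => ⟨(h.2 x hx).1.trans hδ, (h.2 x hx).2.trans hδ⟩⟩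

theorem Small.prim {η r : ℝ} {w : Euc d → ℝ} (h : Small η w) (a : Fin d) :
    SmallOn r ((1 + 2 * r) * η) (prim a w) := by
  refine ⟨contDiff_prim h.1, fun x hx => ⟨?_, ?_⟩⟩
  · have h1 := abs_prim_le (a := a) (fun y => (h.2 y).1) x
    have h2 := mul_le_mul_of_nonneg_right hx h.nonneg
    have h3 := mul_nonneg ((norm_nonneg _).trans hx) h.nonneg
    nlinarith [h.nonneg]
  · have h1 := norm_fderiv_prim_le (a := a) h.1 (fun y => (h.2 y).1) (fun y => (h.2 y).2) x
    have h2 := mul_le_mul_of_nonneg_right hx h.nonneg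
    nlinarith [h.nonneg]

theorem SmallOn.sub {r η δ : ℝ} {w v : Euc d → ℝ} (hw : SmallOn r η w) (hv : SmallOn r δ v) :
    SmallOn r (η + δ) (fun x => w x - v x) := by
  refine ⟨hw.1.sub hv.1, fun x hx => ⟨?_, ?_⟩⟩
  · exact (abs_sub _ _).trans (add_le_add (hw.2 x hx).1 (hv.2 x hx).1)
  · have : fderiv ℝ (fun x => w x - v x) x = fderiv ℝ w x - fderiv ℝ v x :=
      fderiv_sub (hw.1.differentiable (by simp) x) (hv.1.differentiable (by simp) x)
    rw [this]
    exact (_root_.norm_sub_le _ _).trans (add_le_add (hw.2 x hx).2 (hv.2 x hx).2)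

/-- In the ball of radius `ρ`, the preimage by `G` of the hyperplane `x b = s`, with its two sides,
is the graph `x b = s + u x`. -/
def Face (G : Euc d → Euc d) (b : Fin d) (s : ℝ) (u : Euc d → ℝ) (ρ : ℝ) : Prop :=
  ∀ x, ‖x‖ ≤ ρ → (s < G x b ↔ s + u x < x b) ∧ (G x b < s ↔ x b < s + u x)

/-- Replacing the coordinate `b` of the point by that of its image gives a near-identity map `H`.
The preimage of the hyperplane is its image by `H⁻¹`, and `u` is the height there. The sides are
correct because `G x b` increases with `x b` along lines parallel to `stdVec b`. The factor `4` is
`2` for the inverse times `2` for the projection `P`. -/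
theorem Near.exists_face {η : ℝ} {G : Euc d → Euc d} (hG : Near η G) (hη : η ≤ 1 / 4) (b : Fin d)
    (s : ℝ) : ∃ u, Small (4 * η) u ∧ IndepOf b u ∧ ∀ ρ, Face G b s u ρ := by
  set H : Euc d → Euc d := fun x => x + (G x b - x b) • stdVec b with hH
  have hη0 := hG.nonneg
  have hη1 : η < 1 := by linarith
  have hN : NearId η H := by
    refine ⟨contDiff_id.add ((((contDiff_coord b).comp hG.contDiff).sub (contDiff_coord b)).smul
      contDiff_const), fun x => ?_⟩
    have h1 : HasFDerivAt (fun x => G x b - x b) ((EuclideanSpace.proj b : Euc d →L[ℝ] ℝ).comp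
        (fderiv ℝ G x - ContinuousLinearMap.id ℝ _)) x := by
      rw [ContinuousLinearMap.comp_sub]
      exact ((EuclideanSpace.proj b : Euc d →L[ℝ] ℝ).hasFDerivAt.comp x (hG.hasFDerivAt x)).sub
        (hasFDerivAt_coord b x)
    have h2 : fderiv ℝ H x = _ := ((hasFDerivAt_id x).add (h1.smul_const (stdVec b))).fderiv
    rw [h2, add_sub_cancel_left, ContinuousLinearMap.norm_smulRight_apply, norm_single_one, mul_one]
    refine (ContinuousLinearMap.opNorm_comp_le _ _).trans ?_
    have := mul_le_mul (norm_coordProj_le b) (hG.norm_fderiv_sub_le x) (norm_nonneg _) zero_le_one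
    linarith
  set e := hN.toHomeomorph hη1
  have hS := hN.symm (by linarith)
  set P : Euc d → Euc d := fun x => x + (s - x b) • stdVec b with hP
  have hPd : ∀ x, HasFDerivAt P (ContinuousLinearMap.id ℝ (Euc d) +
      (-(EuclideanSpace.proj b : Euc d →L[ℝ] ℝ)).smulRight (stdVec b)) x := fun x =>
    (hasFDerivAt_id x).add (((hasFDerivAt_coord b x).const_sub s).smul_const (stdVec b))
  have hPb : ∀ x, P x b = s := fun x => by rw [hP]; simp
  have hPc : ContDiff ℝ 1 P :=
    contDiff_id.add ((contDiff_const.sub (contDiff_coord b)).smul contDiff_const)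
  set u : Euc d → ℝ := fun x => e.symm (P x) b - s with hu
  have hGe : ∀ y, G (e.symm y) b = y b := by
    intro y
    have h1 : H (e.symm y) = y := e.apply_symm_apply y
    have h2 := congrArg (fun z : Euc d => z b) h1
    simpa [hH] using h2
  have hform : ∀ x, e.symm (P x) = x + (s + u x - x b) • stdVec b := by
    intro x
    set y := e.symm (P x) with hy
    have h1 : H y = P x := e.apply_symm_apply _
    have h2 : y = x + (s - x b) • stdVec b - (G y b - y b) • stdVec b := by
      rw [← hP] at *
      exact eq_sub_of_add_eq h1
    rw [show G y b = s by rw [hy, hGe, hPb]] at h2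
    rw [h2.trans ?_]
    have : y b = s + u x := by rw [hu]; ring
    rw [this, add_sub_assoc, ← sub_smul]
    congr 2; ring
  have hub : ∀ x, |u x| ≤ η := fun x => by
    have h1 : s = G (e.symm (P x)) b := by rw [hGe, hPb]
    have h2 := abs_coord_le (G (e.symm (P x)) - e.symm (P x)) b
    rw [PiLp.sub_apply, ← h1, abs_sub_comm] at h2
    exact h2.trans (hG.norm_sub_le _)
  refine ⟨u, ⟨?_, fun x => ⟨(hub x).trans (by linarith), ?_⟩⟩, ?_, ?_⟩
  · exact ((contDiff_coord b).comp (hS.contDiff.comp hPc)).sub contDiff_const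
  · have h1 := ((hS.hasFDerivAt (P x)).sub (hasFDerivAt_id (P x))).comp x (hPd x)
    have h2 := (EuclideanSpace.proj b : Euc d →L[ℝ] ℝ).hasFDerivAt.comp x h1
    have h3 : (fun z : Euc d => (EuclideanSpace.proj b : Euc d →L[ℝ] ℝ) z) ∘
        (((e.symm : Euc d → Euc d) - id) ∘ P) = u := by
      ext x
      change (e.symm (P x) - P x) b = u x
      rw [PiLp.sub_apply, hPb]
    have h4 : fderiv ℝ u x = _ := (h3 ▸ h2).fderiv
    rw [h4]
    have n1 : ‖ContinuousLinearMap.id ℝ (Euc d) +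
      (-(EuclideanSpace.proj b : Euc d →L[ℝ] ℝ)).smulRight (stdVec b)‖ ≤ 2 := by
      refine (norm_add_le _ _).trans ?_
      rw [ContinuousLinearMap.norm_smulRight_apply, norm_single_one, mul_one, norm_neg]
      have := ContinuousLinearMap.norm_id_le (𝕜 := ℝ) (E := Euc d)
      linarith [norm_coordProj_le b]
    have n2 := hS.norm_fderiv_sub_le (P x)
    refine (ContinuousLinearMap.opNorm_comp_le _ _).trans ?_
    have n3 := (ContinuousLinearMap.opNorm_comp_le (fderiv ℝ e.symm (P x) -
      ContinuousLinearMap.id ℝ (Euc d)) (ContinuousLinearMap.id ℝ (Euc d) +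
      (-(EuclideanSpace.proj b : Euc d →L[ℝ] ℝ)).smulRight (stdVec b))).trans
      (mul_le_mul n2 n1 (norm_nonneg _) (by linarith))
    have := mul_le_mul (norm_coordProj_le b) n3 (norm_nonneg _) zero_le_one
    linarith
  · intro x t
    have : P (x + t • stdVec b) = P x := by
      simp only [hP]
      rw [add_smul_single_self, add_assoc, ← add_smul]
      congr 2; ring
    simp only [hu, this]
  · intro ρ x _
    have h1 : s = G (e.symm (P x)) b := by rw [hGe, hPb]
    have h2 := abs_coord_le ((G x - x) - (G (e.symm (P x)) - e.symm (P x))) b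
    have h3 := h2.trans (hG.norm_sub_sub_le x (e.symm (P x)))
    have h4 : ‖x - e.symm (P x)‖ = |x b - (s + u x)| := by
      rw [hform, sub_add_cancel_left, norm_neg, norm_smul, norm_single_one, mul_one,
        Real.norm_eq_abs, abs_sub_comm]
    have h5 : e.symm (P x) b = s + u x := by rw [hu]; ring
    rw [h4, PiLp.sub_apply, PiLp.sub_apply, PiLp.sub_apply, ← h1, h5] at h3
    have h6 := abs_le.1 h3
    have h7 : η * |x b - (s + u x)| ≤ 1 / 4 * |x b - (s + u x)| :=
      mul_le_mul_of_nonneg_right hη (abs_nonneg _)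
    rcases lt_trichotomy (x b) (s + u x) with h | h | h
    · rw [abs_of_neg (by linarith)] at h6 h7
      constructor
      · constructor <;> intro <;> linarith [h6.1, h6.2]
      · constructor <;> intro <;> linarith [h6.1, h6.2]
    · rw [h, sub_self, abs_zero, mul_zero] at h6
      constructor
      · constructor <;> intro <;> linarith [h6.1, h6.2]
      · constructor <;> intro <;> linarith [h6.1, h6.2]
    · rw [abs_of_pos (by linarith)] at h6 h7
      constructor
      · constructor <;> intro <;> linarith [h6.1, h6.2]
      · constructor <;> intro <;> linarith [h6.1, h6.2]

/-- `φ` is a volume preserving shear in the direction `b` near the face `x b = s`, where it maps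
the height `x b` to `x b + v x`; it moves only the coordinates `a` and `b`. -/
structure IsFaceShear (a b : Fin d) (s R ε : ℝ) (w v : Euc d → ℝ) (φ : Euc d → Euc d) : Prop
    extends VolPert ε (Metric.closedBall 0 (R + 1)) φ where
  move : ∀ x, ‖φ x - x‖ ≤ ε
  coord : ∀ x k, k ≠ a → k ≠ b → φ x k = x k
  shear : ∀ x, ‖x‖ < R → |x b - s| < 3 / 8 → φ x = x + v x • stdVec b
  far : ∀ x, 1 / 2 < |x b - s| → φ x = x
  side : ∀ σ, (∀ x, x a = σ → w x = 0) → ∀ x, (σ < φ x a ↔ σ < x a) ∧ (φ x a < σ ↔ x a < σ)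
  flux : ∀ c : ℝ, (∀ x, w x = c) → ∀ x, ‖x - (c * deriv faceBump (x b - s)) • stdVec a‖ < R →
    φ x = x - (c * deriv faceBump (x b - s)) • stdVec a

theorem exists_isFaceShear {a b : Fin d} (hab : a ≠ b) (s : ℝ) {R ε : ℝ} (hR : 0 < R)
    (hε : 0 < ε) :
    ∃ η > 0, ∀ w v : Euc d → ℝ, SmallOn (R + 1) η w → SmallOn (R + 1) η v → IndepOf b w →
      IndepOf b v → (∀ x, fderiv ℝ w x (stdVec a) = v x) → ∃ φ, IsFaceShear a b s R ε w v φ := by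
  obtain ⟨C, hC, H⟩ := exists_faceShear hab s hR
  have : Nonempty (Fin d) := ⟨a⟩
  have hpos : 0 < 4 * (C + 1) * (2 * (R + 1) + 1) := by positivity
  set η := min (ε / (4 * (C + 1) * (2 * (R + 1) + 1))) (1 / (2 * (C + 1))) with hη
  have hη0 : 0 < η := lt_min (by positivity) (by positivity)
  refine ⟨η, hη0, fun w v hw hv hwb hvb hwa => ?_⟩
  have h1 : C * η ≤ 1 / 2 := by
    have : η * (2 * (C + 1)) ≤ 1 := (le_div_iff₀ (by positivity)).1 (min_le_right _ _)
    nlinarith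
  have h2 : 4 * (C * η) * (2 * (R + 1) + 1) ≤ ε := by
    have h := (le_div_iff₀ hpos).1 (min_le_left (ε / (4 * (C + 1) * (2 * (R + 1) + 1)))
      (1 / (2 * (C + 1))))
    rw [← hη] at h
    have : 0 ≤ η * (2 * (R + 1) + 1) := by positivity
    nlinarith
  obtain ⟨φ, hφ, h3, h4, h5, h6, h7⟩ := H η w v h1 hw hv hwb hvb hwa
  have hCη : 0 ≤ C * η := by positivity
  exact ⟨φ, { hφ.mono (show 4 * (C * η) ≤ ε by nlinarith) with
    move := fun x => (hφ.norm_sub_le (by linarith) x).trans h2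
    coord := h3, shear := h4, far := h5, side := h6, flux := h7 }⟩

/-- At distance at least `3/8` from the face, neither a displacement of `1/4` nor a height of `1/8`
can change sides. Only points close to a face need a finer argument. -/
theorem face_far {s t y c : ℝ} (hy : |y - t| ≤ 1 / 4) (hc : |c| ≤ 1 / 8) (ht : 3 / 8 ≤ |t - s|) :
    (s < y ↔ s + c < t) ∧ (y < s ↔ t < s + c) := by
  have hy' := abs_le.1 hy
  have hc' := abs_le.1 hc
  rcases le_abs'.1 ht with h | h
  · refine ⟨⟨fun h' => ?_, fun h' => ?_⟩, ⟨fun h' => ?_, fun h' => ?_⟩⟩ <;> by_contra <;> linarith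
  · refine ⟨⟨fun h' => ?_, fun h' => ?_⟩, ⟨fun h' => ?_, fun h' => ?_⟩⟩ <;> by_contra <;> linarith

namespace IsFaceShear

variable {a b : Fin d} {s R ε ζ ρ : ℝ} {w v u : Euc d → ℝ} {φ G : Euc d → Euc d}

theorem abs_comp_sub_le (hφ : IsFaceShear a b s R ε w v φ) (hG : Near ζ G) (hζ : ζ ≤ 1 / 8)
    (hε : ε ≤ 1 / 8) (x : Euc d) (k : Fin d) : |(G ∘ φ) x k - x k| ≤ 1 / 4 := by
  have h1 := abs_coord_le (G (φ x) - x) k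
  rw [PiLp.sub_apply] at h1
  have h2 := norm_add_le (G (φ x) - φ x) (φ x - x)
  rw [sub_add_sub_cancel] at h2
  rw [Function.comp_apply]
  linarith [hG.norm_sub_le (φ x), hφ.move x]

theorem norm_le (hφ : IsFaceShear a b s R ε w v φ) {x : Euc d} (hx : ‖x‖ ≤ ρ) :
    ‖φ x‖ ≤ ρ + ε := by
  have h := norm_add_le x (φ x - x)
  rw [add_sub_cancel] at h
  linarith [hφ.move x]

/-- Near the face `φ` adds `v x` to the height, and `u (φ x) = u x` because `u` does not depend on
the sheared coordinate; so the heights subtract exactly. -/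
theorem face (hφ : IsFaceShear a b s R ε w v φ) (hG : Near ζ G) (hζ : ζ ≤ 1 / 8) (hε : ε ≤ 1 / 8)
    (hρ : ρ < R) (hub : IndepOf b u) (huv : ∀ x, ‖x‖ ≤ ρ → |u x - v x| ≤ 1 / 8)
    (h : Face G b s u (ρ + ε)) : Face (G ∘ φ) b s (fun x => u x - v x) ρ := by
  intro x hx
  rcases lt_or_ge |x b - s| (3 / 8) with hxb | hxb
  · have h1 := h (φ x) (hφ.norm_le hx)
    rw [hφ.shear x (hx.trans_lt hρ) hxb, hub, add_smul_single_self] at h1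
    rw [Function.comp_apply, hφ.shear x (hx.trans_lt hρ) hxb, h1.1, h1.2]
    constructor
    · constructor <;> intro <;> linarith
    · constructor <;> intro <;> linarith
  · exact face_far (hφ.abs_comp_sub_le hG hζ hε x b) (huv x hx) hxb

/-- The opposite face is at distance `1`, and `φ` is the identity at distance more than `1/2` from
its own face. -/
theorem face_other (hφ : IsFaceShear a b s R ε w v φ) (hG : Near ζ G) (hζ : ζ ≤ 1 / 8)
    (hε : ε ≤ 1 / 8) {s' : ℝ} (hs : |s' - s| = 1) (hu : ∀ x, |u x| ≤ 1 / 8)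
    (h : Face G b s' u (ρ + ε)) : Face (G ∘ φ) b s' u ρ := by
  intro x hx
  rcases lt_or_ge |x b - s'| (3 / 8) with hxb | hxb
  · have hfar : 1 / 2 < |x b - s| := by
      have := abs_sub_abs_le_abs_sub (s' - s) (s' - x b)
      rw [hs, abs_sub_comm s' (x b), sub_sub_sub_cancel_left] at this
      linarith
    rw [Function.comp_apply, hφ.far x hfar]
    exact h x (by linarith [hφ.nonneg])
  · exact face_far (hφ.abs_comp_sub_le hG hζ hε x b) (hu x) hxb

theorem face_of_ne (hφ : IsFaceShear a b s R ε w v φ) {k : Fin d} (ha : k ≠ a) (hb : k ≠ b)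
    {s' : ℝ} (h : Face G k s' 0 (ρ + ε)) : Face (G ∘ φ) k s' 0 ρ := by
  intro x hx
  have := h (φ x) (hφ.norm_le hx)
  rw [hφ.coord x k ha hb] at this
  exact this

/-- Faces transverse to the auxiliary direction `a` survive when the generating function vanishes on
them, by the clause `side`. -/
theorem face_side (hφ : IsFaceShear a b s R ε w v φ) {s' : ℝ} (hw : ∀ x, x a = s' → w x = 0)
    (h : Face G a s' 0 (ρ + ε)) : Face (G ∘ φ) a s' 0 ρ := by
  intro x hx
  have h1 := h (φ x) (hφ.norm_le hx)
  have h2 := hφ.side s' hw x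
  simp only [Pi.zero_apply, add_zero] at h1 ⊢
  rw [Function.comp_apply, h1.1, h1.2]
  exact h2

end IsFaceShear

end Faces

end WeakShadowing

namespace WeakShadowing

/-! ### Straightening the faces of the cube -/

section Cube

variable {d : ℕ}

/-- The two values of a coordinate on the faces of the unit cube. -/
def level (t : Bool) : ℝ := if t then 1 else 0

theorem abs_level_sub {t t' : Bool} (h : t ≠ t') : |level t - level t'| = 1 := by
  cases t <;> cases t' <;> simp_all [level]

/-- A perturbation of a near-identity map by a small volume preserving map is near the identity. -/
theorem exists_near_comp [NeZero d] {R ε : ℝ} (hR : 0 ≤ R) (hε : 0 < ε) :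
    ∃ δ > 0, ∀ (G φ : Euc d → Euc d), Near δ G → VolPert δ (Metric.closedBall 0 R) φ →
      Near ε (G ∘ φ) := by
  refine ⟨min 1 (ε / (2 * R + 4)), lt_min one_pos (by positivity), fun G φ hG hφ => ?_⟩
  set δ := min 1 (ε / (2 * R + 4))
  have h := hG.comp_volPert hR hφ
  have h0 := hG.nonneg
  have h1 : δ ≤ 1 := min_le_left _ _
  have h2 : δ * (2 * R + 4) ≤ ε := (le_div_iff₀ (by positivity)).1 (min_le_right _ _)
  have h3 : δ + δ + δ * δ + δ * (2 * R + 1) ≤ ε := by nlinarith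
  exact { h.toNearId.mono h3 with norm_sub_le := fun x => (h.norm_sub_le x).trans h3 }

theorem exists_volPert_comp {K : Set (Euc d)} {ε : ℝ} (hε : 0 < ε) :
    ∃ δ > 0, ∀ φ ψ : Euc d → Euc d, VolPert δ K φ → VolPert δ K ψ → VolPert ε K (φ ∘ ψ) := by
  refine ⟨min 1 (ε / 3), lt_min one_pos (by positivity), fun φ ψ hφ hψ => (hφ.comp hψ).mono ?_⟩
  have h0 := hφ.nonneg
  have h1 : min 1 (ε / 3) ≤ 1 := min_le_left _ _
  have h2 : min 1 (ε / 3) ≤ ε / 3 := min_le_right _ _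
  nlinarith

theorem Near.mono {η δ : ℝ} {G : Euc d → Euc d} (hG : Near η G) (h : η ≤ δ) : Near δ G :=
  { hG.toNearId.mono h with norm_sub_le := fun x => (hG.norm_sub_le x).trans h }

theorem Face.mono {G : Euc d → Euc d} {b : Fin d} {s ρ ρ' : ℝ} {u : Euc d → ℝ}
    (h : Face G b s u ρ) (hρ : ρ' ≤ ρ) : Face G b s u ρ' := fun x hx => h x (hx.trans hρ)

theorem indepOf_zero (b : Fin d) : IndepOf b (0 : Euc d → ℝ) := fun _ _ => rfl

/-- The faces of the cube transverse to any direction but `l` can be straightened. -/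
theorem exists_straighten_sides {l : Fin d} {R : ℝ} (hR : 0 < R) (T : Finset (Fin d × Bool))
    (hT : ∀ f ∈ T, f.1 ≠ l) : ∀ ρ, ρ < R → ∀ ε > 0, ∃ η > 0, ∀ G : Euc d → Euc d, Near η G →
      ∃ φ, VolPert ε (Metric.closedBall 0 (R + 1)) φ ∧
        ∀ f ∈ T, Face (G ∘ φ) f.1 (level f.2) 0 ρ := by
  have : NeZero d := ⟨by rintro rfl; exact l.elim0⟩
  induction T using Finset.induction_on with
  | empty => exact fun ρ _ ε hε => ⟨1, one_pos, fun G _ => ⟨id, VolPert.id.mono hε.le, by simp⟩⟩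
  | insert f T hf ih =>
    intro ρ hρ ε hε
    obtain ⟨j, t⟩ := f
    have hjl : j ≠ l := hT _ (Finset.mem_insert_self _ _)
    obtain ⟨δ1, hδ1, hcomp⟩ := exists_volPert_comp (K := Metric.closedBall (0 : Euc d) (R + 1)) hε
    set ε2 := min δ1 (min (1 / 8) ((R - ρ) / 2)) with hε2
    have hε2pos : 0 < ε2 := lt_min hδ1 (lt_min (by norm_num) (by linarith))
    have hε2a : ε2 ≤ δ1 := min_le_left _ _
    have hε2b : ε2 ≤ 1 / 8 := (min_le_right _ _).trans (min_le_left _ _)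
    have hε2c : ε2 ≤ (R - ρ) / 2 := (min_le_right _ _).trans (min_le_right _ _)
    obtain ⟨η2, hη2, hshear⟩ := exists_isFaceShear hjl.symm (level t) hR hε2pos
    set ζ := min (1 / 32) (η2 / (4 * (1 + 2 * (R + 1)))) with hζ
    have hζpos : 0 < ζ := lt_min (by norm_num) (by positivity)
    have hζ1 : ζ ≤ 1 / 32 := min_le_left _ _
    have hζ2 : ζ * (4 * (1 + 2 * (R + 1))) ≤ η2 :=
      (le_div_iff₀ (by positivity)).1 (min_le_right _ _)
    obtain ⟨δ2, hδ2, hnear⟩ := exists_near_comp (d := d) (R := R + 1) (by linarith) hζpos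
    obtain ⟨η1, hη1, H⟩ := ih (fun f hf => hT f (Finset.mem_insert_of_mem hf)) ((ρ + R) / 2)
      (by linarith) (min δ1 δ2) (lt_min hδ1 hδ2)
    refine ⟨min η1 δ2, lt_min hη1 hδ2, fun G hG => ?_⟩
    obtain ⟨φ1, hφ1, hF⟩ := H G (hG.mono (min_le_left _ _))
    have hG1 := hnear G φ1 (hG.mono (min_le_right _ _)) (hφ1.mono (min_le_right _ _))
    -- The whole height `u` is removed, with `l` as auxiliary direction. This can only disturb the
    -- faces transverse to `l`, which are not in `T`.
    obtain ⟨u, hu, hub, huF⟩ := hG1.exists_face (by linarith) j (level t)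
    have hζR : 0 ≤ ζ * (R + 1) := by positivity
    obtain ⟨φ2, hφ2⟩ := hshear (prim l u) u
      ((hu.prim l).mono (by nlinarith)) ((hu.smallOn _).mono (by nlinarith))
      (prim_indepOf hjl.symm hub) hub (fderiv_prim_apply hu.1)
    refine ⟨φ1 ∘ φ2, hcomp _ _ (hφ1.mono (min_le_left _ _)) (hφ2.toVolPert.mono hε2a), ?_⟩
    rw [← Function.comp_assoc]
    intro f hf'
    rcases Finset.mem_insert.1 hf' with rfl | hfT
    · have := hφ2.face (ρ := ρ) hG1 (by linarith) hε2b hρ hub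
        (fun x _ => by rw [sub_self, abs_zero]; norm_num) (huF _)
      simp only [sub_self] at this
      exact this
    · obtain ⟨j', t'⟩ := f
      have hF' := (hF _ hfT).mono (show ρ + ε2 ≤ (ρ + R) / 2 by linarith)
      by_cases hj : j' = j
      · subst hj
        have htt : t' ≠ t := by rintro rfl; exact hf hfT
        exact hφ2.face_other hG1 (by linarith) hε2b (abs_level_sub htt) (by simp) hF'
      · exact hφ2.face_of_ne (hT _ (Finset.mem_insert_of_mem hfT)) hj hF'

/-- In the ball of radius `ρ`, the map `G` preserves the faces of the unit cube transverse to the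
directions other than `l`, and the preimages of the two faces transverse to `l` are the graphs of
the small functions `u`. -/
structure Straightened (l : Fin d) (G : Euc d → Euc d) (u : Bool → Euc d → ℝ) (ζ ρ : ℝ) :
    Prop where
  near : Near ζ G
  side : ∀ j ≠ l, ∀ t, Face G j (level t) 0 ρ
  small : ∀ t, Small ζ (u t)
  indep : ∀ t, IndepOf l (u t)
  face : ∀ t, Face G l (level t) (u t) ρ

theorem Straightened.mono {l : Fin d} {G : Euc d → Euc d} {u : Bool → Euc d → ℝ} {ζ ζ' ρ ρ' : ℝ}
    (h : Straightened l G u ζ ρ) (hζ : ζ ≤ ζ') (hρ : ρ' ≤ ρ) : Straightened l G u ζ' ρ' :=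
  ⟨h.near.mono hζ, fun j hj t => (h.side j hj t).mono hρ, fun t => (h.small t).mono hζ, h.indep,
    fun t => (h.face t).mono hρ⟩

/-- All faces not transverse to `l` are flattened first; the two remaining ones, being preimages
under a near-identity map, are graphs. -/
theorem exists_straightened {l : Fin d} {R ρ ε : ℝ} (hR : 0 < R) (hρ : ρ < R) (hε : 0 < ε) :
    ∃ η > 0, ∀ G : Euc d → Euc d, Near η G →
      ∃ φ, VolPert ε (Metric.closedBall 0 (R + 1)) φ ∧ ∃ u, Straightened l (G ∘ φ) u ε ρ := by
  have : NeZero d := ⟨by rintro rfl; exact l.elim0⟩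
  set ζ := min (1 / 4) (ε / 4)
  obtain ⟨δ, hδ, hnear⟩ := exists_near_comp (d := d) (R := R + 1) (ε := ζ) (by linarith)
    (lt_min (by norm_num) (by positivity))
  obtain ⟨η, hη, H⟩ := exists_straighten_sides (l := l) hR
    (Finset.univ.filter fun f : Fin d × Bool => f.1 ≠ l) (by simp) ρ hρ (min ε δ) (lt_min hε hδ)
  refine ⟨min η δ, lt_min hη hδ, fun G hG => ?_⟩
  obtain ⟨φ, hφ, hF⟩ := H G (hG.mono (min_le_left _ _))
  have hG1 := hnear G φ (hG.mono (min_le_right _ _)) (hφ.mono (min_le_right _ _))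
  choose u hu hul huF using fun t => hG1.exists_face (min_le_left _ _) l (level t)
  have hζ : 4 * ζ ≤ ε := by linarith [min_le_right (1 / 4) (ε / 4)]
  exact ⟨φ, hφ.mono (min_le_left _ _), u, hG1.mono (by linarith [hG1.nonneg]),
    fun j hj t => hF (j, t) (by simpa using hj), fun t => (hu t).mono hζ, hul, fun t => huF t ρ⟩

/-- Averaging one of the two functions in one coordinate. -/
theorem exists_average {l k : Fin d} (hk : k ≠ l) (t : Bool) {R ρ ρ' ε : ℝ} (hR : 0 < R)
    (hρ : ρ < R) (hρ' : ρ < ρ') (hε : 0 < ε) :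
    ∃ η > 0, ∀ (G : Euc d → Euc d) (u : Bool → Euc d → ℝ), Straightened l G u η ρ' →
      ∃ φ, VolPert ε (Metric.closedBall 0 (R + 1)) φ ∧
        Straightened l (G ∘ φ) (Function.update u t (avg k (u t))) ε ρ := by
  have : NeZero d := ⟨by rintro rfl; exact l.elim0⟩
  obtain ⟨δ, hδ, hnear⟩ := exists_near_comp (d := d) (R := R + 1) (by linarith) hε
  set ε2 := min (min ε δ) (min (1 / 8) (ρ' - ρ)) with hε2
  have hε2pos : 0 < ε2 := lt_min (lt_min hε hδ) (lt_min (by norm_num) (by linarith))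
  have hε2a : ε2 ≤ ε := (min_le_left _ _).trans (min_le_left _ _)
  have hε2d : ε2 ≤ δ := (min_le_left _ _).trans (min_le_right _ _)
  have hε2b : ε2 ≤ 1 / 8 := (min_le_right _ _).trans (min_le_left _ _)
  have hε2c : ε2 ≤ ρ' - ρ := (min_le_right _ _).trans (min_le_right _ _)
  obtain ⟨η2, hη2, hshear⟩ := exists_isFaceShear hk (level t) hR hε2pos
  set η := min (min δ (ε / 2)) (min (1 / 16) (η2 / (3 * (1 + 2 * (R + 1))))) with hη
  have hηpos : 0 < η := lt_min (lt_min hδ (by positivity)) (lt_min (by norm_num) (by positivity))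
  have hη1 : η ≤ δ := (min_le_left _ _).trans (min_le_left _ _)
  have hη2' : η ≤ ε / 2 := (min_le_left _ _).trans (min_le_right _ _)
  have hη3 : η ≤ 1 / 16 := (min_le_right _ _).trans (min_le_left _ _)
  have hη4 : η * (3 * (1 + 2 * (R + 1))) ≤ η2 :=
    (le_div_iff₀ (by positivity)).1 ((min_le_right _ _).trans (min_le_right _ _))
  refine ⟨η, hηpos, fun G u hS => ?_⟩
  have hu := hS.small t
  have hav := hu.avg k
  have hηR : 0 ≤ η * (R + 1) := by positivity
  have hv : SmallOn (R + 1) (3 * η) (fun x => u t x - avg k (u t) x) :=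
    ((hu.smallOn _).sub (hav.smallOn _)).mono (by linarith)
  have hvs : Small (3 * η) (fun x => u t x - avg k (u t) x) := by
    refine ⟨hv.1, fun x => ?_⟩
    exact (((hu.smallOn ‖x‖).sub (hav.smallOn ‖x‖)).2 x le_rfl).imp
      (fun h => h.trans (by linarith)) (fun h => h.trans (by linarith))
  have hvb : IndepOf l (fun x => u t x - avg k (u t) x) :=
    (hS.indep t).sub (avg_indepOf (hS.indep t))
  obtain ⟨φ, hφ⟩ := hshear (prim k fun x => u t x - avg k (u t) x) _
    ((hvs.prim k).mono (by nlinarith)) (hv.mono (by nlinarith))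
    (prim_indepOf hk hvb) hvb (fderiv_prim_apply hv.1)
  -- The faces transverse to `k` are already flat and must stay so. The primitive has to vanish on
  -- both, which is why only the part of `u t` of zero average is removed.
  have hw : ∀ t' x, x k = level t' → prim k (fun x => u t x - avg k (u t) x) x = 0 := by
    intro t' x hx
    cases t'
    · exact prim_eq_zero (by simpa [level] using hx)
    · rw [prim_eq_avg (by simpa [level] using hx)]
      have hc : ∀ f : Euc d → ℝ, ContDiff ℝ 1 f → IntervalIntegrable
          (fun s : ℝ => f (x + (s - x k) • stdVec k)) volume 0 1 := fun f hf =>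
        (hf.continuous.comp (by fun_prop)).intervalIntegrable _ _
      have h1 : avg k (fun x => u t x - avg k (u t) x) x =
          avg k (u t) x - avg k (avg k (u t)) x :=
        intervalIntegral.integral_sub (hc _ hu.1) (hc _ hav.1)
      have h2 : avg k (avg k (u t)) x = avg k (u t) x := by
        rw [avg]
        simp only [avg_indepOf_self x _]
        simp
      rw [h1, h2, sub_self]
  have hη8 : η ≤ 1 / 8 := by linarith
  have hρε : ρ + ε2 ≤ ρ' := by linarith
  refine ⟨φ, hφ.toVolPert.mono hε2a, ?_⟩
  refine ⟨hnear G φ (hS.near.mono hη1) (hφ.toVolPert.mono hε2d), fun j hj t' => ?_, fun t' => ?_,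
    fun t' => ?_, fun t' => ?_⟩
  · have hF := (hS.side j hj t').mono hρε
    by_cases hjk : j = k
    · subst hjk
      exact hφ.face_side (hw t') hF
    · exact hφ.face_of_ne hjk hj hF
  · by_cases ht : t' = t
    · subst ht
      rw [Function.update_self]
      exact hav.mono (by linarith)
    · rw [Function.update_of_ne ht]
      exact (hS.small t').mono (by linarith)
  · by_cases ht : t' = t
    · subst ht
      rw [Function.update_self]
      exact avg_indepOf (hS.indep t')
    · rw [Function.update_of_ne ht]
      exact hS.indep t'
  · by_cases ht : t' = t
    · subst ht
      rw [Function.update_self]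
      have := hφ.face (ρ := ρ) hS.near hη8 hε2b hρ (hS.indep t')
        (fun x _ => by
          rw [sub_sub_cancel]
          exact (hav.2 x).1.trans (by linarith)) ((hS.face t').mono hρε)
      simpa only [sub_sub_cancel] using this
    · rw [Function.update_of_ne ht]
      exact hφ.face_other hS.near hη8 hε2b (abs_level_sub ht)
        (fun x => ((hS.small t').2 x).1.trans hη8) ((hS.face t').mono hρε)

/-- Averaging both functions in several coordinates. -/
theorem exists_averages {l : Fin d} {R : ℝ} (hR : 0 < R) (Q : Finset (Fin d × Bool))
    (hQ : ∀ f ∈ Q, f.1 ≠ l) : ∀ ρ ρ', ρ < R → ρ < ρ' → ∀ ε > 0, ∃ η > 0,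
      ∀ (G : Euc d → Euc d) (u : Bool → Euc d → ℝ), Straightened l G u η ρ' →
      ∃ φ, VolPert ε (Metric.closedBall 0 (R + 1)) φ ∧
        ∃ u', Straightened l (G ∘ φ) u' ε ρ ∧ ∀ f ∈ Q, IndepOf f.1 (u' f.2) := by
  induction Q using Finset.induction_on with
  | empty =>
    intro ρ ρ' _ hρ' ε hε
    exact ⟨ε, hε, fun G u h => ⟨id, VolPert.id.mono hε.le, u, h.mono le_rfl hρ'.le, by simp⟩⟩
  | insert f Q hf ih =>
    intro ρ ρ' hρ hρ' ε hε
    obtain ⟨k, t⟩ := f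
    have hkl : k ≠ l := hQ _ (Finset.mem_insert_self _ _)
    obtain ⟨δ, hδ, hcomp⟩ := exists_volPert_comp (K := Metric.closedBall (0 : Euc d) (R + 1)) hε
    have hmin : ρ < min R ρ' := lt_min hρ hρ'
    have hmR : (ρ + min R ρ') / 2 < R := by linarith [min_le_left R ρ']
    have hmρ' : (ρ + min R ρ') / 2 < ρ' := by linarith [min_le_right R ρ']
    obtain ⟨η2, hη2, H2⟩ := exists_average hkl t hR hρ
      (show ρ < (ρ + min R ρ') / 2 by linarith) (lt_min hδ hε)
    obtain ⟨η1, hη1, H1⟩ := ih (fun f hf => hQ f (Finset.mem_insert_of_mem hf))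
      ((ρ + min R ρ') / 2) ρ' hmR hmρ' (min δ η2) (lt_min hδ hη2)
    refine ⟨η1, hη1, fun G u hS => ?_⟩
    obtain ⟨φ1, hφ1, u1, hS1, hind⟩ := H1 G u hS
    obtain ⟨φ2, hφ2, hS2⟩ := H2 _ u1 (hS1.mono (min_le_right _ _) le_rfl)
    refine ⟨φ1 ∘ φ2, hcomp _ _ (hφ1.mono (min_le_left _ _)) (hφ2.mono (min_le_left _ _)),
      _, by rw [← Function.comp_assoc]; exact hS2.mono (min_le_right _ _) le_rfl, fun f hfQ => ?_⟩
    obtain ⟨i, t'⟩ := f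
    dsimp only
    by_cases ht : t' = t
    · subst ht
      rw [Function.update_self]
      rcases Finset.mem_insert.1 hfQ with h | h
      · rw [Prod.mk.injEq] at h
        rw [h.1]
        exact avg_indepOf_self
      · exact avg_indepOf (hind _ h)
    · rw [Function.update_of_ne ht]
      rcases Finset.mem_insert.1 hfQ with h | h
      · exact absurd (Prod.mk.inj h).2 ht
      · exact hind _ h

theorem eq_const_of_indepOf {u : Euc d → ℝ} (hu : Differentiable ℝ u) (h : ∀ i, IndepOf i u)
    (x : Euc d) : u x = u 0 := by
  refine is_const_of_fderiv_eq_zero hu (fun y => ?_) x 0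
  have : (fderiv ℝ u y : Euc d →ₗ[ℝ] ℝ) = 0 := by
    refine (EuclideanSpace.basisFun (Fin d) ℝ).toBasis.ext fun i => ?_
    have := (h i).fderiv_apply hu y
    simpa using this
  ext v
  exact LinearMap.congr_fun this v

/-- Near-identity maps preserve the faces of the cube, up to moving the faces transverse to `l` by
constants. -/
theorem exists_straightened_const {l : Fin d} {R ρ ε : ℝ} (hR : 0 < R) (hρ : ρ < R) (hε : 0 < ε) :
    ∃ η > 0, ∀ G : Euc d → Euc d, Near η G →
      ∃ φ, VolPert ε (Metric.closedBall 0 (R + 1)) φ ∧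
        ∃ m : Bool → ℝ, Straightened l (G ∘ φ) (fun t _ => m t) ε ρ := by
  obtain ⟨δ, hδ, hcomp⟩ := exists_volPert_comp (K := Metric.closedBall (0 : Euc d) (R + 1)) hε
  obtain ⟨η2, hη2, H2⟩ := exists_averages (l := l) hR
    (Finset.univ.filter fun f : Fin d × Bool => f.1 ≠ l) (by simp) ρ ((ρ + R) / 2) hρ
    (by linarith) (min δ ε) (lt_min hδ hε)
  obtain ⟨η1, hη1, H1⟩ := exists_straightened (l := l) hR (show (ρ + R) / 2 < R by linarith)
    (lt_min hδ hη2)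
  refine ⟨η1, hη1, fun G hG => ?_⟩
  obtain ⟨φ1, hφ1, u, hS⟩ := H1 G hG
  obtain ⟨φ2, hφ2, u', hS', hind⟩ := H2 _ u (hS.mono (min_le_right _ _) le_rfl)
  refine ⟨φ1 ∘ φ2, hcomp _ _ (hφ1.mono (min_le_left _ _)) (hφ2.mono (min_le_left _ _)),
    fun t => u' t 0, ?_⟩
  rw [← Function.comp_assoc]
  have : (fun (t : Bool) (_ : Euc d) => u' t 0) = u' := by
    ext t x
    refine (eq_const_of_indepOf ((hS'.small t).1.differentiable (by simp)) (fun i => ?_) x).symm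
    by_cases hi : i = l
    · rw [hi]; exact hS'.indep t
    · exact hind (i, t) (by simpa using hi)
  rw [this]
  exact hS'.mono (min_le_right _ _) le_rfl

end Cube

end WeakShadowing

namespace WeakShadowing

/-! ### The last two faces: volume, flux, and invariance of the cube -/

section UnitCube

variable {d : ℕ}

/-- The open box with the given lower and upper bounds. -/
def openBox (lo hi : Fin d → ℝ) : Set (Euc d) := {x | ∀ i, lo i < x i ∧ x i < hi i}

/-- The open unit cube. -/
def unitCube (d : ℕ) : Set (Euc d) := openBox 0 1

theorem openBox_eq_preimage (lo hi : Fin d → ℝ) :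
    openBox lo hi = (MeasurableEquiv.toLp 2 (Fin d → ℝ)).symm ⁻¹'
      univ.pi (fun i => Ioo (lo i) (hi i)) := by
  ext x; simp [openBox]

theorem measurableSet_openBox (lo hi : Fin d → ℝ) : MeasurableSet (openBox lo hi) := by
  rw [openBox_eq_preimage]
  exact (MeasurableEquiv.measurable _) (MeasurableSet.univ_pi fun _ => measurableSet_Ioo)

theorem volume_openBox (lo hi : Fin d → ℝ) :
    volume (openBox lo hi) = ∏ i, ENNReal.ofReal (hi i - lo i) := by
  rw [openBox_eq_preimage, (EuclideanSpace.volume_preserving_symm_measurableEquiv_toLp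
    (Fin d)).measure_preimage (MeasurableSet.univ_pi fun _ => measurableSet_Ioo).nullMeasurableSet,
    Real.volume_pi_Ioo]

theorem norm_le_of_abs_le {x : Euc d} {c : ℝ} (h : ∀ i, |x i| ≤ c) : ‖x‖ ≤ d * c := by
  have h1 : x = ∑ i, x i • stdVec i := by
    simpa using ((EuclideanSpace.basisFun (Fin d) ℝ).sum_repr x).symm
  rw [h1]
  refine (norm_sum_le _ _).trans ?_
  have : ∀ i ∈ Finset.univ, ‖x i • stdVec i‖ ≤ c := fun i _ => by
    rw [norm_smul, norm_single_one, mul_one]; exact h i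
  simpa using Finset.sum_le_sum this

theorem norm_le_of_mem_unitCube {x : Euc d} (hx : x ∈ unitCube d) : ‖x‖ ≤ d := by
  have := norm_le_of_abs_le (x := x) (c := 1) fun i => abs_le.2
    ⟨by have := (hx i).1; simp only [Pi.zero_apply] at this; linarith,
     by have := (hx i).2; simp only [Pi.one_apply] at this; exact this.le⟩
  simpa using this

theorem isOpen_unitCube : IsOpen (unitCube d) := by
  have : unitCube d = ⋂ i, {x : Euc d | 0 < x i ∧ x i < 1} := by
    ext x; simp [unitCube, openBox]
  rw [this]
  refine isOpen_iInter_of_finite fun i => ?_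
  have hc : Continuous fun x : Euc d => x i := by fun_prop
  exact (isOpen_lt continuous_const hc).inter (isOpen_lt hc continuous_const)

variable {l : Fin d} {G : Euc d → Euc d} {ζ ρ : ℝ}

/-- Each inequality defining the cube is translated by the corresponding `Face`. The bound on `ρ`
keeps all points concerned in the ball: those of the box have coordinates of size at most `2`, and
the preimages of points of the cube have norm at most `d + ζ`. -/
theorem Straightened.image_openBox {m : Bool → ℝ} (h : Straightened l G (fun t _ => m t) ζ ρ)
    (hζ : ζ ≤ 1 / 8) (hρ : 2 * d + 1 ≤ ρ) :
    G '' openBox (Function.update 0 l (m false)) (Function.update 1 l (1 + m true)) =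
      unitCube d := by
  have hm : ∀ t, |m t| ≤ 1 / 8 := fun t => ((h.small t).2 0).1.trans hζ
  have hm0 := abs_le.1 (hm false)
  have hm1 := abs_le.1 (hm true)
  have key : ∀ x : Euc d, ‖x‖ ≤ ρ → (G x ∈ unitCube d ↔
      x ∈ openBox (Function.update 0 l (m false)) (Function.update 1 l (1 + m true))) := by
    intro x hx
    refine forall_congr' fun i => ?_
    by_cases hi : i = l
    · subst hi
      have h0 := (h.face false x hx).1
      have h1 := (h.face true x hx).2
      simp only [level] at h0 h1
      simp only [Pi.zero_apply, Pi.one_apply, Function.update_self]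
      simpa using and_congr h0 h1
    · have h0 := (h.side i hi false x hx).1
      have h1 := (h.side i hi true x hx).2
      simp only [level, Pi.zero_apply, add_zero] at h0 h1
      simp only [Pi.zero_apply, Pi.one_apply, Function.update_of_ne hi]
      simpa using and_congr h0 h1
  ext y
  constructor
  · rintro ⟨x, hx, rfl⟩
    refine (key x ?_).2 hx
    have : ‖x‖ ≤ d * 2 := norm_le_of_abs_le fun i => by
      have := hx i
      by_cases hi : i = l
      · subst hi
        simp only [Function.update_self] at this
        exact abs_le.2 ⟨by linarith, by linarith⟩
      · simp only [Function.update_of_ne hi, Pi.zero_apply, Pi.one_apply] at this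
        exact abs_le.2 ⟨by linarith, by linarith⟩
    linarith
  · intro hy
    obtain ⟨x, rfl⟩ := h.near.surjective (by linarith) y
    refine ⟨x, (key x ?_).1 hy, rfl⟩
    have h1 := h.near.norm_sub_le x
    have h2 := norm_le_of_mem_unitCube hy
    have h3 := _root_.norm_sub_le (G x) (G x - x)
    rw [sub_sub_cancel] at h3
    have : (0 : ℝ) ≤ d := Nat.cast_nonneg d
    linarith

/-- The box has volume `1 + m true - m false`, and its image is the unit cube. -/
theorem Straightened.const_eq {m : Bool → ℝ} (h : Straightened l G (fun t _ => m t) ζ ρ)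
    (hζ : ζ ≤ 1 / 8) (hρ : 2 * d + 1 ≤ ρ)
    (hvol : ∀ A, MeasurableSet A → A ⊆ Metric.closedBall 0 (2 * d : ℝ) →
      volume (G '' A) = volume A) : m false = m true := by
  have hm : ∀ t, |m t| ≤ 1 / 8 := fun t => ((h.small t).2 0).1.trans hζ
  have hm0 := abs_le.1 (hm false)
  have hm1 := abs_le.1 (hm true)
  have h1 := hvol _ (measurableSet_openBox (Function.update 0 l (m false))
    (Function.update 1 l (1 + m true))) (by
      intro x hx
      rw [mem_closedBall_zero_iff, mul_comm]
      refine norm_le_of_abs_le fun i => ?_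
      have := hx i
      by_cases hi : i = l
      · subst hi
        simp only [Function.update_self] at this
        exact abs_le.2 ⟨by linarith, by linarith⟩
      · simp only [Function.update_of_ne hi, Pi.zero_apply, Pi.one_apply] at this
        exact abs_le.2 ⟨by linarith, by linarith⟩)
  rw [h.image_openBox hζ hρ, unitCube, volume_openBox, volume_openBox] at h1
  have h2 : ∏ i : Fin d, ENNReal.ofReal (Function.update (1 : Fin d → ℝ) l (1 + m true) i -
      Function.update (0 : Fin d → ℝ) l (m false) i) =
      ENNReal.ofReal (1 + m true - m false) := by
    rw [Finset.prod_eq_single l]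
    · simp
    · intro i _ hi
      simp [Function.update_of_ne hi]
    · simp
  rw [h2] at h1
  simp only [Pi.one_apply, Pi.zero_apply, sub_zero, ENNReal.ofReal_one, Finset.prod_const_one] at h1
  have h3 := congrArg ENNReal.toReal h1
  rw [ENNReal.toReal_ofReal (by linarith), ENNReal.toReal_one] at h3
  linarith

/-- A map that moves both faces transverse to `l` by the same constant can be corrected so that
these faces are only moved by a function of zero average. -/
theorem exists_flux {i : Fin d} (hi : i ≠ l) {R ρ' ε : ℝ} (hR : 0 < R) (hρR : ρ < R)
    (hρ' : ρ < ρ') (hε : 0 < ε) :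
    ∃ η > 0, ∀ (G : Euc d → Euc d) (m : ℝ), Straightened l G (fun _ _ => m) η ρ' →
      ∃ φ, VolPert ε (Metric.closedBall 0 (R + 1)) φ ∧
        Straightened l (G ∘ φ) (fun _ x => m + m * deriv faceBump (x i)) ε ρ := by
  have : NeZero d := ⟨by rintro rfl; exact l.elim0⟩
  have hc1 : ContDiff ℝ ∞ (deriv faceBump) := ContDiff.deriv' (by simpa using contDiff_faceBump)
  obtain ⟨B, hB⟩ := faceBump.hasCompactSupport.deriv.exists_bound_of_continuous hc1.continuous
  obtain ⟨B', hB'⟩ := faceBump.hasCompactSupport.deriv.deriv.exists_bound_of_continuous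
    (hc1.continuous_deriv (by simp))
  have hB0 : 0 ≤ B := (norm_nonneg _).trans (hB 0)
  have hB0' : 0 ≤ B' := (norm_nonneg _).trans (hB' 0)
  obtain ⟨δ, hδ, hnear⟩ := exists_near_comp (d := d) (R := R + 1) (by linarith) hε
  set ε2 := min (min ε δ) (min (1 / 8) (ρ' - ρ)) with hε2
  have hε2pos : 0 < ε2 := lt_min (lt_min hε hδ) (lt_min (by norm_num) (by linarith))
  have hε2a : ε2 ≤ ε := (min_le_left _ _).trans (min_le_left _ _)
  have hε2d : ε2 ≤ δ := (min_le_left _ _).trans (min_le_right _ _)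
  have hε2b : ε2 ≤ 1 / 8 := (min_le_right _ _).trans (min_le_left _ _)
  have hε2c : ε2 ≤ ρ' - ρ := (min_le_right _ _).trans (min_le_right _ _)
  obtain ⟨η2, hη2, hshear⟩ := exists_isFaceShear hi.symm 0 hR hε2pos
  set c := min ε ((R - ρ) / 2)
  have hcpos : 0 < c := lt_min hε (by linarith)
  set η := min (min δ η2) (min (1 / 16) (c / (1 + B + B'))) with hη
  have hηpos : 0 < η := lt_min (lt_min hδ hη2) (lt_min (by norm_num) (by positivity))
  have hη1 : η ≤ δ := (min_le_left _ _).trans (min_le_left _ _)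
  have hη2' : η ≤ η2 := (min_le_left _ _).trans (min_le_right _ _)
  have hη3 : η ≤ 1 / 16 := (min_le_right _ _).trans (min_le_left _ _)
  have hη4 : η * (1 + B + B') ≤ c :=
    (le_div_iff₀ (by positivity)).1 ((min_le_right _ _).trans (min_le_right _ _))
  refine ⟨η, hηpos, fun G m hS => ?_⟩
  have hm : |m| ≤ η := ((hS.small true).2 0).1
  -- For the constant generating function `m` the face `x i = 0` is not sheared at all, while points
  -- near it slide along `stdVec l` by `-m * deriv faceBump (x i)`.
  obtain ⟨φ, hφ⟩ := hshear (fun _ => m) (fun _ => 0)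
    ⟨contDiff_const, fun x _ => ⟨hm.trans hη2', by simp [hη2.le]⟩⟩
    ⟨contDiff_const, fun x _ => ⟨by simp [hη2.le], by simp [hη2.le]⟩⟩
    (fun _ _ => rfl) (fun _ _ => rfl) (fun x => by simp)
  have hη8 : η ≤ 1 / 8 := by linarith
  have hρε : ρ + ε2 ≤ ρ' := by linarith
  have hmB : ∀ t, |m * deriv faceBump t| ≤ η * B := fun t => by
    rw [abs_mul]
    exact mul_le_mul hm (hB t) (abs_nonneg _) hηpos.le
  have hηB : 0 ≤ η * B := by positivity
  have hηB' : 0 ≤ η * B' := by positivity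
  refine ⟨φ, hφ.toVolPert.mono hε2a, ?_⟩
  refine ⟨hnear G φ (hS.near.mono hη1) (hφ.toVolPert.mono hε2d), fun j hj t' => ?_, fun t' => ?_,
    fun t' x t => ?_, fun t' x hx => ?_⟩
  · have hF := (hS.side j hj t').mono hρε
    by_cases hji : j = i
    · subst hji
      cases t'
      · have := hφ.face (ρ := ρ) hS.near hη8 hε2b hρR (indepOf_zero j) (by simp)
          (by simpa [level] using hF)
        simp only [Pi.zero_apply, sub_zero] at this
        exact this
      · exact hφ.face_other hS.near hη8 hε2b (by simp [level]) (by simp) hF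
    · exact hφ.face_of_ne hj hji hF
  · refine ⟨contDiff_const.add (contDiff_const.mul ((hc1.of_le (by simp)).comp (contDiff_coord i))),
      fun x => ⟨?_, ?_⟩⟩
    · refine (abs_add_le _ _).trans ?_
      have := hmB (x i)
      have := min_le_left ε ((R - ρ) / 2)
      nlinarith
    · have h1 : HasFDerivAt (fun x : Euc d => m + m * deriv faceBump (x i))
          (m • deriv (deriv faceBump) (x i) • (EuclideanSpace.proj i : Euc d →L[ℝ] ℝ)) x :=
        ((HasDerivAt.comp_hasFDerivAt (h₂ := deriv faceBump) (f := fun x : Euc d => x i) x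
          (hc1.differentiable (by simp) (x i)).hasDerivAt (hasFDerivAt_coord i x)).const_mul
          m).const_add m
      rw [h1.fderiv, norm_smul, norm_smul]
      have h2 := mul_le_mul (hB' (x i)) (norm_coordProj_le i) (norm_nonneg _) hB0'
      have h3 := mul_le_mul hm h2 (by positivity) hηpos.le
      have := min_le_left ε ((R - ρ) / 2)
      rw [Real.norm_eq_abs]
      nlinarith
  · dsimp only
    rw [add_smul_single_of_ne x hi]
  · have h0 := hmB (x i)
    have hlt : ‖x - (m * deriv faceBump (x i - 0)) • stdVec l‖ < R := by
      refine (_root_.norm_sub_le _ _).trans_lt ?_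
      rw [norm_smul, norm_single_one, mul_one, Real.norm_eq_abs, sub_zero]
      have := min_le_right ε ((R - ρ) / 2)
      nlinarith
    have h1 := hφ.flux m (fun _ => rfl) x hlt
    have h2 := hS.face t' (φ x) ((hφ.norm_le hx).trans hρε)
    rw [Function.comp_apply, h2.1, h2.2, h1]
    simp only [sub_zero, PiLp.sub_apply, PiLp.smul_apply, PiLp.single_apply, if_true,
      smul_eq_mul, mul_one]
    constructor
    · constructor <;> intro <;> linarith
    · constructor <;> intro <;> linarith

/-- Over the unit interval `deriv faceBump` integrates to `faceBump 1 - faceBump 0 = -1`, since the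
bump sits at one of the two faces only. This offsets the constant `m`. -/
theorem avg_flux {i : Fin d} (m : ℝ) :
    avg i (fun x : Euc d => m + m * deriv faceBump (x i)) = 0 := by
  ext x
  have h1 : ∀ s : ℝ, (x + (s - x i) • stdVec i) i = s := fun s => by simp
  simp only [avg, h1]
  have hc1 : ContDiff ℝ ∞ (deriv faceBump) := ContDiff.deriv' (by simpa using contDiff_faceBump)
  have h2 : Continuous fun s => m * deriv faceBump s := continuous_const.mul hc1.continuous
  rw [intervalIntegral.integral_add (by simp) (h2.intervalIntegrable _ _),
    intervalIntegral.integral_const_mul, intervalIntegral.integral_deriv_eq_sub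
      (fun t _ => contDiff_faceBump.differentiable (by simp) t)
      (hc1.continuous.intervalIntegrable _ _), faceBump_one (t := 0) (by norm_num),
    faceBump_zero (t := 1) (by norm_num)]
  simp

/-- A volume preserving map close to the identity maps the unit cube onto itself after a small
volume preserving perturbation. -/
theorem exists_preserving_unitCube (hd : 2 ≤ d) {ε : ℝ} (hε : 0 < ε) :
    ∃ η > 0, ∀ G : Euc d → Euc d, Near η G →
      (∀ A, MeasurableSet A → A ⊆ Metric.closedBall 0 (2 * d + 5 : ℝ) →
        volume (G '' A) = volume A) →
      ∃ φ, VolPert ε (Metric.closedBall 0 (2 * d + 5)) φ ∧ (G ∘ φ) '' unitCube d = unitCube d := by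
  have : NeZero d := ⟨by omega⟩
  -- Two directions are needed, whence `2 ≤ d`: the common shift along `l` is cancelled by a flux
  -- across a face transverse to `i`.
  let l : Fin d := ⟨0, by omega⟩
  let i : Fin d := ⟨1, by omega⟩
  have hi : i ≠ l := by simp [i, l, Fin.ext_iff]
  have hd0 : (0 : ℝ) ≤ d := Nat.cast_nonneg d
  have hR : (0 : ℝ) < 2 * d + 4 := by linarith
  have hR1 : (2 * d + 4 + 1 : ℝ) = 2 * d + 5 := by ring
  obtain ⟨δ1, hδ1, hc1⟩ := exists_volPert_comp
    (K := Metric.closedBall (0 : Euc d) (2 * d + 4 + 1)) hε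
  obtain ⟨δ2, hδ2, hc2⟩ := exists_volPert_comp
    (K := Metric.closedBall (0 : Euc d) (2 * d + 4 + 1)) hδ1
  -- Thresholds are chosen in the reverse order of use. The radii of control decrease from `2 * d +
  -- 2` to `2 * d + 1`, because each perturbation moves points a little.
  obtain ⟨η4, hη4, H4⟩ := exists_average (l := l) hi true (ρ := 2 * d + 1) (ρ' := 2 * d + 5 / 4)
    hR (by linarith) (by linarith) (show 0 < min δ2 (1 / 8) from lt_min hδ2 (by norm_num))
  obtain ⟨η3, hη3, H3⟩ := exists_average (l := l) hi false (ρ := 2 * d + 5 / 4)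
    (ρ' := 2 * d + 3 / 2) hR (by linarith) (by linarith)
    (show 0 < min δ2 η4 from lt_min hδ2 hη4)
  obtain ⟨η2, hη2, H2⟩ := exists_flux (l := l) hi (ρ := 2 * d + 3 / 2) (ρ' := 2 * d + 2) hR
    (by linarith) (by linarith) (show 0 < min δ2 η3 from lt_min hδ2 hη3)
  obtain ⟨η1, hη1, H1⟩ := exists_straightened_const (l := l) hR (ρ := 2 * d + 2) (by linarith)
    (show 0 < min (min δ2 η2) (1 / 8) from lt_min (lt_min hδ2 hη2) (by norm_num))
  refine ⟨η1, hη1, fun G hG hvol => ?_⟩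
  obtain ⟨φ1, hφ1, m, hS1⟩ := H1 G hG
  have hε1 : min (min δ2 η2) (1 / 8) < 1 := (min_le_right _ _).trans_lt (by norm_num)
  -- The only use of conservation of volume by `G`.
  have hm := hS1.const_eq (min_le_right _ _) (by linarith) fun A hA hAs => by
    have hAs' : A ⊆ Metric.closedBall (0 : Euc d) (2 * d + 4 + 1) :=
      hAs.trans (Metric.closedBall_subset_closedBall (by linarith))
    rw [image_comp, hvol, hφ1.measure_image hε1 _ hA]
    · exact (hA.image_of_measurable_injOn hφ1.contDiff.continuous.measurable
        (hφ1.injective hε1).injOn)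
    · rw [← hR1]
      rintro _ ⟨x, hx, rfl⟩
      exact hφ1.mapsTo hε1 (hAs' hx)
  have hm' : (fun (t : Bool) (_ : Euc d) => m t) = fun _ _ => m true := by
    ext t x
    cases t
    · exact hm
    · rfl
  rw [hm'] at hS1
  obtain ⟨φ2, hφ2, hS2⟩ := H2 _ _ (hS1.mono ((min_le_left _ _).trans (min_le_right _ _)) le_rfl)
  obtain ⟨φ3, hφ3, hS3⟩ := H3 _ _ (hS2.mono (min_le_right _ _) le_rfl)
  obtain ⟨φ4, hφ4, hS4⟩ := H4 _ _ (hS3.mono (min_le_right _ _) le_rfl)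
  -- Averaging both heights in the coordinate `i` after the flux correction leaves zero.
  have hu : Function.update (Function.update
      (fun (_ : Bool) (x : Euc d) => m true + m true * deriv faceBump (x i)) false
      (avg i fun x : Euc d => m true + m true * deriv faceBump (x i))) true
      (avg i (Function.update
      (fun (_ : Bool) (x : Euc d) => m true + m true * deriv faceBump (x i)) false
      (avg i fun x : Euc d => m true + m true * deriv faceBump (x i)) true)) =
      fun t _ => (fun _ : Bool => (0 : ℝ)) t := by
    funext t
    cases t
    · rw [Function.update_of_ne (by simp), Function.update_self, avg_flux]; rfl
    · rw [Function.update_self, Function.update_of_ne (by simp), avg_flux]; rfl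
  rw [hu] at hS4
  have h5 := hS4.image_openBox (min_le_right _ _) (by linarith)
  simp only [add_zero, Function.update_zero, Function.update_one] at h5
  refine ⟨φ1 ∘ φ2 ∘ (φ3 ∘ φ4), ?_, ?_⟩
  · rw [← hR1, ← Function.comp_assoc]
    exact hc1 _ _
      (hc2 _ _ (hφ1.mono ((min_le_left _ _).trans (min_le_left _ _))) (hφ2.mono (min_le_left _ _)))
      (hc2 _ _ (hφ3.mono (min_le_left _ _)) (hφ4.mono (min_le_left _ _)))
  · simpa only [Function.comp_assoc, unitCube] using h5

end UnitCube

end WeakShadowing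

namespace WeakShadowing

/-! ### Chain transitivity and orbits meeting two open sets -/

section ChainTransitivity

variable {M : Type*} [MetricSpace M]

/-- A finite `δ`-chain extends to a pseudo-orbit. -/
theorem exists_isPseudoOrbit_of_chain {f : Equiv.Perm M} {δ : ℝ} (hδ : 0 < δ) {v z : M}
    (h : Relation.ReflTransGen (fun a b => dist (f a) b < δ) v z) :
    ∃ x : ℤ → M, IsPseudoOrbit f δ x ∧ (∃ i ≤ 0, x i = v) ∧ x 0 = z := by
  induction h with
  | refl =>
    refine ⟨fun i => (f ^ i) v, fun i => ?_, ⟨0, le_rfl, by simp⟩, by simp⟩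
    rw [← Equiv.Perm.mul_apply, ← zpow_one_add, add_comm, dist_self]
    exact hδ
  | @tail b c _ hbc ih =>
    obtain ⟨x, hx, ⟨i, hi, hxi⟩, hx0⟩ := ih
    refine ⟨fun i => if i < 0 then x (i + 1) else (f ^ i) c, fun i => ?_, ⟨i - 1, by omega, ?_⟩, ?_⟩
    · rcases lt_trichotomy i (-1) with h | h | h
      · simp only [show i < 0 by omega, show i + 1 < 0 by omega, if_true]
        exact hx (i + 1)
      · subst h
        simpa [hx0] using hbc
      · simp only [show ¬ i < 0 by omega, show ¬ i + 1 < 0 by omega, if_false]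
        rw [← Equiv.Perm.mul_apply, ← zpow_one_add, add_comm, dist_self]
        exact hδ
    · simp [show i - 1 < 0 by omega, hxi]
    · simp

variable [CompactSpace M] [ConnectedSpace M] [MeasurableSpace M] [BorelSpace M]
  {μ : Measure M} [IsFiniteMeasure μ] [μ.IsOpenPosMeasure]

/-- A measure preserving map of a connected space is chain transitive. -/
theorem chain_of_measurePreserving {f : M → M} (hf : Continuous f) (hμ : MeasurePreserving f μ μ)
    {δ : ℝ} (hδ : 0 < δ) (v z : M) : Relation.TransGen (fun a b => dist (f a) b < δ) v z := by
  set S : Set M := {z | Relation.TransGen (fun a b => dist (f a) b < δ) v z} with hS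
  suffices h : S = univ by
    have : z ∈ S := h ▸ mem_univ z
    exact this
  refine IsClopen.eq_univ ⟨?_, ?_⟩ ⟨f v, Relation.TransGen.single (by simpa using hδ)⟩
  -- Let `z` be a limit of reachable points. From a reachable `z'` near `z`, jump onto the orbit of
  -- a recurrent point `w` near `z`, follow it until it is back near `z`, and make a last jump to
  -- `z`.
  · refine isClosed_of_closure_subset fun z hz => ?_
    obtain ⟨r, hr, hfr⟩ := Metric.uniformContinuous_iff.1
      (CompactSpace.uniformContinuous_of_continuous hf) (δ / 2) (by positivity)
    set ρ := min (r / 2) (δ / 2)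
    have hρ : 0 < ρ := lt_min (by positivity) (by positivity)
    have hρr : ρ ≤ r / 2 := min_le_left _ _
    have hρδ : ρ ≤ δ / 2 := min_le_right _ _
    obtain ⟨z', hz'S, hz'⟩ := Metric.mem_closure_iff.1 hz ρ hρ
    obtain ⟨w, hw, k, hk, hwk⟩ := hμ.conservative.exists_mem_iterate_mem
      (s := Metric.ball z ρ) Metric.isOpen_ball.measurableSet.nullMeasurableSet
      (Metric.measure_ball_pos μ z hρ).ne'
    rw [Metric.mem_ball] at hw hwk
    have hfw : dist (f z') (f w) < δ / 2 := hfr <| by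
      have := dist_triangle z' z w
      rw [dist_comm z' z, dist_comm z w] at this
      linarith
    obtain ⟨n, rfl⟩ : ∃ n, k = n + 1 := ⟨k - 1, by omega⟩
    have hreach : ∀ m, (∃ y ∈ S, dist (f y) (f^[m + 1] w) < δ / 2) := by
      intro m
      induction m with
      | zero => exact ⟨z', hz'S, hfw⟩
      | succ m ih =>
        obtain ⟨y, hy, hyd⟩ := ih
        refine ⟨f^[m + 1] w, Relation.TransGen.tail hy (by linarith), ?_⟩
        rw [Function.iterate_succ_apply' f (m + 1), dist_self]
        positivity
    obtain ⟨y, hy, hyd⟩ := hreach n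
    refine Relation.TransGen.tail hy ?_
    have := dist_triangle (f y) (f^[n + 1] w) z
    linarith
  -- The end of the last jump may be moved freely within a small neighbourhood.
  · rw [isOpen_iff_mem_nhds]
    intro z hz
    obtain ⟨b, hb, hbz⟩ : ∃ b, (b = v ∨ Relation.TransGen (fun a b => dist (f a) b < δ) v b) ∧
        dist (f b) z < δ := by
      cases hz with
      | single h => exact ⟨v, Or.inl rfl, h⟩
      | tail h1 h2 => exact ⟨_, Or.inr h1, h2⟩
    have ho : IsOpen {z | dist (f b) z < δ} :=
      isOpen_lt (continuous_const.dist continuous_id) continuous_const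
    filter_upwards [ho.mem_nhds hbz] with y hy
    rcases hb with rfl | hb
    · exact Relation.TransGen.single hy
    · exact Relation.TransGen.tail hb hy

/-- A weakly shadowable measure preserving map has an orbit that meets two given open sets. -/
theorem HasWeakShadowing.exists_orbit {f : Equiv.Perm M} (h : HasWeakShadowing f)
    (hf : Continuous f) (hμ : MeasurePreserving f μ μ) {V Z : Set M} (hV : IsOpen V)
    (hZ : IsOpen Z) (hV' : V.Nonempty) (hZ' : Z.Nonempty) :
    ∃ (y : M) (i j : ℤ), (f ^ i) y ∈ V ∧ (f ^ j) y ∈ Z := by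
  obtain ⟨v, hv⟩ := hV'
  obtain ⟨z, hz⟩ := hZ'
  obtain ⟨ε1, hε1, h1⟩ := Metric.isOpen_iff.1 hV v hv
  obtain ⟨ε2, hε2, h2⟩ := Metric.isOpen_iff.1 hZ z hz
  obtain ⟨δ, hδ, H⟩ := h (min ε1 ε2) (lt_min hε1 hε2)
  obtain ⟨x, hx, ⟨i, _, hi⟩, h0⟩ := exists_isPseudoOrbit_of_chain hδ
    (chain_of_measurePreserving hf hμ hδ v z).to_reflTransGen
  obtain ⟨y, hy⟩ := H x hx
  obtain ⟨j, hj⟩ := hy i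
  obtain ⟨k, hk⟩ := hy 0
  rw [hi, Metric.mem_ball, dist_comm] at hj
  rw [h0, Metric.mem_ball, dist_comm] at hk
  exact ⟨y, j, k, h1 (hj.trans_le (min_le_left _ _)), h2 (hk.trans_le (min_le_right _ _))⟩

end ChainTransitivity

end WeakShadowing

namespace WeakShadowing

/-! ### Charts in which the measure is Lebesgue measure -/

section VolumeChart

variable {d : ℕ}

theorem measurableSet_image_openPartialHomeomorph {X Y : Type*} [TopologicalSpace X]
    [TopologicalSpace Y] [MeasurableSpace X] [BorelSpace X] [MeasurableSpace Y] [BorelSpace Y]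
    (e : OpenPartialHomeomorph X Y) {A : Set X} (hA : MeasurableSet A) (hAe : A ⊆ e.source) :
    MeasurableSet (e '' A) := by
  have h1 : Measurable (e.target.domRestrict e.symm) := e.continuousOn_symm.domRestrict.measurable
  have h2 := e.open_target.measurableSet.subtype_image (h1 hA)
  convert h2 using 1
  ext y
  constructor
  · rintro ⟨x, hx, rfl⟩
    exact ⟨⟨e x, e.map_source (hAe hx)⟩, by
      change e.symm (e x) ∈ A
      rwa [e.left_inv (hAe hx)], rfl⟩
  · rintro ⟨⟨y, hy⟩, hyA, rfl⟩
    exact ⟨e.symm y, hyA, e.right_inv hy⟩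

/-- A local diffeomorphism of `ℝ^d` with a prescribed positive Jacobian. -/
theorem exists_openPartialHomeomorph_det (a : Fin d) {ρ : Euc d → ℝ} {T : Set (Euc d)} {y₀ : Euc d}
    (hT : T ∈ 𝓝 y₀) (hρ : ContDiffOn ℝ 1 ρ T) (hpos : ∀ y ∈ T, 0 < ρ y) :
    ∃ t : OpenPartialHomeomorph (Euc d) (Euc d), y₀ ∈ t.source ∧ t y₀ = 0 ∧ t.source ⊆ T ∧
      ContDiff ℝ 1 t ∧ ContDiffOn ℝ 1 t.symm t.target ∧
      ∀ y ∈ t.source, (fderiv ℝ t y).det = ρ y := by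
  obtain ⟨r, hr, hrT⟩ := Metric.mem_nhds_iff.1 hT
  let κ : ContDiffBump y₀ := ⟨r / 3, r / 2, by positivity, by linarith⟩
  -- `R` extends the germ of `ρ` to a positive function on the whole space: where the cutoff is
  -- positive it is a convex combination of `ρ` and `1`, elsewhere it is `1`.
  set R : Euc d → ℝ := fun y => 1 + κ y * (ρ y - 1) with hR
  have hRc : ContDiff ℝ 1 R := by
    rw [contDiff_iff_contDiffAt]
    intro y
    by_cases hy : dist y y₀ < r
    · have hyT : T ∈ 𝓝 y := mem_of_superset (Metric.isOpen_ball.mem_nhds hy) hrT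
      exact contDiffAt_const.add (κ.contDiffAt.mul
        ((hρ.contDiffAt hyT).sub contDiffAt_const))
    · have h : R =ᶠ[𝓝 y] fun _ => 1 := by
        have hy' : r / 2 < dist y y₀ := by linarith
        filter_upwards [(isOpen_lt continuous_const (continuous_id.dist continuous_const)).mem_nhds
          hy'] with z hz
        have hz0 : κ z = 0 := κ.zero_of_le_dist (le_of_lt hz)
        simp [R, hz0]
      exact contDiffAt_const.congr_of_eventuallyEq h
  have hRpos : ∀ y, 0 < R y := by
    intro y
    by_cases hy : dist y y₀ < r
    · have h1 := hpos y (hrT hy)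
      have h2 := κ.nonneg (x := y)
      have h3 := κ.le_one (x := y)
      simp only [R]
      rcases h2.eq_or_lt with h | h
      · rw [← h]; norm_num
      · nlinarith [mul_pos h h1]
    · simp [R, κ.zero_of_le_dist (show κ.rOut ≤ dist y y₀ by simp [κ]; linarith)]
  have hR1 : ∀ y ∈ Metric.ball y₀ (r / 3), R y = ρ y := fun y hy => by
    simp [R, κ.one_of_mem_closedBall (Metric.ball_subset_closedBall hy)]
  -- Only the coordinate `a` changes: up to translation it becomes a primitive of `R` in that
  -- coordinate, so the Jacobian is `R`.
  set τ : Euc d → Euc d := fun y =>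
    y - y₀ + (prim a R y - prim a R y₀ - (y a - y₀ a)) • stdVec a with hτ
  have hpc := contDiff_prim (a := a) hRc
  have hτc : ContDiff ℝ 1 τ := (contDiff_id.sub contDiff_const).add
    (((hpc.sub contDiff_const).sub ((contDiff_coord a).sub contDiff_const)).smul contDiff_const)
  have hτd : ∀ y, HasFDerivAt τ (ContinuousLinearMap.id ℝ (Euc d) +
      (fderiv ℝ (prim a R) y - (EuclideanSpace.proj a : Euc d →L[ℝ] ℝ)).smulRight (stdVec a)) y :=
    fun y => ((hasFDerivAt_id y).sub_const y₀).add
      ((((hpc.differentiable (by simp) y).hasFDerivAt.sub_const _).sub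
        ((hasFDerivAt_coord a y).sub_const _)).smul_const (stdVec a))
  have hdet : ∀ y, (fderiv ℝ τ y).det = R y := by
    intro y
    rw [(hτd y).fderiv]
    have h := LinearMap.transvection.det ((fderiv ℝ (prim a R) y -
      (EuclideanSpace.proj a : Euc d →L[ℝ] ℝ) : Euc d →L[ℝ] ℝ) : Euc d →ₗ[ℝ] ℝ) (stdVec a)
    refine h.trans ?_
    change 1 + (fderiv ℝ (prim a R) y (stdVec a) - stdVec a a) = R y
    rw [fderiv_prim_apply hRc]
    simp
  have hA : ∀ y, ∃ A : Euc d ≃L[ℝ] Euc d, HasFDerivAt τ (A : Euc d →L[ℝ] Euc d) y := fun y =>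
    ⟨(fderiv ℝ τ y).toContinuousLinearEquivOfDetNeZero (by rw [hdet]; exact (hRpos y).ne'), by
      rw [ContinuousLinearMap.coe_toContinuousLinearEquivOfDetNeZero]
      exact (hτc.differentiable (by simp) y).hasFDerivAt⟩
  choose A hA using hA
  set t0 := (hτc.contDiffAt (x := y₀)).toOpenPartialHomeomorph τ (hA y₀) one_ne_zero
  have ht0 : (t0 : Euc d → Euc d) = τ := rfl
  refine ⟨t0.restrOpen (Metric.ball y₀ (r / 3)) Metric.isOpen_ball, ?_, ?_, ?_, ?_, ?_, ?_⟩
  · exact ⟨(hτc.contDiffAt (x := y₀)).mem_toOpenPartialHomeomorph_source (hA y₀) one_ne_zero,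
      Metric.mem_ball_self (by positivity)⟩
  · change τ y₀ = 0
    simp [τ]
  · exact fun y hy => hrT (Metric.ball_subset_ball (by linarith) hy.2)
  · exact hτc
  · intro z hz
    exact ((t0.restrOpen (Metric.ball y₀ (r / 3)) Metric.isOpen_ball).contDiffAt_symm hz
      (hA _) hτc.contDiffAt).contDiffWithinAt
  · intro y hy
    exact (hdet y).trans (hR1 y hy.2)

variable {M : Type*} [TopologicalSpace M] [ChartedSpace (EuclideanSpace ℝ (Fin d)) M]

/-- The derivative of an inverse chart maps a basis to a basis, on which a nonzero alternating form
of top degree does not vanish. -/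
theorem VolumeForm.coeff_ne_zero [IsManifold (𝓡 d) ∞ M] (Ω : VolumeForm d M)
    {e : OpenPartialHomeomorph M (EuclideanSpace ℝ (Fin d))}
    (he : e ∈ atlas (EuclideanSpace ℝ (Fin d)) M) {y : EuclideanSpace ℝ (Fin d)}
    (hy : y ∈ e.target) : Ω.coeff e y ≠ 0 := by
  have : IsManifold (𝓡 d) 1 M := IsManifold.of_le (n := ∞) (by simp)
  have hbij := (mdifferentiable_of_mem_atlas (I := 𝓡 d) he).symm.mfderiv_bijective hy
  set L : EuclideanSpace ℝ (Fin d) →ₗ[ℝ] TangentSpace (𝓡 d) (e.symm y) :=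
    (mfderiv (𝓡 d) (𝓡 d) e.symm y).toLinearMap with hL
  let b : Module.Basis (Fin d) ℝ (TangentSpace (𝓡 d) (e.symm y)) :=
    (EuclideanSpace.basisFun (Fin d) ℝ).toBasis.map (LinearEquiv.ofBijective L hbij)
  have h := (AlternatingMap.map_basis_ne_zero_iff b (Ω.form (e.symm y))).2 (Ω.form_ne_zero _)
  have hb : (b : Fin d → TangentSpace (𝓡 d) (e.symm y)) =
      fun i => mfderiv (𝓡 d) (𝓡 d) e.symm y (EuclideanSpace.single i (1 : ℝ)) := by
    funext i
    simp [b, hL]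
    rfl
  rw [hb] at h
  exact h

variable [MeasurableSpace M]

/-- A `C¹` chart in which the measure `μ` is the Lebesgue measure. -/
structure IsVolumeChart (μ : Measure M) (ψ : OpenPartialHomeomorph M (Euc d)) : Prop where
  contMDiffOn : ContMDiffOn (𝓡 d) (𝓡 d) 1 ψ ψ.source
  contMDiffOn_symm : ContMDiffOn (𝓡 d) (𝓡 d) 1 ψ.symm ψ.target
  measure_eq : ∀ A, MeasurableSet A → A ⊆ ψ.source → μ A = volume (ψ '' A)

/-- The chart is followed by a coordinate change whose Jacobian is the absolute density; the change
of variables formula then cancels the density. -/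
theorem exists_isVolumeChart [BorelSpace M] [IsManifold (𝓡 d) ∞ M] (hd : 0 < d)
    (Ω : VolumeForm d M) {μ : Measure M} (hμ : Ω.IsLebesgueMeasure μ) (p : M) :
    ∃ ψ : OpenPartialHomeomorph M (Euc d), p ∈ ψ.source ∧ ψ p = 0 ∧ IsVolumeChart μ ψ := by
  have : IsManifold (𝓡 d) 1 M := IsManifold.of_le (n := ∞) (by simp)
  set e := chartAt (EuclideanSpace ℝ (Fin d)) p
  have he : e ∈ atlas (EuclideanSpace ℝ (Fin d)) M := chart_mem_atlas _ p
  have hp : p ∈ e.source := mem_chart_source _ p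
  have hne : ∀ y ∈ e.target, Ω.coeff e y ≠ 0 := fun y hy => Ω.coeff_ne_zero he hy
  have hcoeff : ContDiffOn ℝ 1 (Ω.coeff e) e.target := (Ω.smooth e he).of_le (by simp)
  obtain ⟨t, ht0, htp, htT, htc, hts, htd⟩ := exists_openPartialHomeomorph_det ⟨0, hd⟩
    (e.open_target.mem_nhds (e.map_source hp)) (ContDiffOn.abs hcoeff hne)
    (fun y hy => abs_pos.2 (hne y hy))
  have hem : e ∈ IsManifold.maximalAtlas (𝓡 d) 1 M := IsManifold.chart_mem_maximalAtlas p
  refine ⟨e.trans t, ?_, htp, ?_, ?_, ?_⟩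
  · rw [OpenPartialHomeomorph.trans_source]
    exact ⟨hp, ht0⟩
  · rw [OpenPartialHomeomorph.trans_source]
    exact htc.contMDiff.comp_contMDiffOn ((contMDiffOn_of_mem_maximalAtlas hem).mono
      inter_subset_left)
  · rw [OpenPartialHomeomorph.trans_target]
    exact (contMDiffOn_symm_of_mem_maximalAtlas hem).comp
      (hts.contMDiffOn.mono inter_subset_left) (fun x hx => hx.2)
  · intro A hA hAs
    rw [OpenPartialHomeomorph.trans_source] at hAs
    have hAe : A ⊆ e.source := hAs.trans inter_subset_left
    have hAt : e '' A ⊆ t.source := by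
      rintro _ ⟨x, hx, rfl⟩
      exact (hAs hx).2
    have hm := measurableSet_image_openPartialHomeomorph e hA hAe
    rw [hμ e he A hA hAe, OpenPartialHomeomorph.coe_trans, image_comp,
      ← lintegral_abs_det_fderiv_eq_addHaar_image volume hm
        (fun y _ => (htc.differentiable (by simp) y).hasFDerivAt.hasFDerivWithinAt)
        (t.injOn.mono hAt)]
    refine setLIntegral_congr_fun hm fun y hy => ?_
    simp only [htd y (hAt hy), abs_abs]

end VolumeChart

/-! ### Local finiteness and positivity on open sets -/

section LebesgueMeasure

variable {d : ℕ} {M : Type*} [TopologicalSpace M] [ChartedSpace (EuclideanSpace ℝ (Fin d)) M]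
  [MeasurableSpace M] [BorelSpace M] {μ : Measure M}

theorem isLocallyFiniteMeasure_of_isVolumeChart
    (h : ∀ p, ∃ ψ : OpenPartialHomeomorph M (Euc d), p ∈ ψ.source ∧ ψ p = 0 ∧ IsVolumeChart μ ψ) :
    IsLocallyFiniteMeasure μ := by
  refine ⟨fun p => ?_⟩
  obtain ⟨ψ, hp, hp0, hψ⟩ := h p
  have ho := ψ.isOpen_inter_preimage (Metric.isOpen_ball (x := (0 : Euc d)) (ε := 1))
  refine ⟨_, ho.mem_nhds ⟨hp, by simp [hp0]⟩, ?_⟩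
  rw [hψ.measure_eq _ ho.measurableSet inter_subset_left]
  refine (measure_mono ?_).trans_lt (measure_ball_lt_top (x := (0 : Euc d)) (r := 1))
  rintro _ ⟨x, hx, rfl⟩
  exact hx.2

theorem isOpenPosMeasure_of_isVolumeChart
    (h : ∀ p, ∃ ψ : OpenPartialHomeomorph M (Euc d), p ∈ ψ.source ∧ ψ p = 0 ∧ IsVolumeChart μ ψ) :
    μ.IsOpenPosMeasure := by
  refine ⟨fun U hU ⟨x, hx⟩ h0 => ?_⟩
  obtain ⟨ψ, hp, -, hψ⟩ := h x
  have ho := hU.inter ψ.open_source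
  have h1 := hψ.measure_eq _ ho.measurableSet inter_subset_right
  rw [measure_mono_null inter_subset_left h0] at h1
  exact (ψ.isOpen_image_of_subset_source ho inter_subset_right).measure_ne_zero volume
    ⟨ψ x, x, ⟨hx, hp⟩, rfl⟩ h1.symm

end LebesgueMeasure

end WeakShadowing

namespace WeakShadowing

/-! ### Lifting perturbations from a chart to the manifold -/

section Lift

variable {d : ℕ} {M : Type*} [TopologicalSpace M]

open Classical in
/-- The self-map of `M` which is `φ` in the chart `ψ`, and the identity outside its domain. -/
noncomputable def chartLift (ψ : OpenPartialHomeomorph M (Euc d)) (φ : Euc d → Euc d) (x : M) : M :=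
  if x ∈ ψ.source then ψ.symm (φ (ψ x)) else x

variable {ψ : OpenPartialHomeomorph M (Euc d)} {φ φ' : Euc d → Euc d} {K : Set (Euc d)}

theorem chartLift_of_mem {x : M} (hx : x ∈ ψ.source) : chartLift ψ φ x = ψ.symm (φ (ψ x)) :=
  if_pos hx

theorem chartLift_of_notMem {x : M} (hx : x ∉ ψ.source) : chartLift ψ φ x = x := if_neg hx

/-- `φ` is the identity outside `K`, and maps `K` to itself. -/
def SupportedIn (K : Set (Euc d)) (φ : Euc d → Euc d) : Prop :=
  MapsTo φ K K ∧ ∀ x ∉ K, φ x = x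

theorem SupportedIn.mem_target (h : SupportedIn K φ) (hK : K ⊆ ψ.target) {y : Euc d}
    (hy : y ∈ ψ.target) : φ y ∈ ψ.target := by
  by_cases hyK : y ∈ K
  · exact hK (h.1 hyK)
  · rwa [h.2 y hyK]

theorem chartLift_eq_self (h : SupportedIn K φ) {x : M} (hx : x ∉ ψ.symm '' K) :
    chartLift ψ φ x = x := by
  by_cases hxs : x ∈ ψ.source
  · rw [chartLift_of_mem hxs, h.2, ψ.left_inv hxs]
    exact fun hK => hx ⟨ψ x, hK, ψ.left_inv hxs⟩
  · exact chartLift_of_notMem hxs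

theorem chartLift_mem_source (h : SupportedIn K φ) (hK : K ⊆ ψ.target) {x : M}
    (hx : x ∈ ψ.source) : chartLift ψ φ x ∈ ψ.source := by
  rw [chartLift_of_mem hx]
  exact ψ.map_target (h.mem_target hK (ψ.map_source hx))

theorem apply_chartLift (h : SupportedIn K φ) (hK : K ⊆ ψ.target) {x : M} (hx : x ∈ ψ.source) :
    ψ (chartLift ψ φ x) = φ (ψ x) := by
  rw [chartLift_of_mem hx, ψ.right_inv (h.mem_target hK (ψ.map_source hx))]

theorem chartLift_comp (h : SupportedIn K φ) (hK : K ⊆ ψ.target) (hφ : ∀ y, φ' (φ y) = y)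
    (x : M) : chartLift ψ φ' (chartLift ψ φ x) = x := by
  by_cases hx : x ∈ ψ.source
  · rw [chartLift_of_mem (chartLift_mem_source h hK hx), apply_chartLift h hK hx, hφ,
      ψ.left_inv hx]
  · rw [chartLift_of_notMem hx, chartLift_of_notMem hx]

theorem isClosed_symm_image [T2Space M] (hK : IsCompact K) (hKt : K ⊆ ψ.target) :
    IsClosed (ψ.symm '' K) :=
  (hK.image_of_continuousOn (ψ.continuousOn_symm.mono hKt)).isClosed

theorem symm_image_subset_source (hKt : K ⊆ ψ.target) : ψ.symm '' K ⊆ ψ.source := by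
  rintro _ ⟨y, hy, rfl⟩
  exact ψ.map_target (hKt hy)

theorem chartLift_eventuallyEq_id [T2Space M] (h : SupportedIn K φ) (hK : IsCompact K)
    (hKt : K ⊆ ψ.target) {x : M} (hx : x ∉ ψ.symm '' K) : chartLift ψ φ =ᶠ[𝓝 x] id := by
  filter_upwards [(isClosed_symm_image hK hKt).isOpen_compl.mem_nhds hx] with y hy
    using chartLift_eq_self h hy

theorem chartLift_eventuallyEq {x : M} (hx : x ∈ ψ.source) :
    chartLift ψ φ =ᶠ[𝓝 x] ψ.symm ∘ φ ∘ ψ := by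
  filter_upwards [ψ.open_source.mem_nhds hx] with y hy using chartLift_of_mem hy

variable [ChartedSpace (EuclideanSpace ℝ (Fin d)) M] [MeasurableSpace M] {μ : Measure M}

theorem contMDiff_chartLift [T2Space M] (hψ : IsVolumeChart μ ψ) (h : SupportedIn K φ)
    (hφ : ContDiff ℝ 1 φ) (hK : IsCompact K) (hKt : K ⊆ ψ.target) :
    ContMDiff (𝓡 d) (𝓡 d) 1 (chartLift ψ φ) := by
  intro x
  by_cases hx : x ∈ ψ.symm '' K
  · have hxs := symm_image_subset_source hKt hx
    refine ContMDiffAt.congr_of_eventuallyEq ?_ (chartLift_eventuallyEq hxs)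
    have h1 := hψ.contMDiffOn.contMDiffAt (ψ.open_source.mem_nhds hxs)
    have h2 : φ (ψ x) ∈ ψ.target := h.mem_target hKt (ψ.map_source hxs)
    exact ContMDiffAt.comp x (hψ.contMDiffOn_symm.contMDiffAt (ψ.open_target.mem_nhds h2))
      (ContMDiffAt.comp x hφ.contMDiff.contMDiffAt h1)
  · exact contMDiffAt_id.congr_of_eventuallyEq (chartLift_eventuallyEq_id h hK hKt hx)

theorem VolPert.supportedIn {ε : ℝ} (hφ : VolPert ε K φ) (hε : ε < 1) : SupportedIn K φ :=
  ⟨fun _ hx => hφ.mapsTo hε hx, hφ.eq_self⟩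

/-- The inverse is the lift of the inverse of `φ`. Invariance of `μ` is checked by splitting a set
along the domain of the chart: outside nothing moves, and inside `μ` is Lebesgue measure, which `φ`
preserves. -/
theorem exists_volDiff_of_volPert [T2Space M] [BorelSpace M] (hψ : IsVolumeChart μ ψ)
    (hK : IsCompact K) (hKt : K ⊆ ψ.target) {ε : ℝ} (hε : ε < 1) (hφ : VolPert ε K φ) :
    ∃ f : VolDiff d μ, ⇑f.1 = chartLift ψ φ := by
  have hs := hφ.supportedIn hε
  set e := hφ.toHomeomorph hε
  have he : ∀ y, φ (e.symm y) = y := e.apply_symm_apply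
  have he' : ∀ y, e.symm (φ y) = y := e.symm_apply_apply
  have hs' : SupportedIn K e.symm := by
    refine ⟨fun y hy => ?_, fun y hy => ?_⟩
    · rw [← hφ.mem_iff hε, he]
      exact hy
    · have := he' y
      rwa [hφ.eq_self y hy] at this
  have hc := contMDiff_chartLift hψ hs hφ.contDiff hK hKt
  have hc' := contMDiff_chartLift hψ hs' (hφ.contDiff_symm hε) hK hKt
  let F : M ≃ₘ^1⟮𝓡 d, 𝓡 d⟯ M :=
    { toFun := chartLift ψ φ
      invFun := chartLift ψ e.symm
      left_inv := chartLift_comp hs hKt he'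
      right_inv := chartLift_comp hs' hKt he
      contMDiff_toFun := hc
      contMDiff_invFun := hc' }
  refine ⟨⟨F, hc.continuous.measurable, ?_⟩, rfl⟩
  ext A hA
  have hm : Measurable (chartLift ψ φ) := hc.continuous.measurable
  have hms := ψ.open_source.measurableSet
  have hF : (F : M → M) = chartLift ψ φ := rfl
  rw [hF, Measure.map_apply hm hA]
  change μ (chartLift ψ φ ⁻¹' A) = μ A
  have h1 : chartLift ψ φ ⁻¹' A \ ψ.source = A \ ψ.source := by
    ext x
    refine and_congr_left fun hx => ?_
    rw [mem_preimage, chartLift_of_notMem hx]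
  have h2 : μ (chartLift ψ φ ⁻¹' A ∩ ψ.source) = μ (A ∩ ψ.source) := by
    have hB := (hm hA).inter hms
    rw [hψ.measure_eq _ hB inter_subset_right, hψ.measure_eq _ (hA.inter hms) inter_subset_right,
      ← hφ.measure_image hε volume (measurableSet_image_openPartialHomeomorph ψ hB
        inter_subset_right)]
    congr 1
    ext y
    constructor
    · rintro ⟨_, ⟨x, ⟨hxA, hxs⟩, rfl⟩, rfl⟩
      exact ⟨chartLift ψ φ x, ⟨hxA, chartLift_mem_source hs hKt hxs⟩, apply_chartLift hs hKt hxs⟩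
    · rintro ⟨x, ⟨hxA, hxs⟩, rfl⟩
      refine ⟨_, ⟨chartLift ψ e.symm x, ⟨?_, chartLift_mem_source hs' hKt hxs⟩, rfl⟩, ?_⟩
      · rw [mem_preimage, chartLift_comp hs' hKt he]
        exact hxA
      · rw [apply_chartLift hs' hKt hxs, he]
  rw [← measure_inter_add_sdiff _ hms, h1, h2, measure_inter_add_sdiff _ hms]

/-- The composition of two volume preserving diffeomorphisms. -/
noncomputable def VolDiff.comp (g f : VolDiff d μ) : VolDiff d μ := ⟨f.1.trans g.1, g.2.comp f.2⟩

theorem VolDiff.comp_apply (g f : VolDiff d μ) (x : M) :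
    (g.comp f).toPerm x = g.toPerm (f.toPerm x) := rfl

theorem VolDiff.contMDiff (f : VolDiff d μ) : ContMDiff (𝓡 d) (𝓡 d) 1 f.toPerm :=
  f.1.contMDiff_toFun

theorem VolDiff.continuous (f : VolDiff d μ) : Continuous f.toPerm := f.contMDiff.continuous

theorem VolDiff.measurePreserving (f : VolDiff d μ) : MeasurePreserving f.toPerm μ μ := f.2

end Lift

/-! ### Tangent maps read in a chart, and small perturbations in the `C¹` topology -/

section Tangent

variable {d : ℕ} {M : Type*} [TopologicalSpace M] [ChartedSpace (EuclideanSpace ℝ (Fin d)) M]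

theorem tangentMap_congr {f f' : M → M} {v : TangentBundle (𝓡 d) M} (h : f =ᶠ[𝓝 v.1] f') :
    tangentMap (𝓡 d) (𝓡 d) f v = tangentMap (𝓡 d) (𝓡 d) f' v := by
  simp only [tangentMap]
  rw [h.mfderiv_eq]
  congr 1
  exact h.eq_of_nhds

variable [MeasurableSpace M] {μ : Measure M} {ψ : OpenPartialHomeomorph M (Euc d)}

theorem IsVolumeChart.mdifferentiableAt (hψ : IsVolumeChart μ ψ) {x : M} (hx : x ∈ ψ.source) :
    MDifferentiableAt (𝓡 d) (𝓡 d) ψ x :=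
  (hψ.contMDiffOn.contMDiffAt (ψ.open_source.mem_nhds hx)).mdifferentiableAt (by simp)

theorem IsVolumeChart.mdifferentiableAt_symm (hψ : IsVolumeChart μ ψ) {y : Euc d}
    (hy : y ∈ ψ.target) : MDifferentiableAt (𝓡 d) (𝓡 d) ψ.symm y :=
  (hψ.contMDiffOn_symm.contMDiffAt (ψ.open_target.mem_nhds hy)).mdifferentiableAt (by simp)

end Tangent

section Topology

variable {d : ℕ} {M : Type*} [TopologicalSpace M] [T2Space M]
  [ChartedSpace (EuclideanSpace ℝ (Fin d)) M] [MeasurableSpace M] [BorelSpace M] {μ : Measure M}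
  {ψ : OpenPartialHomeomorph M (Euc d)} {K : Set (Euc d)} [IsManifold (𝓡 d) 1 M]

/-- A chart reads tangent vectors as pairs of a point and a vector. -/
noncomputable def tangentCoord (ψ : OpenPartialHomeomorph M (Euc d))
    (v : TangentBundle (𝓡 d) M) : Euc d × Euc d :=
  tangentBundleModelSpaceHomeomorph (𝓡 d) (tangentMap (𝓡 d) (𝓡 d) ψ v)

/-- The tangent vector with given coordinates in a chart. -/
noncomputable def tangentOfCoord (ψ : OpenPartialHomeomorph M (Euc d)) (z : Euc d × Euc d) :
    TangentBundle (𝓡 d) M :=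
  tangentMap (𝓡 d) (𝓡 d) ψ.symm (⟨z.1, z.2⟩ : TangentBundle (𝓡 d) (Euc d))

theorem continuous_tangentVector_mk :
    Continuous fun z : Euc d × Euc d => (⟨z.1, z.2⟩ : TangentBundle (𝓡 d) (Euc d)) :=
  (tangentBundleModelSpaceHomeomorph (𝓡 d)).symm.continuous

omit [T2Space M] [BorelSpace M] in
theorem IsVolumeChart.continuousOn_tangentOfCoord (hψ : IsVolumeChart μ ψ) :
    ContinuousOn (tangentOfCoord ψ) (ψ.target ×ˢ univ) := by
  have h1 := hψ.contMDiffOn_symm.continuousOn_tangentMapWithin le_rfl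
    ψ.open_target.uniqueMDiffOn
  have h3 : ContinuousOn (fun z : Euc d × Euc d => tangentMapWithin (𝓡 d) (𝓡 d) ψ.symm ψ.target
      (⟨z.1, z.2⟩ : TangentBundle (𝓡 d) (Euc d))) (ψ.target ×ˢ univ) :=
    ContinuousOn.comp h1 (continuous_tangentVector_mk (d := d)).continuousOn fun z hz => hz.1
  refine h3.congr fun z hz => ?_
  have h4 := tangentMapWithin_eq_tangentMap (I := 𝓡 d) (I' := 𝓡 d) (f := ψ.symm)
    (p := (⟨z.1, z.2⟩ : TangentBundle (𝓡 d) (Euc d)))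
    (ψ.open_target.uniqueMDiffOn z.1 hz.1) (hψ.mdifferentiableAt_symm hz.1)
  exact h4.symm

omit [T2Space M] [BorelSpace M] in
theorem IsVolumeChart.continuousOn_tangentCoord (hψ : IsVolumeChart μ ψ) :
    ContinuousOn (tangentCoord ψ) (Bundle.TotalSpace.proj ⁻¹' ψ.source) := by
  have h1 := hψ.contMDiffOn.continuousOn_tangentMapWithin le_rfl ψ.open_source.uniqueMDiffOn
  have h2 := (tangentBundleModelSpaceHomeomorph (𝓡 d)).continuous
  refine (h2.comp_continuousOn h1).congr fun v hv => ?_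
  exact congrArg (tangentBundleModelSpaceHomeomorph (𝓡 d))
    (tangentMapWithin_eq_tangentMap (ψ.open_source.uniqueMDiffOn v.1 hv)
      (hψ.mdifferentiableAt hv)).symm

omit [T2Space M] [BorelSpace M] [IsManifold (𝓡 d) 1 M] in
theorem IsVolumeChart.tangentOfCoord_tangentCoord (hψ : IsVolumeChart μ ψ)
    {v : TangentBundle (𝓡 d) M} (hv : v.1 ∈ ψ.source) :
    tangentOfCoord ψ (tangentCoord ψ v) = v := by
  have h1 := tangentMap_comp_at v (hψ.mdifferentiableAt_symm (ψ.map_source hv))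
    (hψ.mdifferentiableAt hv)
  have h2 : ψ.symm ∘ ψ =ᶠ[𝓝 v.1] id := by
    filter_upwards [ψ.open_source.mem_nhds hv] with y hy using ψ.left_inv hy
  rw [tangentMap_congr h2, tangentMap_id] at h1
  exact h1.symm

omit [T2Space M] [BorelSpace M] [IsManifold (𝓡 d) 1 M] in
theorem IsVolumeChart.tangentMap_chartLift (hψ : IsVolumeChart μ ψ) {φ : Euc d → Euc d}
    (hφ : Differentiable ℝ φ) {v : TangentBundle (𝓡 d) M} (hv : v.1 ∈ ψ.source)
    (hφv : φ (ψ v.1) ∈ ψ.target) :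
    tangentMap (𝓡 d) (𝓡 d) (chartLift ψ φ) v = tangentOfCoord ψ
      (φ (tangentCoord ψ v).1, fderiv ℝ φ (tangentCoord ψ v).1 (tangentCoord ψ v).2) := by
  have hφd : MDifferentiableAt (𝓡 d) (𝓡 d) φ (ψ v.1) := (hφ _).mdifferentiableAt
  rw [tangentMap_congr (chartLift_eventuallyEq hv),
    tangentMap_comp_at v (hψ.mdifferentiableAt_symm hφv) (hφd.comp v.1 (hψ.mdifferentiableAt hv)),
    tangentMap_comp_at v hφd (hψ.mdifferentiableAt hv)]
  rw [tangentOfCoord]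
  congr 1
  simp only [tangentMap, mfderiv_eq_fderiv]
  rfl

/-- The vectors of `C` over the support have a compact set `C'` of coordinates. A perturbation moves
their base points by at most `ε * (2 * |R| + 1)` and their fibre parts by at most `ε * |B|`, so they
stay in a thickening of `C'`. Elsewhere the lift is locally the identity. -/
theorem exists_mapsTo_tangentMap (hψ : IsVolumeChart μ ψ) (hK : IsCompact K) (hKt : K ⊆ ψ.target)
    {C O : Set (TangentBundle (𝓡 d) M)} (hC : IsCompact C) (hO : IsOpen O) (hCO : C ⊆ O) :
    ∃ ε > 0, ∀ φ, VolPert ε K φ → MapsTo (tangentMap (𝓡 d) (𝓡 d) (chartLift ψ φ)) C O := by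
  rcases subsingleton_or_nontrivial (Euc d) with hsub | hnt
  · refine ⟨1, one_pos, fun φ _ v hv => ?_⟩
    have : chartLift ψ φ = id := by
      funext x
      by_cases hx : x ∈ ψ.source
      · rw [chartLift_of_mem hx, Subsingleton.elim (φ (ψ x)) (ψ x), ψ.left_inv hx]; rfl
      · rw [chartLift_of_notMem hx]; rfl
    rw [this, tangentMap_id]
    exact hCO hv
  have hΩ : IsOpen ((ψ.target ×ˢ univ) ∩ tangentOfCoord ψ ⁻¹' O) :=
    hψ.continuousOn_tangentOfCoord.isOpen_inter_preimage (ψ.open_target.prod isOpen_univ) hO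
  set C' := tangentCoord ψ '' (C ∩ Bundle.TotalSpace.proj ⁻¹' (ψ.symm '' K)) with hC'def
  have hKc := isClosed_symm_image hK hKt
  have hKs := symm_image_subset_source hKt
  have hC' : IsCompact C' :=
    (hC.inter_right (hKc.preimage (FiberBundle.continuous_proj _ _))).image_of_continuousOn
      (hψ.continuousOn_tangentCoord.mono fun v hv => hKs hv.2)
  have hC'Ω : C' ⊆ (ψ.target ×ˢ univ) ∩ tangentOfCoord ψ ⁻¹' O := by
    rintro _ ⟨v, ⟨hvC, hvK⟩, rfl⟩
    refine ⟨⟨ψ.map_source (hKs hvK), mem_univ _⟩, ?_⟩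
    rw [mem_preimage, hψ.tangentOfCoord_tangentCoord (hKs hvK)]
    exact hCO hvC
  obtain ⟨δ, hδ, hδΩ⟩ := hC'.exists_thickening_subset_open hΩ hC'Ω
  obtain ⟨B, hB⟩ := hC'.isBounded.exists_norm_le
  obtain ⟨R, hR⟩ := hK.isBounded.subset_closedBall 0
  set ε := min (1 / 2) (δ / (2 * (2 * |R| + 1 + |B|)))
  have hε : 0 < ε := lt_min (by norm_num) (by positivity)
  have hε1 : ε < 1 := (min_le_left _ _).trans_lt (by norm_num)
  have hε2 : ε * (2 * |R| + 1 + |B|) < δ := by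
    have : ε * (2 * (2 * |R| + 1 + |B|)) ≤ δ := (le_div_iff₀ (by positivity)).1 (min_le_right _ _)
    linarith
  refine ⟨ε, hε, fun φ hφ v hv => ?_⟩
  have hs := hφ.supportedIn hε1
  by_cases hvK : v.1 ∈ ψ.symm '' K
  · have hvs := hKs hvK
    rw [hψ.tangentMap_chartLift hφ.differentiable hvs (hs.mem_target hKt (ψ.map_source hvs))]
    have hmem : tangentCoord ψ v ∈ C' := ⟨v, ⟨hv, hvK⟩, rfl⟩
    generalize tangentCoord ψ v = z at hmem
    have hRK := (hφ.mono_set (hR.trans (Metric.closedBall_subset_closedBall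
      (le_abs_self R)))).norm_sub_le (abs_nonneg R) z.1
    have hw : ‖z.2‖ ≤ |B| := ((norm_snd_le z).trans (hB _ hmem)).trans (le_abs_self _)
    have hεR : 0 ≤ ε * (2 * |R| + 1) := by positivity
    have hεB : 0 ≤ ε * |B| := by positivity
    refine (hδΩ (Metric.mem_thickening_iff.2 ⟨z, hmem, ?_⟩)).2
    rw [Prod.dist_eq]
    refine max_lt ?_ ?_
    · rw [dist_eq_norm]
      exact lt_of_le_of_lt hRK (by linarith)
    · rw [dist_eq_norm]
      have h3 := (fderiv ℝ φ z.1 - ContinuousLinearMap.id ℝ (Euc d)).le_opNorm z.2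
      have h4 := mul_le_mul (hφ.norm_fderiv_sub_le z.1) hw (norm_nonneg _) hε.le
      exact lt_of_le_of_lt (h3.trans h4) (by linarith)
  · rw [tangentMap_congr (chartLift_eventuallyEq_id hs hK hKt hvK), tangentMap_id]
    exact hCO hv

end Topology

section Perturbation

variable {d : ℕ} {M : Type*} [TopologicalSpace M] [T2Space M]
  [ChartedSpace (EuclideanSpace ℝ (Fin d)) M] [MeasurableSpace M] [BorelSpace M] {μ : Measure M}
  {ψ : OpenPartialHomeomorph M (Euc d)} {K : Set (Euc d)} [IsManifold (𝓡 d) ∞ M]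

/-- Small volume preserving perturbations in a chart stay in a given neighbourhood. -/
theorem exists_perturbation_mem (hψ : IsVolumeChart μ ψ) (hK : IsCompact K) (hKt : K ⊆ ψ.target)
    {U : Set (VolDiff d μ)} (hU : IsOpen U) {g : VolDiff d μ} (hg : g ∈ U) :
    ∃ ε > 0, ∀ φ, VolPert ε K φ → ∃ g' ∈ U, ∀ x, g'.toPerm x = g.toPerm (chartLift ψ φ x) := by
  have : IsManifold (𝓡 d) 1 M := IsManifold.of_le (n := ∞) (by simp)
  -- Otherwise some perturbations of size `1 / (n + 2)` all avoid `U`, although their compositions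
  -- with `g` tend to `g`. The shift by `2` keeps the size below `1`, so that they lift to
  -- diffeomorphisms.
  by_contra! hcon
  have hpos : ∀ n : ℕ, (0 : ℝ) < 1 / (n + 2) := fun n => by positivity
  choose φ hφ hnot using fun n : ℕ => hcon (1 / (n + 2)) (hpos n)
  have hlt : ∀ n : ℕ, (1 / (n + 2) : ℝ) < 1 := fun n => by
    rw [div_lt_one (by positivity)]
    have : (0 : ℝ) ≤ n := Nat.cast_nonneg n
    linarith
  choose F hF using fun n => exists_volDiff_of_volPert hψ hK hKt (hlt n) (hφ n)
  have htend : Tendsto (fun n => g.comp (F n)) atTop (𝓝 g) := by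
    rw [nhds_induced, tendsto_comap_iff, ContinuousMap.tendsto_nhds_compactOpen]
    intro C hC O hO hCO
    obtain ⟨ε, hε, H⟩ := exists_mapsTo_tangentMap hψ hK hKt hC
      (hO.preimage g.tangent.continuous) hCO
    obtain ⟨N, hN⟩ := exists_nat_gt (1 / ε)
    filter_upwards [eventually_ge_atTop N] with n hn
    have hle : (1 / (n + 2) : ℝ) ≤ ε := by
      rw [div_le_iff₀ (by positivity)]
      rw [div_lt_iff₀ hε] at hN
      have : (N : ℝ) ≤ n := by exact_mod_cast hn
      nlinarith
    intro v hv
    have h1 := H (φ n) ((hφ n).mono hle) hv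
    have h2 : tangentMap (𝓡 d) (𝓡 d) (g.comp (F n)).toPerm v =
        tangentMap (𝓡 d) (𝓡 d) g.toPerm (tangentMap (𝓡 d) (𝓡 d) (F n).toPerm v) :=
      tangentMap_comp_at v (g.contMDiff.mdifferentiable (by simp) _)
        ((F n).contMDiff.mdifferentiable (by simp) _)
    change tangentMap (𝓡 d) (𝓡 d) (g.comp (F n)).toPerm v ∈ O
    rw [h2]
    have h3 : ((F n).toPerm : M → M) = chartLift ψ (φ n) := hF n
    rw [h3]
    exact h1
  obtain ⟨n, hn⟩ := (htend.eventually_mem (hU.mem_nhds hg)).exists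
  obtain ⟨x, hx⟩ := hnot n _ hn
  apply hx
  rw [VolDiff.comp_apply]
  exact congrArg _ (congrFun (hF n) x)

end Perturbation

end WeakShadowing

namespace WeakShadowing

/-! ### From trivial real spectrum to finite order by small transvections -/

section LinearAlgebra

open Polynomial LinearMap

theorem exists_dual_eq_one_eq_zero {V : Type*} [AddCommGroup V] [Module ℝ V] {v w : V}
    (h : v ∉ Submodule.span ℝ {w}) :
    ∃ f : Module.Dual ℝ V, f v = 1 ∧ f w = 0 := by
  obtain ⟨f, hf, hle⟩ := Submodule.exists_le_ker_of_notMem h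
  refine ⟨(f v)⁻¹ • f, by simp [hf], ?_⟩
  have : f w = 0 := hle (Submodule.mem_span_singleton_self w)
  simp [this]

variable {V : Type*} [AddCommGroup V] [Module ℝ V] [FiniteDimensional ℝ V]

/-- If `(t - A) z = A v`, then `t - A ∘ (1 + f ⊗ v) = (t - A) ∘ (1 - f ⊗ z)`, and the last factor
has determinant `1 - f z`. This gives the new characteristic polynomial from one explicit solution
`z`. -/
theorem eval_charpoly_comp_transvection (A : Module.End ℝ V) (f : Module.Dual ℝ V) {v z : V} {t : ℝ}
    (hz : t • z - A z = A v) :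
    (A ∘ₗ transvection f v).charpoly.eval t = A.charpoly.eval t * (1 - f z) := by
  have key : algebraMap ℝ (Module.End ℝ V) t - A ∘ₗ transvection f v =
      (algebraMap ℝ (Module.End ℝ V) t - A) ∘ₗ transvection f (-z) := by
    ext x
    simp only [LinearMap.sub_apply, Module.algebraMap_end_apply, LinearMap.comp_apply,
      transvection.apply, map_add, map_smul, ← hz, smul_neg, map_neg, smul_sub,
      smul_comm (f x) t]
    abel
  rw [LinearMap.eval_charpoly, LinearMap.eval_charpoly, key, LinearMap.det_comp,
    transvection.det, map_neg, ← sub_eq_add_neg]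

theorem eq_of_eval_eq_of_ne {p q : ℝ[X]} (a : ℝ) (h : ∀ t, t ≠ a → p.eval t = q.eval t) : p = q :=
  eq_of_infinite_eval_eq p q <| (Set.finite_singleton a).infinite_compl.mono fun t ht => h t ht

/-- A double eigenvalue gives a two-dimensional invariant subspace in triangular form. -/
theorem exists_triangular_pair {A : Module.End ℝ V} {l : ℝ} (h : (X - C l) ^ 2 ∣ A.charpoly) :
    ∃ (e₁ e₂ : V) (a : ℝ), e₁ ∉ Submodule.span ℝ {e₂} ∧ e₂ ∉ Submodule.span ℝ {e₁} ∧
      A e₁ = l • e₁ ∧ A e₂ = l • e₂ + a • e₁ := by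
  have hne : A.charpoly ≠ 0 := A.charpoly_monic.ne_zero
  have hmul := (le_rootMultiplicity_iff hne).2 h
  rw [← LinearMap.finrank_maxGenEigenspace_eq] at hmul
  have hroot : A.charpoly.IsRoot l := dvd_iff_isRoot.1 ((dvd_pow_self _ two_ne_zero).trans h)
  obtain ⟨e₁, he₁⟩ := ((Module.End.hasEigenvalue_iff_isRoot_charpoly A l).2 hroot).exists_hasEigenvector
  have hA : A e₁ = l • e₁ := he₁.apply_eq_smul
  have h0 : e₁ ≠ 0 := he₁.2
  obtain ⟨x, hx, hxe⟩ : ∃ x ∈ A.maxGenEigenspace l, x ∉ Submodule.span ℝ {e₁} := by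
    by_contra! hcon
    have := Submodule.finrank_mono (show A.maxGenEigenspace l ≤ Submodule.span ℝ {e₁} from hcon)
    rw [finrank_span_singleton h0] at this
    omega
  obtain ⟨k, hk⟩ := (Module.End.mem_maxGenEigenspace A l x).1 hx
  have hex : ∃ k : ℕ, ((A - l • 1) ^ k : Module.End ℝ V) x ∈ Submodule.span ℝ {e₁} :=
    ⟨k, by rw [hk]; exact zero_mem _⟩
  classical
  obtain ⟨m, hm⟩ : ∃ m, Nat.find hex = m + 1 := by
    refine Nat.exists_eq_succ_of_ne_zero fun h0 => hxe ?_
    simpa [h0] using Nat.find_spec hex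
  have hspec := Nat.find_spec hex
  rw [hm, pow_succ', Module.End.mul_apply] at hspec
  obtain ⟨a, ha⟩ := Submodule.mem_span_singleton.1 hspec
  have hmin := Nat.find_min hex (m := m) (by omega)
  refine ⟨e₁, ((A - l • 1) ^ m : Module.End ℝ V) x, a, fun hmem => ?_, hmin, hA, ?_⟩
  · obtain ⟨c, hc⟩ := Submodule.mem_span_singleton.1 hmem
    have hc0 : c ≠ 0 := by rintro rfl; exact h0 (by simpa using hc.symm)
    exact hmin (Submodule.mem_span_singleton.2 ⟨c⁻¹, by rw [← hc, inv_smul_smul₀ hc0]⟩)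
  · rw [ha]; simp

/-- A property of endomorphisms that survives composition with small transvections. -/
def StableUnderTransvections (P : Module.End ℝ V → Prop) : Prop :=
  ∀ A, P A → ∀ (f : Module.Dual ℝ V) (v : V), f v = 0 →
    ∃ c₀ > 0, ∀ c : ℝ, |c| < c₀ → P (A ∘ₗ transvection (c • f) v)

variable {P : Module.End ℝ V → Prop}

/-- If the pair is diagonal, a transvection adding a multiple of `e₁` to `e₂` creates a Jordan
block. The solution `z` is then a multiple of `e₁`, which `f` kills, so the characteristic
polynomial is unchanged. -/
theorem StableUnderTransvections.exists_nondegenerate_pair (hP : StableUnderTransvections P)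
    {A : Module.End ℝ V} (hA : P A) {l : ℝ} (hl : l ≠ 0) (h : (X - C l) ^ 2 ∣ A.charpoly) :
    ∃ A', P A' ∧ A'.charpoly = A.charpoly ∧ ∃ (e₁ e₂ : V) (a : ℝ), a ≠ 0 ∧
      e₁ ∉ Submodule.span ℝ {e₂} ∧ A' e₁ = l • e₁ ∧ A' e₂ = l • e₂ + a • e₁ := by
  obtain ⟨e₁, e₂, a, h₁, h₂, hA₁, hA₂⟩ := exists_triangular_pair h
  by_cases ha : a = 0
  · subst ha
    obtain ⟨f, hf₂, hf₁⟩ := exists_dual_eq_one_eq_zero h₂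
    obtain ⟨c₀, hc₀, hc⟩ := hP A hA f e₁ hf₁
    refine ⟨_, hc (c₀ / 2) (by rw [abs_of_pos (by positivity)]; linarith), ?_, e₁, e₂, c₀ / 2 * l,
      by positivity, h₁, ?_, ?_⟩
    · refine eq_of_eval_eq_of_ne l fun t ht => ?_
      have ht : t - l ≠ 0 := sub_ne_zero.2 ht
      rw [eval_charpoly_comp_transvection A _ (z := (l / (t - l)) • e₁)]
      · simp [hf₁]
      · rw [map_smul, hA₁, smul_smul, smul_smul, ← sub_smul]
        congr 1
        field_simp
    · simp [transvection.apply, hf₁, hA₁]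
    · simp [transvection.apply, hf₂, hA₁, hA₂, smul_smul]
  · exact ⟨A, hA, rfl, e₁, e₂, a, ha, h₁, hA₁, hA₂⟩

/-- A double eigenvalue `±1` can be replaced by any close pair of eigenvalues of product `1`. -/
theorem StableUnderTransvections.exists_charpoly_eq (hP : StableUnderTransvections P)
    {A : Module.End ℝ V} (hA : P A) {l : ℝ} (hl : l ^ 2 = 1) {Q : ℝ[X]}
    (h : A.charpoly = (X - C l) ^ 2 * Q) :
    ∃ η > 0, ∀ τ : ℝ, |τ| < η → ∃ A', P A' ∧ A'.charpoly = (X ^ 2 - C (2 * l + τ) * X + 1) * Q := by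
  have hl0 : l ≠ 0 := by rintro rfl; norm_num at hl
  obtain ⟨A', hA', hχ, e₁, e₂, a, ha, he, h₁, h₂⟩ :=
    hP.exists_nondegenerate_pair hA hl0 (Dvd.intro _ h.symm)
  obtain ⟨f, hf₁, hf₂⟩ := exists_dual_eq_one_eq_zero he
  -- Composing with the transvection `c • f` along `e₂` gives, on the span of `e₁` and `e₂`, trace
  -- `2 * l + c * a` and determinant `l ^ 2 = 1`. As `a ≠ 0`, `c = τ / a` prescribes the trace.
  obtain ⟨c₀, hc₀, hc⟩ := hP A' hA' f e₂ hf₂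
  refine ⟨c₀ * |a|, by positivity, fun τ hτ => ⟨_, hc (τ / a) ?_, ?_⟩⟩
  · rwa [abs_div, div_lt_iff₀ (by positivity)]
  · refine eq_of_eval_eq_of_ne l fun t ht => ?_
    have ht : t - l ≠ 0 := sub_ne_zero.2 ht
    rw [eval_charpoly_comp_transvection A' _
      (z := (l / (t - l)) • e₂ + (a * t / (t - l) ^ 2) • e₁), hχ, h]
    · simp only [eval_mul, eval_pow, eval_sub, eval_X, eval_C, eval_add, eval_one, map_add,
        map_smul, LinearMap.smul_apply, hf₁, hf₂, smul_eq_mul]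
      field_simp
      linear_combination Q.eval t * a * hl
    · rw [map_add, map_smul, map_smul, h₁, h₂]
      match_scalars <;> field_simp <;> ring

/-- The quadratic is the minimal polynomial of `l * exp (2πi / n)` with `n = N * k + 1` and `k`
large. As `N` is even, `n` is odd and `l ^ n = l`. The form of `n` is chosen for
`isCoprime_of_dvd_X_pow_sub_one`. -/
theorem quadratic_dvd_X_pow_sub_C {l : ℝ} (hl : l ^ 2 = 1) {N : ℕ} (hN : 0 < N) (hN₂ : Even N)
    {η : ℝ} (hη : 0 < η) : ∃ τ : ℝ, |τ| < η ∧ ∃ k : ℕ,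
      (X ^ 2 - C (2 * l + τ) * X + 1 : ℝ[X]) ∣ X ^ (N * k + 1) - C l ∧
      ∀ s : ℝ, s ^ 2 = 1 → (X ^ 2 - C (2 * l + τ) * X + 1 : ℝ[X]).eval s ≠ 0 := by
  have habs : |l| = 1 := by
    rcases (sq_eq_sq_iff_eq_or_eq_neg.1 (hl.trans (one_pow 2).symm)) with rfl | rfl <;> simp
  have hlim : Tendsto (fun k : ℕ => Real.cos (2 * Real.pi / ((N * k + 1 : ℕ) : ℝ))) atTop (𝓝 1) := by
    rw [← Real.cos_zero]
    refine (Real.continuous_cos.tendsto 0).comp (tendsto_const_nhds.div_atTop ?_)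
    refine tendsto_natCast_atTop_atTop.comp (tendsto_atTop_mono (fun k => ?_) tendsto_id)
    exact (Nat.le_mul_of_pos_left k hN).trans (Nat.le_succ _)
  obtain ⟨k, hk, hk2⟩ := ((hlim.eventually (Metric.ball_mem_nhds 1 (half_pos hη))).and
    (eventually_ge_atTop 2)).exists
  set n := N * k + 1 with hn
  have hn3 : (3 : ℝ) ≤ n := by
    have : 3 ≤ n := by nlinarith
    exact_mod_cast this
  set θ := 2 * Real.pi / (n : ℝ) with hθ
  have hθ0 : 0 < θ := by positivity
  have hθπ : θ < Real.pi := by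
    rw [hθ, div_lt_iff₀ (by linarith)]
    nlinarith [Real.pi_pos]
  have hsin : 0 < Real.sin θ := Real.sin_pos_of_pos_of_lt_pi hθ0 hθπ
  have hsc := Real.sin_sq_add_cos_sq θ
  set z : ℂ := l * Complex.exp (θ * Complex.I) with hz
  have hre : z.re = l * Real.cos θ := by
    rw [hz, Complex.re_ofReal_mul, Complex.exp_ofReal_mul_I_re]
  have him : z.im = l * Real.sin θ := by
    rw [hz, Complex.im_ofReal_mul, Complex.exp_ofReal_mul_I_im]
  have hnorm : ‖z‖ = 1 := by
    rw [hz, norm_mul, Complex.norm_exp_ofReal_mul_I, Complex.norm_real, Real.norm_eq_abs, habs,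
      one_mul]
  refine ⟨2 * l * (Real.cos θ - 1), ?_, k, ?_, fun s hs => ?_⟩
  · rw [Real.dist_eq] at hk
    rw [abs_mul, abs_mul, habs, abs_two]
    linarith
  · have hdvd := quadratic_dvd_of_aeval_eq_zero_im_ne_zero (X ^ n - C l : ℝ[X]) (z := z) ?_ ?_
    · rwa [hnorm, one_pow, C_1, hre,
        show 2 * (l * Real.cos θ) = 2 * l + 2 * l * (Real.cos θ - 1) by ring] at hdvd
    · have hpow : (l : ℂ) ^ n = l := by
        obtain ⟨m, rfl⟩ := hN₂
        rw [hn, show (m + m) * k + 1 = 2 * (m * k) + 1 by ring, pow_succ, pow_mul]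
        norm_cast
        rw [hl, one_pow, one_mul]
      have hexp : Complex.exp (θ * Complex.I) ^ n = 1 := by
        rw [← Complex.exp_nat_mul, hθ]
        push_cast
        rw [← Complex.exp_two_pi_mul_I]
        congr 1
        have : (n : ℂ) ≠ 0 := by exact_mod_cast (by positivity : n ≠ 0)
        field_simp
      simp [hz, mul_pow, hpow, hexp]
    · rw [him]
      exact mul_ne_zero (by rintro rfl; norm_num at hl) hsin.ne'
  · simp only [eval_add, eval_sub, eval_mul, eval_pow, eval_X, eval_C, eval_one, hs]
    intro h
    have h2 : l * Real.cos θ * s = 1 := by linarith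
    have h3 : Real.cos θ ^ 2 = 1 := by
      have := congrArg (· ^ 2) h2
      simp only [mul_pow, hl, hs] at this
      linarith
    nlinarith

/-- A common complex root `a` has `a ^ N = 1` and `a ^ (N * k + 1) = l`, hence `a = l`, which is not
a root of `r`. -/
theorem isCoprime_of_dvd_X_pow_sub_one {l : ℝ} {N k : ℕ} {Q r : ℝ[X]}
    (hQ : Q ∣ X ^ N - 1) (hr : r ∣ X ^ (N * k + 1) - C l) (hrl : r.eval l ≠ 0) : IsCoprime r Q := by
  refine (isCoprime_iff_aeval_ne_zero_of_isAlgClosed ℝ ℂ r Q).2 fun a => ?_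
  by_contra! h
  have h1 : a ^ N = 1 := by
    have := aeval_eq_zero_of_dvd_aeval_eq_zero hQ h.2
    simpa [sub_eq_zero] using this
  have h2 : a = l := by
    have := aeval_eq_zero_of_dvd_aeval_eq_zero hr h.1
    simpa [sub_eq_zero, pow_succ, pow_mul, h1] using this
  refine hrl ?_
  have := h.1
  rw [h2, ← Complex.coe_algebraMap, aeval_algebraMap_apply] at this
  simpa using this

theorem isCoprime_X_sub_C_of_eval_ne_zero {a : ℝ} {Q : ℝ[X]} (h : Q.eval a ≠ 0) :
    IsCoprime (X - C a) Q :=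
  (irreducible_X_sub_C a).coprime_iff_not_dvd.2 fun hd => h (dvd_iff_isRoot.1 hd)

/-- Each step trades a double eigenvalue `±1` for a new pair of roots of unity, absorbed in `Q`. As
this pair is not among the roots of `Q`, the new `Q` still divides some `X ^ (2 * N) - 1`. -/
theorem StableUnderTransvections.exists_pow_eq_one_aux (hP : StableUnderTransvections P) (s : ℕ) :
    ∀ i j : ℕ, i + j ≤ s → ∀ A, P A → ∀ (Q : ℝ[X]) (N : ℕ), 0 < N → Q ∣ X ^ (2 * N) - 1 →
      Q.eval 1 ≠ 0 → Q.eval (-1) ≠ 0 → A.charpoly = (X - C 1) ^ i * ((X - C (-1)) ^ j * Q) →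
      ∃ B, P B ∧ ∃ N > 0, B ^ N = 1 := by
  induction s using Nat.strong_induction_on with
  | _ s ih =>
  intro i j hij A hA Q N hN hQ hQ₁ hQ₂ hχ
  have step : ∀ l : ℝ, l ^ 2 = 1 → ∀ i' j', i' + j' < s →
      A.charpoly = (X - C l) ^ 2 * ((X - C 1) ^ i' * ((X - C (-1)) ^ j' * Q)) →
      ∃ B, P B ∧ ∃ N > 0, B ^ N = 1 := by
    intro l hl i' j' hs hχ'
    obtain ⟨η, hη, hτ⟩ := hP.exists_charpoly_eq hA hl hχ'
    obtain ⟨τ, hτη, k, hdvd, hev⟩ := quadratic_dvd_X_pow_sub_C hl (Nat.mul_pos two_pos hN)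
      (even_two_mul N) hη
    obtain ⟨A', hA', hχA⟩ := hτ τ hτη
    have hcop := isCoprime_of_dvd_X_pow_sub_one hQ hdvd (hev l hl)
    set r : ℝ[X] := X ^ 2 - C (2 * l + τ) * X + 1
    refine ih (i' + j') hs i' j' le_rfl A' hA' (r * Q) ((2 * N * k + 1) * N) (by positivity)
      (hcop.mul_dvd ?_ ?_) ?_ ?_ ?_
    · refine hdvd.trans (Dvd.dvd.trans ?_ (show (X : ℝ[X]) ^ (2 * (2 * N * k + 1)) - 1 ∣ _ from ?_))
      · refine ⟨X ^ (2 * N * k + 1) + C l, ?_⟩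
        have : (C l : ℝ[X]) ^ 2 = 1 := by rw [← C_pow, hl, C_1]
        linear_combination this
      · rw [← mul_assoc, pow_mul _ (2 * (2 * N * k + 1)) N]
        simpa using sub_dvd_pow_sub_pow ((X : ℝ[X]) ^ (2 * (2 * N * k + 1))) 1 N
    · refine hQ.trans ?_
      rw [show 2 * ((2 * N * k + 1) * N) = 2 * N * (2 * N * k + 1) by ring, pow_mul _ (2 * N)]
      simpa only [one_pow] using sub_dvd_pow_sub_pow ((X : ℝ[X]) ^ (2 * N)) 1 (2 * N * k + 1)
    · rw [eval_mul]; exact mul_ne_zero (hev 1 (by norm_num)) hQ₁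
    · rw [eval_mul]; exact mul_ne_zero (hev (-1) (by norm_num)) hQ₂
    · rw [hχA]; ring
  by_cases hi : 2 ≤ i
  · obtain ⟨i, rfl⟩ := Nat.exists_eq_add_of_le hi
    exact step 1 (by norm_num) i j (by omega) (by rw [hχ]; ring)
  by_cases hj : 2 ≤ j
  · obtain ⟨j, rfl⟩ := Nat.exists_eq_add_of_le hj
    exact step (-1) (by norm_num) i j (by omega) (by rw [hχ]; ring)
  -- Now `i, j ≤ 1`, so the characteristic polynomial is a product of coprime divisors of `X ^ (2 *
  -- N) - 1`, and Cayley–Hamilton applies.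
  refine ⟨A, hA, 2 * N, by positivity, ?_⟩
  have h2 : (X : ℝ[X]) ^ 2 - 1 ∣ X ^ (2 * N) - 1 := by
    rw [pow_mul]
    simpa using sub_dvd_pow_sub_pow ((X : ℝ[X]) ^ 2) 1 N
  have hfac : (X : ℝ[X]) ^ 2 - 1 = (X - C 1) * (X - C (-1)) := by
    simp only [C_neg, C_1]; ring
  rw [hfac] at h2
  have hdvd : A.charpoly ∣ X ^ (2 * N) - 1 := by
    have hQ' : IsCoprime ((X - C (-1)) ^ j) Q := (isCoprime_X_sub_C_of_eval_ne_zero hQ₂).pow_left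
    rw [hχ]
    refine IsCoprime.mul_dvd (IsCoprime.mul_right ?_ (isCoprime_X_sub_C_of_eval_ne_zero hQ₁).pow_left) ?_
      (hQ'.mul_dvd ?_ hQ)
    · exact (isCoprime_X_sub_C_of_eval_ne_zero (by norm_num)).pow
    · exact (pow_dvd_pow _ (by omega : i ≤ 1)).trans (by rw [pow_one]; exact (dvd_mul_right _ _).trans h2)
    · exact (pow_dvd_pow _ (by omega : j ≤ 1)).trans (by rw [pow_one]; exact (dvd_mul_left _ _).trans h2)
  obtain ⟨R, hR⟩ := hdvd
  have := congrArg (aeval A) hR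
  rw [map_mul, LinearMap.aeval_self_charpoly, zero_mul] at this
  simpa [sub_eq_zero] using this

/-- Starting from the trivial real spectrum, small transvections lead to an endomorphism of
finite order. -/
theorem StableUnderTransvections.exists_pow_eq_one (hP : StableUnderTransvections P)
    {A : Module.End ℝ V} (hA : P A) {i j : ℕ} (h : A.charpoly = (X - 1) ^ i * (X + 1) ^ j) :
    ∃ B, P B ∧ ∃ N > 0, B ^ N = 1 :=
  hP.exists_pow_eq_one_aux (i + j) i j le_rfl A hA 1 1 one_pos (one_dvd _) (by simp) (by simp)
    (by simp [h])

end LinearAlgebra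

end WeakShadowing

namespace WeakShadowing

/-! ### Transvections as germs of volume preserving perturbations -/

section LocalTransvection

variable {E : Type*} [NormedAddCommGroup E] [InnerProductSpace ℝ E] [FiniteDimensional ℝ E]

/-- A small transvection is the germ of a volume preserving perturbation with small support. -/
theorem exists_volPert_eventuallyEq_transvection {R ε : ℝ} (hR : 0 < R) (hε : 0 < ε) (f : E →L[ℝ] ℝ)
    {v : E} (hfv : f v = 0) : ∃ c₀ > 0, ∀ c : ℝ, |c| < c₀ →
      ∃ φ, VolPert ε (Metric.closedBall 0 R) φ ∧ φ =ᶠ[𝓝 0] fun x => x + (c * f x) • v := by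
  let κ : ContDiffBump (0 : E) := ⟨R / 2, R, by positivity, by linarith⟩
  have hκ : ∀ x : E, R < ‖x‖ → κ x = 0 := fun x hx =>
    κ.zero_of_le_dist (by rw [dist_zero_right]; exact hx.le)
  by_cases hf : ∃ u, f u = 1
  swap
  · have hf0 : f = 0 := by
      ext x
      by_contra hx
      exact hf ⟨(f x)⁻¹ • x, by simpa using inv_mul_cancel₀ hx⟩
    exact ⟨1, one_pos, fun c _ => ⟨id, (VolPert.id.mono hε.le), by simp [hf0]; rfl⟩⟩
  obtain ⟨u, hu⟩ := hf
  -- The generating function will be `κ * (c / 2 * f ^ 2)`: the second factor is constant along `v`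
  -- as `f v = 0`, and its derivative along `u` is `c * f`.
  obtain ⟨C, hC0, hC⟩ := exists_volPert_of_generating hR.le κ.contDiff hκ u v
  set η := min (1 / 2) (ε / 4) / (C + 1) with hη
  have hη0 : 0 < η := by positivity
  have hCη : C * η ≤ min (1 / 2) (ε / 4) := by
    rw [hη, mul_div_assoc', div_le_iff₀ (by positivity)]
    nlinarith [show 0 < min (1 / 2) (ε / 4) by positivity]
  set B := ‖f‖ + ‖f‖ * R + ‖f‖ * R * ‖f‖ + (‖f‖ * R) ^ 2 + 1
  have hB : 0 < B := by positivity
  refine ⟨η / B, by positivity, fun c hc => ?_⟩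
  have hc' : |c| * B ≤ η := ((lt_div_iff₀ hB).1 hc).le
  have hfx : ∀ x : E, ‖x‖ ≤ R → |f x| ≤ ‖f‖ * R := fun x hx =>
    (f.le_opNorm x).trans (mul_le_mul_of_nonneg_left hx (norm_nonneg f))
  have hdg : ∀ x, HasFDerivAt (fun x => c * f x) (c • f) x := fun x => f.hasFDerivAt.const_mul c
  have hdw : ∀ x, HasFDerivAt (fun x => c / 2 * f x ^ 2) ((c * f x) • f) x := fun x => by
    have := (f.hasFDerivAt (x := x)).pow 2 |>.const_mul (c / 2)
    refine this.congr_fderiv ?_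
    ext y
    simp
    ring
  have hle : ∀ t, 0 ≤ t → t ≤ B → |c| * t ≤ η := fun t _ ht =>
    (mul_le_mul_of_nonneg_left ht (abs_nonneg c)).trans hc'
  have hN := norm_nonneg f
  have hw : SmallOn R η (fun x => c / 2 * f x ^ 2) := by
    refine ⟨contDiff_const.mul (f.contDiff.pow 2), fun x hx => ⟨?_, ?_⟩⟩
    · rw [abs_mul, abs_div, abs_two, abs_pow]
      have h1 := pow_le_pow_left₀ (abs_nonneg _) (hfx x hx) 2
      have h2 := hle ((‖f‖ * R) ^ 2) (by positivity) (by
        simp only [B]; nlinarith [mul_nonneg hN hR.le, mul_nonneg (mul_nonneg hN hR.le) hN])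
      nlinarith [abs_nonneg c, mul_le_mul_of_nonneg_left h1 (abs_nonneg c), sq_nonneg |f x|,
        mul_nonneg (abs_nonneg c) (sq_nonneg |f x|)]
    · rw [(hdw x).fderiv, norm_smul, norm_mul, Real.norm_eq_abs, Real.norm_eq_abs, mul_assoc]
      refine (mul_le_mul_of_nonneg_left (mul_le_mul_of_nonneg_right (hfx x hx) hN)
        (abs_nonneg c)).trans (hle _ (by positivity) ?_)
      simp only [B]
      nlinarith [mul_nonneg hN hR.le, sq_nonneg (‖f‖ * R)]
  have hg : SmallOn R η (fun x => c * f x) := by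
    refine ⟨contDiff_const.mul f.contDiff, fun x hx => ⟨?_, ?_⟩⟩
    · rw [abs_mul]
      refine (mul_le_mul_of_nonneg_left (hfx x hx) (abs_nonneg c)).trans (hle _ (by positivity) ?_)
      simp only [B]
      nlinarith [mul_nonneg (mul_nonneg hN hR.le) hN, sq_nonneg (‖f‖ * R)]
    · rw [(hdg x).fderiv, norm_smul, Real.norm_eq_abs]
      refine hle _ (by positivity) ?_
      simp only [B]
      nlinarith [mul_nonneg hN hR.le, mul_nonneg (mul_nonneg hN hR.le) hN, sq_nonneg (‖f‖ * R)]
  obtain ⟨-, φ, hφ, hφx⟩ := hC η _ _ (hCη.trans (min_le_left _ _)) hw hg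
    (fun x => by rw [(hdw x).fderiv]; simp [hfv]) (fun x => by rw [(hdg x).fderiv]; simp [hfv])
    (fun x => by rw [(hdw x).fderiv]; simp [hu])
  refine ⟨φ, hφ.mono (by linarith [hCη.trans (min_le_right _ _)]), ?_⟩
  have h1 : (κ : E → ℝ) =ᶠ[𝓝 0] 1 := κ.eventuallyEq_one
  filter_upwards [h1.eventuallyEq_nhds] with x hx
  have hd : fderiv ℝ κ x = 0 := by
    rw [hx.fderiv_eq]
    exact fderiv_const_apply 1
  have := hφx x
  rw [hd, hx.eq_of_nhds] at this
  simpa using this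

end LocalTransvection

/-! ### Iterates of locally perturbed maps -/

section Iterates

variable {M : Type*}

/-- The points of `N` stay outside `N` at the intermediate times, so the perturbation acts once
only, at the first step. -/
theorem iterate_eq_iterate_comp {g g' L : M → M} {N : Set M} {n : ℕ} (hg' : ∀ x, g' x = g (L x))
    (hLN : MapsTo L N N) (hL : ∀ x ∉ N, L x = x)
    (hN : ∀ i, 0 < i → i < n → ∀ x ∈ N, g^[i] x ∉ N) {x : M} (hx : x ∈ N) :
    ∀ i, 0 < i → i ≤ n → g'^[i] x = g^[i] (L x) := by
  intro i hi hin
  induction i, hi using Nat.le_induction with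
  | base => exact hg' x
  | succ i hi ih =>
    rw [Function.iterate_succ_apply', Function.iterate_succ_apply', ih (by omega), hg',
      hL _ (hN i hi (by omega) _ (hLN hx))]

variable {d : ℕ} [TopologicalSpace M] {ψ : OpenPartialHomeomorph M (Euc d)}

theorem SupportedIn.mapsTo_chartLift {K : Set (Euc d)} {φ : Euc d → Euc d} (h : SupportedIn K φ)
    (hK : K ⊆ ψ.target) : MapsTo (chartLift ψ φ) (ψ.symm '' K) (ψ.symm '' K) := by
  rintro _ ⟨y, hy, rfl⟩
  rw [chartLift_of_mem (ψ.map_target (hK hy)), ψ.right_inv (hK hy)]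
  exact ⟨_, h.1 hy, rfl⟩

/-- Finitely many times are involved. At each one that moves `p`, disjoint neighbourhoods of `p` and
its image separate a small ball from its iterate. -/
theorem exists_closedBall_iterate_ne [T2Space M] {g : M → M} (hg : Continuous g) {p : M}
    (hp : p ∈ ψ.source) (hp0 : ψ p = 0) (m : ℕ) : ∃ R > 0, Metric.closedBall 0 R ⊆ ψ.target ∧
      ∀ i < m, g^[i] p ≠ p → ∀ y ∈ Metric.closedBall (0 : Euc d) R,
        ∀ z ∈ Metric.closedBall (0 : Euc d) R, g^[i] (ψ.symm y) ≠ ψ.symm z := by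
  have hsymm : ψ.symm 0 = p := by rw [← hp0, ψ.left_inv hp]
  have h0 : (0 : Euc d) ∈ ψ.target := hp0 ▸ ψ.map_source hp
  have hc : ContinuousAt ψ.symm 0 := ψ.continuousAt_symm h0
  have hev : ∀ i ∈ Finset.range m, ∃ u w : Set M, Disjoint u w ∧
      (g^[i] p ≠ p → ∀ᶠ y in 𝓝 (0 : Euc d), g^[i] (ψ.symm y) ∈ u ∧ ψ.symm y ∈ w) := by
    intro i _
    by_cases h : g^[i] p = p
    · exact ⟨∅, ∅, by simp, fun h' => absurd h h'⟩
    obtain ⟨u, w, hu, hw, hpu, hpw, huw⟩ := t2_separation h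
    refine ⟨u, w, huw, fun _ => ?_⟩
    have hci : ContinuousAt (fun y => g^[i] (ψ.symm y)) 0 :=
      (hg.iterate i).continuousAt.comp hc
    exact (hci.eventually_mem (hu.mem_nhds (by rwa [hsymm]))).and
      (hc.eventually_mem (hw.mem_nhds (by rwa [hsymm])))
  choose! u w huw hev using hev
  have hall : ∀ᶠ y in 𝓝 (0 : Euc d), ∀ i ∈ Finset.range m, g^[i] p ≠ p →
      g^[i] (ψ.symm y) ∈ u i ∧ ψ.symm y ∈ w i := by
    refine (Filter.eventually_all_finset _).2 fun i hi => ?_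
    by_cases h : g^[i] p = p
    · exact Eventually.of_forall fun _ h' => absurd h h'
    · filter_upwards [hev i hi h] with y hy _ using hy
  obtain ⟨R, hR, hRsub⟩ := Metric.nhds_basis_closedBall.mem_iff.1
    (inter_mem (ψ.open_target.mem_nhds h0) hall)
  refine ⟨R, hR, fun y hy => (hRsub hy).1, fun i hi hne y hy z hz heq => ?_⟩
  have h1 := ((hRsub hy).2 i (Finset.mem_range.2 hi) hne).1
  have h2 := ((hRsub hz).2 i (Finset.mem_range.2 hi) hne).2
  rw [heq] at h1
  exact (huw i (Finset.mem_range.2 hi)).le_bot ⟨h1, h2⟩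

end Iterates

/-! ### The return derivative at a periodic point -/

section ReturnMap

variable {d : ℕ} {M : Type*} [TopologicalSpace M] [T2Space M]
  [ChartedSpace (EuclideanSpace ℝ (Fin d)) M] [MeasurableSpace M] [BorelSpace M] {μ : Measure M}
  {ψ : OpenPartialHomeomorph M (Euc d)} [IsManifold (𝓡 d) ∞ M]

/-- Some `g ∈ U` has `p` as a point of least period `n`, and its return map has the derivative `A`
at `p`, read in the chart `ψ`. -/
def HasReturnDeriv (U : Set (VolDiff d μ)) (ψ : OpenPartialHomeomorph M (Euc d)) (p : M) (n : ℕ)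
    (A : Module.End ℝ (Euc d)) : Prop :=
  ∃ g ∈ U, g.toPerm^[n] p = p ∧ (∀ i, 0 < i → i < n → g.toPerm^[i] p ≠ p) ∧
    HasFDerivAt (fun y => ψ (g.toPerm^[n] (ψ.symm y))) (LinearMap.toContinuousLinearMap A) 0

/-- The perturbation lives in a ball that the orbit of `p` meets once per period, so the return map
is composed with the germ of a transvection and the period is unchanged. -/
theorem stableUnderTransvections_hasReturnDeriv (hψ : IsVolumeChart μ ψ) {U : Set (VolDiff d μ)}
    (hU : IsOpen U) {p : M} (hp : p ∈ ψ.source) (hp0 : ψ p = 0) {n : ℕ} (hn : 0 < n) :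
    StableUnderTransvections (HasReturnDeriv U ψ p n) := by
  rintro A ⟨g, hg, hgp, hgn, hgA⟩ f v hfv
  have hsymm : ψ.symm 0 = p := by rw [← hp0, ψ.left_inv hp]
  obtain ⟨R, hR, hRt, hdisj⟩ := exists_closedBall_iterate_ne g.continuous hp hp0 n
  have hK : IsCompact (Metric.closedBall (0 : Euc d) R) := isCompact_closedBall 0 R
  obtain ⟨ε, hε, hpert⟩ := exists_perturbation_mem hψ hK hRt hU hg
  obtain ⟨c₀, hc₀, hc⟩ := exists_volPert_eventuallyEq_transvection hR
    (lt_min hε (by norm_num : (0 : ℝ) < 1 / 2)) (LinearMap.toContinuousLinearMap f) hfv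
  refine ⟨c₀, hc₀, fun c hcc => ?_⟩
  obtain ⟨φ, hφ, hφ0⟩ := hc c hcc
  have hs : SupportedIn (Metric.closedBall 0 R) φ :=
    hφ.supportedIn ((min_le_right _ _).trans_lt (by norm_num))
  obtain ⟨g', hg', hgg'⟩ := hpert φ (hφ.mono (min_le_left _ _))
  have hit := fun x hx => iterate_eq_iterate_comp (x := x) (n := n) hgg'
    (hs.mapsTo_chartLift hRt) (fun x hx => chartLift_eq_self hs hx) (by
      rintro i hi hin _ ⟨y, hy, rfl⟩ ⟨z, hz, hzy⟩
      exact hdisj i hin (hgn i hi hin) y hy z hz hzy.symm) hx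
  have hφ00 : φ 0 = 0 := by simpa using hφ0.eq_of_nhds
  have hpN : p ∈ ψ.symm '' Metric.closedBall 0 R := ⟨0, by simp [hR.le], hsymm⟩
  have hLp : chartLift ψ φ p = p := by rw [chartLift_of_mem hp, hp0, hφ00, hsymm]
  refine ⟨g', hg', ?_, fun i hi hin => ?_, ?_⟩
  · rw [hit p hpN n hn le_rfl, hLp, hgp]
  · rw [hit p hpN i hi hin.le, hLp]
    exact hgn i hi hin
  · have hL : HasFDerivAt (fun x : Euc d => x + (c * f x) • v)
        (LinearMap.toContinuousLinearMap (LinearMap.transvection (c • f) v)) 0 := by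
      have : (fun x : Euc d => x + (c * f x) • v) =
          LinearMap.toContinuousLinearMap (LinearMap.transvection (c • f) v) := by
        ext x
        simp [LinearMap.transvection.apply]
      rw [this]
      exact ContinuousLinearMap.hasFDerivAt _
    have hcomp := HasFDerivAt.comp (g := fun y => ψ (g.toPerm^[n] (ψ.symm y))) (0 : Euc d)
      (by simpa using hgA) hL
    refine HasFDerivAt.congr_of_eventuallyEq (hcomp.congr_fderiv ?_) ?_
    · ext x
      simp
    · filter_upwards [hφ0, Metric.closedBall_mem_nhds (0 : Euc d) hR] with y hy hyR
      rw [Function.comp_apply, hit _ ⟨y, hyR, rfl⟩ n hn le_rfl,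
        chartLift_of_mem (ψ.map_target (hRt hyR)), ψ.right_inv (hRt hyR), hy]
      rfl

omit [T2Space M] [BorelSpace M] [IsManifold (𝓡 d) ∞ M] in
-- Passing from the preferred coordinates at `p` to the chart `ψ` conjugates the derivative, which
-- preserves the characteristic polynomial.
theorem exists_hasReturnDeriv_of_trivial (hψ : IsVolumeChart μ ψ) {U : Set (VolDiff d μ)}
    {g : VolDiff d μ} (hg : g ∈ U) {p : M} (hp : p ∈ ψ.source) (hp0 : ψ p = 0)
    (h : g.IsPeriodicWithTrivialRealSpectrum p) : ∃ n > 0, ∃ A, HasReturnDeriv U ψ p n A ∧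
      ∃ i j : ℕ, A.charpoly = (Polynomial.X - 1) ^ i * (Polynomial.X + 1) ^ j := by
  obtain ⟨hper, k, -, hk⟩ := h
  have hsymm : ψ.symm 0 = p := by rw [← hp0, ψ.left_inv hp]
  have h0 : (0 : Euc d) ∈ ψ.target := hp0 ▸ ψ.map_source hp
  set n := Function.minimalPeriod g.toPerm p with hn
  have hnpos : 0 < n := Function.minimalPeriod_pos_of_mem_periodicPts hper
  have hgp : g.toPerm^[n] p = p := Function.isPeriodicPt_minimalPeriod g.toPerm p
  have hψp : HasMFDerivAt (𝓡 d) (𝓡 d) ψ p (mfderiv (𝓡 d) (𝓡 d) ψ p) :=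
    (hψ.mdifferentiableAt hp).hasMFDerivAt
  have hψs : HasMFDerivAt (𝓡 d) (𝓡 d) ψ.symm 0 (mfderiv (𝓡 d) (𝓡 d) ψ.symm 0) :=
    (hψ.mdifferentiableAt_symm h0).hasMFDerivAt
  have hgn : HasMFDerivAt (𝓡 d) (𝓡 d) (g.toPerm^[n]) p (mfderiv (𝓡 d) (𝓡 d) (g.toPerm^[n]) p) :=
    ((g.contMDiff.iterate n).mdifferentiable (by simp) p).hasMFDerivAt
  set P : Euc d →L[ℝ] Euc d := mfderiv (𝓡 d) (𝓡 d) ψ p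
  set S : Euc d →L[ℝ] Euc d := mfderiv (𝓡 d) (𝓡 d) ψ.symm 0
  set D : Euc d →L[ℝ] Euc d := g.returnDeriv p with hD
  have hψp' : HasMFDerivAt (𝓡 d) (𝓡 d) ψ (ψ.symm 0) P := by rwa [hsymm]
  have hPS : P.comp S = ContinuousLinearMap.id ℝ (Euc d) := by
    refine HasFDerivAt.unique (f := id) (x := (0 : Euc d)) ?_ (hasFDerivAt_id 0)
    refine (hψp'.comp 0 hψs).hasFDerivAt.congr_of_eventuallyEq ?_
    filter_upwards [ψ.open_target.mem_nhds h0] with y hy using (ψ.right_inv hy).symm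
  have hPS' : (P : Euc d →ₗ[ℝ] Euc d) ∘ₗ S = LinearMap.id := by
    ext1 x; exact congrArg (· x) hPS
  have hSP' : (S : Euc d →ₗ[ℝ] Euc d) ∘ₗ P = LinearMap.id := (LinearMap.comp_eq_id_comm _ _).1 hPS'
  let e : Euc d ≃ₗ[ℝ] Euc d := LinearEquiv.ofLinearMap (P : Euc d →ₗ[ℝ] Euc d) S hPS' hSP'
  refine ⟨n, hnpos, e.conj (D : Euc d →ₗ[ℝ] Euc d), ⟨g, hg, hgp, fun i hi hin => ?_, ?_⟩, k,
    d - k, ?_⟩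
  · exact Function.not_isPeriodicPt_of_pos_of_lt_minimalPeriod hi.ne' hin
  · have hgn' : HasMFDerivAt (𝓡 d) (𝓡 d) (g.toPerm^[n]) (ψ.symm 0) D := by rwa [hsymm]
    have hψg : HasMFDerivAt (𝓡 d) (𝓡 d) ψ (g.toPerm^[n] (ψ.symm 0)) P := by rwa [hsymm, hgp]
    exact (hψg.comp 0 (hgn'.comp 0 hψs)).hasFDerivAt
  · rw [LinearEquiv.charpoly_conj, hk]

end ReturnMap

end WeakShadowing

namespace WeakShadowing

/-! ### Blowing up near a fixed point -/

section Rescaling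

variable {E : Type*} [NormedAddCommGroup E] [NormedSpace ℝ E]

/-- A vector moved far away by all the powers that are not the identity. -/
theorem exists_le_norm_pow_apply_sub (B : Module.End ℝ E) {N : ℕ}
    (hN : ∀ j, 0 < j → j < N → B ^ j ≠ 1) (C : ℕ → ℝ) :
    ∃ q : E, ∀ j, 0 < j → j < N → C j ≤ ‖(B ^ j) q - q‖ := by
  -- A real vector space is not a finite union of proper subspaces, here the kernels of the `B ^ j -
  -- 1`. A large multiple of `q` then gives the required distances.
  obtain ⟨q, hq⟩ : ∃ q : E, ∀ j, 0 < j → j < N → (B ^ j) q - q ≠ 0 := by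
    by_contra! hcon
    have hun : (⋃ i : Finset.Ioo 0 N, (LinearMap.ker (B ^ (i : ℕ) - 1) : Set E)) = univ := by
      refine eq_univ_of_forall fun q => ?_
      obtain ⟨j, h0, hj, h⟩ := hcon q
      exact mem_iUnion.2 ⟨⟨j, Finset.mem_Ioo.2 ⟨h0, hj⟩⟩, by simpa using h⟩
    obtain ⟨⟨j, hj⟩, htop⟩ := Subspace.exists_eq_top_of_iUnion_eq_univ hun
    obtain ⟨h0, hjN⟩ := Finset.mem_Ioo.1 hj
    exact hN j h0 hjN (sub_eq_zero.1 (LinearMap.ker_eq_top.1 htop))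
  have hev : ∀ᶠ t : ℝ in atTop, ∀ j ∈ Finset.Ioo 0 N, C j ≤ t * ‖(B ^ j) q - q‖ := by
    refine (Filter.eventually_all_finset _).2 fun j hj => ?_
    obtain ⟨h0, hjN⟩ := Finset.mem_Ioo.1 hj
    exact (tendsto_id.atTop_mul_const (norm_pos_iff.2 (hq j h0 hjN))).eventually_ge_atTop _
  obtain ⟨t, ht, ht0⟩ := (hev.and (eventually_ge_atTop 0)).exists
  refine ⟨t • q, fun j h0 hj => (ht j (Finset.mem_Ioo.2 ⟨h0, hj⟩)).trans ?_⟩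
  rw [map_smul, ← smul_sub, norm_smul, Real.norm_of_nonneg ht0]

/-- Blown up around a point near a fixed point with derivative the identity, a `C¹` map is close
to the identity. -/
theorem exists_rescaled_near [FiniteDimensional ℝ E] {T : E → E} (hT : ContDiffAt ℝ 1 T 0)
    (hT0 : T 0 = 0) (hTd : HasFDerivAt T (ContinuousLinearMap.id ℝ E) 0) (q : E) {ρ η : ℝ}
    (hρ : 0 < ρ) (hη : 0 < η) : ∃ r₀ > 0, ∀ r : ℝ, 0 < r → r < r₀ →
      ∃ G : E → E, NearId η G ∧ (∀ x, ‖G x - x‖ ≤ η) ∧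
        ∀ x ∈ Metric.closedBall 0 ρ, T (r • (q + x)) = r • (q + G x) := by
  have : ProperSpace E := FiniteDimensional.proper ℝ E
  have : HasContDiffBump E := by infer_instance
  let χ : ContDiffBump (0 : E) := ⟨ρ, ρ + 1, hρ, by linarith⟩
  obtain ⟨b, hb⟩ := (χ.hasCompactSupport.fderiv ℝ).exists_bound_of_continuous
    (χ.contDiff.continuous_fderiv (n := 1) (by simp))
  have hb0 : 0 ≤ b := (norm_nonneg _).trans (hb 0)
  set s := ‖q‖ + ρ + 2 with hs
  have hs0 : 0 < s := by positivity
  set η' := η / (1 + (1 + b) * s) with hη'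
  have hη'0 : 0 < η' := by positivity
  have hη's : η' * (1 + (1 + b) * s) = η := div_mul_cancel₀ _ (by positivity)
  have hcont : ContinuousAt (fderiv ℝ T) 0 := (hT.fderiv_right (m := 0) (by simp)).continuousAt
  have hball : ∀ᶠ y in 𝓝 (0 : E), ContDiffAt ℝ 1 T y ∧
      ‖fderiv ℝ T y - ContinuousLinearMap.id ℝ E‖ ≤ η' := by
    refine (hT.eventually (by simp)).and ?_
    filter_upwards [hcont.eventually_mem (Metric.closedBall_mem_nhds _ hη'0)] with y hy
    rwa [mem_closedBall_iff_norm, hTd.fderiv] at hy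
  obtain ⟨δ, hδ, hδb⟩ := Metric.nhds_basis_ball.mem_iff.1 hball
  have hTy : ∀ y ∈ Metric.ball (0 : E) δ, ‖T y - y‖ ≤ η' * ‖y‖ := by
    intro y hy
    have := (convex_ball (0 : E) δ).norm_image_sub_le_of_norm_hasFDerivWithin_le
      (f := fun y => T y - y) (C := η')
      (fun z hz => (((hδb hz).1.differentiableAt (by simp)).hasFDerivAt.sub
        (hasFDerivAt_id z)).hasFDerivWithinAt) (fun z hz => (hδb hz).2)
      (Metric.mem_ball_self hδ) hy
    simpa [hT0] using this
  refine ⟨δ / s, by positivity, fun r hr hrδ => ?_⟩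
  have hrs : r * s < δ := (lt_div_iff₀ hs0).1 hrδ
  have hqx : ∀ x : E, ‖x‖ < ρ + 2 → ‖q + x‖ ≤ s := fun x hx =>
    (norm_add_le _ _).trans (by linarith)
  have hmem : ∀ x : E, ‖x‖ < ρ + 2 → r • (q + x) ∈ Metric.ball (0 : E) δ := fun x hx => by
    rw [mem_ball_zero_iff, norm_smul, Real.norm_of_nonneg hr.le]
    exact (mul_le_mul_of_nonneg_left (hqx x hx) hr.le).trans_lt hrs
  -- The rescaled displacement: its derivative is that of `T - id` near `0`, hence small for small
  -- `r`, and it is cut off outside the ball of radius `ρ` to define `G` globally.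
  set u : E → E := fun x => r⁻¹ • (T (r • (q + x)) - r • (q + x)) with hu
  have huC : ∀ x : E, ‖x‖ < ρ + 2 → ContDiffAt ℝ 1 u x := fun x hx => by
    have ha : ContDiffAt ℝ 1 (fun x : E => r • (q + x)) x :=
      (contDiff_const.add contDiff_id).contDiffAt.const_smul r
    exact contDiffAt_const.smul (((hδb (hmem x hx)).1.comp x ha).sub ha)
  have hun : ∀ x : E, ‖x‖ < ρ + 2 → ‖u x‖ ≤ η' * s := fun x hx => by
    rw [hu, norm_smul, norm_inv, Real.norm_of_nonneg hr.le, inv_mul_le_iff₀ hr]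
    refine (hTy _ (hmem x hx)).trans ?_
    rw [norm_smul, Real.norm_of_nonneg hr.le]
    have := mul_le_mul_of_nonneg_left (hqx x hx) (mul_nonneg hr.le hη'0.le)
    linarith
  have hud : ∀ x : E, ‖x‖ < ρ + 2 → HasFDerivAt u
      (fderiv ℝ T (r • (q + x)) - ContinuousLinearMap.id ℝ E) x := fun x hx => by
    have ha : HasFDerivAt (fun x : E => r • (q + x)) (r • ContinuousLinearMap.id ℝ E) x :=
      ((hasFDerivAt_id x).const_add q).const_smul r
    have h1 := (((hδb (hmem x hx)).1.differentiableAt (by simp)).hasFDerivAt.comp x ha)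
    refine ((h1.sub ha).const_smul r⁻¹).congr_fderiv ?_
    ext z
    simp [smul_sub, hr.ne']
  have hχ : ∀ x : E, |χ x| ≤ 1 := fun x => by
    rw [abs_of_nonneg χ.nonneg]; exact χ.le_one
  have hfar : ∀ x : E, ρ + 1 < ‖x‖ → (fun x => x + χ x • u x) =ᶠ[𝓝 x] id := fun x hx => by
    filter_upwards [(isOpen_lt continuous_const continuous_norm).mem_nhds hx] with y hy
    rw [χ.zero_of_le_dist (by rw [dist_zero_right]; exact le_of_lt hy), zero_smul, add_zero]
    rfl
  have hcases : ∀ x : E, ‖x‖ < ρ + 2 ∨ ρ + 1 < ‖x‖ := fun x => by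
    rcases lt_or_ge ‖x‖ (ρ + 2) with h | h
    · exact Or.inl h
    · exact Or.inr (by linarith)
  refine ⟨fun x => x + χ x • u x, ⟨?_, fun x => ?_⟩, fun x => ?_, fun x hx => ?_⟩
  · refine contDiff_iff_contDiffAt.2 fun x => ?_
    rcases hcases x with h | h
    · exact contDiffAt_id.add (χ.contDiff.contDiffAt.smul (huC x h))
    · exact contDiffAt_id.congr_of_eventuallyEq (hfar x h)
  · rcases hcases x with h | h
    · have hχd : HasFDerivAt χ (fderiv ℝ χ x) x :=
        ((χ.contDiff (n := 1)).differentiable (by simp) x).hasFDerivAt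
      have hG : HasFDerivAt (fun x => x + χ x • u x) (ContinuousLinearMap.id ℝ E + _) x :=
        (hasFDerivAt_id x).add (hχd.smul (hud x h))
      rw [hG.fderiv, add_sub_cancel_left]
      refine (norm_add_le _ _).trans ?_
      rw [norm_smul, ContinuousLinearMap.norm_smulRight_apply, Real.norm_eq_abs]
      have h1 := mul_le_mul (hχ x) (hδb (hmem x h)).2 (norm_nonneg _) zero_le_one
      have h2 := mul_le_mul (hb x) (hun x h) (norm_nonneg _) hb0
      nlinarith [mul_pos hη'0 hs0]
    · rw [(hfar x h).fderiv_eq, fderiv_id, sub_self, norm_zero]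
      exact hη.le
  · rw [add_sub_cancel_left]
    rcases hcases x with h | h
    · rw [norm_smul, Real.norm_eq_abs]
      have h1 := mul_le_mul (hχ x) (hun x h) (norm_nonneg _) zero_le_one
      nlinarith [mul_pos hη'0 hs0, mul_nonneg hb0 (mul_pos hη'0 hs0).le]
    · rw [χ.zero_of_le_dist (by rw [dist_zero_right]; exact h.le), zero_smul, norm_zero]
      exact hη.le
  · simp only [χ.one_of_mem_closedBall hx, one_smul, hu]
    rw [← add_assoc, smul_add r (q + x), smul_inv_smul₀ hr.ne']
    abel

/-- Conjugation by a homothety and a translation leaves the derivatives unchanged, so the `C¹` size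
of a perturbation does not depend on the scale `r`. -/
theorem VolPert.rescale {ε ρ : ℝ} {φ : E → E} (hφ : VolPert ε (Metric.closedBall 0 ρ) φ) (q : E)
    {r : ℝ} (hr : 0 < r) : VolPert ε ((fun x => r • (q + x)) '' Metric.closedBall 0 ρ)
      (fun y => r • (q + φ (r⁻¹ • y - q))) := by
  have hd : ∀ y, HasFDerivAt (fun y => r • (q + φ (r⁻¹ • y - q))) (fderiv ℝ φ (r⁻¹ • y - q)) y := by
    intro y
    have ha : HasFDerivAt (fun y : E => r⁻¹ • y - q) (r⁻¹ • ContinuousLinearMap.id ℝ E) y :=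
      ((hasFDerivAt_id y).const_smul r⁻¹).sub_const q
    refine ((((hφ.hasFDerivAt _).comp y ha).const_add q).const_smul r).congr_fderiv ?_
    ext z
    simp [hr.ne']
  refine ⟨⟨?_, fun y => ?_⟩, fun y hy => ?_, fun y => ?_⟩
  · exact contDiff_const.smul (contDiff_const.add (hφ.contDiff.comp
      ((contDiff_const.smul contDiff_id).sub contDiff_const)))
  · rw [(hd y).fderiv]
    exact hφ.norm_fderiv_sub_le _
  · rw [hφ.eq_self, add_sub_cancel, smul_inv_smul₀ hr.ne']
    exact fun h => hy ⟨_, h, by simp [hr.ne']⟩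
  · rw [(hd y).fderiv, hφ.det_eq_one]

end Rescaling

end WeakShadowing

namespace WeakShadowing

section Euclidean

variable {d : ℕ}

open scoped Pointwise in
theorem volume_image_smul_add (q : Euc d) (r : ℝ) (B : Set (Euc d)) :
    volume ((fun x => r • (q + x)) '' B) = ENNReal.ofReal |r ^ d| * volume B := by
  have h : (fun x : Euc d => r • (q + x)) '' B = r • ((fun x => q + x) '' B) := by
    rw [← image_smul, image_image]
  rw [h, Measure.addHaar_smul, image_add_left, measure_preimage_add, finrank_euclideanSpace_fin]

theorem isOpenMap_smul_add (q : Euc d) {r : ℝ} (hr : r ≠ 0) :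
    IsOpenMap fun x : Euc d => r • (q + x) :=
  (isOpenMap_smul₀ hr).comp (isOpenMap_add_left q)

end Euclidean

/-! ### Powers of the return map, and islands that return late -/

section ReturnMap

variable {d : ℕ} {M : Type*} [TopologicalSpace M] {ψ : OpenPartialHomeomorph M (Euc d)}

theorem hasFDerivAt_return_pow {g : M → M} (hg : Continuous g) {p : M} (hp : p ∈ ψ.source)
    (hp0 : ψ p = 0) {n : ℕ} (hgp : g^[n] p = p) {A : Module.End ℝ (Euc d)}
    (hA : HasFDerivAt (fun y => ψ (g^[n] (ψ.symm y))) (LinearMap.toContinuousLinearMap A) 0) (j : ℕ) :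
    HasFDerivAt (fun y => ψ (g^[n * j] (ψ.symm y))) (LinearMap.toContinuousLinearMap (A ^ j)) 0 := by
  have hsymm : ψ.symm 0 = p := by rw [← hp0, ψ.left_inv hp]
  have h0 : (0 : Euc d) ∈ ψ.target := hp0 ▸ ψ.map_source hp
  have hper : ∀ j, g^[n * j] p = p := fun j =>
    (Function.IsPeriodicPt.mul_const (show Function.IsPeriodicPt g n p from hgp) j)
  induction j with
  | zero =>
    refine (hasFDerivAt_id (0 : Euc d)).congr_of_eventuallyEq ?_ |>.congr_fderiv ?_
    · filter_upwards [ψ.open_target.mem_nhds h0] with y hy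
      exact ψ.right_inv hy
    · ext x; simp
  | succ j ih =>
    have hcomp := HasFDerivAt.comp (g := fun y => ψ (g^[n] (ψ.symm y)))
      (f := fun y => ψ (g^[n * j] (ψ.symm y))) (0 : Euc d)
      (by simpa only [hsymm, hper, hp0] using hA) ih
    refine (hcomp.congr_of_eventuallyEq ?_).congr_fderiv ?_
    · have hc : ContinuousAt (fun y => g^[n * j] (ψ.symm y)) 0 :=
        (hg.iterate _).continuousAt.comp (ψ.continuousAt_symm h0)
      filter_upwards [hc.eventually_mem (ψ.open_source.mem_nhds (by rwa [hsymm, hper]))] with y hy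
      simp only [Function.comp_apply]
      rw [ψ.left_inv hy, ← Function.iterate_add_apply]
      congr 2
      ring
    · ext x
      simp [pow_succ']

variable [ChartedSpace (EuclideanSpace ℝ (Fin d)) M] [MeasurableSpace M] [BorelSpace M]
  {μ : Measure M} [T2Space M]

theorem volume_image_return [CompactSpace M] (hψ : IsVolumeChart μ ψ) (g : VolDiff d μ) (m : ℕ)
    {D : Set (Euc d)}
    (hD : MeasurableSet D) (hDt : D ⊆ ψ.target)
    (hDs : ∀ y ∈ D, g.toPerm^[m] (ψ.symm y) ∈ ψ.source) :
    volume ((fun y => ψ (g.toPerm^[m] (ψ.symm y))) '' D) = volume D := by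
  have hB : MeasurableSet (ψ.symm '' D) := measurableSet_image_openPartialHomeomorph ψ.symm hD hDt
  have hinj : Function.Injective g.toPerm^[m] := g.toPerm.injective.iterate m
  have hemb : MeasurableEmbedding g.toPerm^[m] :=
    ((g.continuous.iterate m).isClosedEmbedding hinj).measurableEmbedding
  have h1 := hψ.measure_eq _ hB (symm_image_subset_source hDt)
  have h2 := hψ.measure_eq (g.toPerm^[m] '' (ψ.symm '' D)) (hemb.measurableSet_image.2 hB) (by
    rintro _ ⟨_, ⟨y, hy, rfl⟩, rfl⟩
    exact hDs y hy)
  rw [← (g.measurePreserving.iterate m).measure_preimage_emb hemb, preimage_image_eq _ hinj, h1,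
    image_image, image_image, image_image] at h2
  rw [← h2]
  congr 1
  refine (image_congr fun y hy => ?_).trans (image_id D)
  exact ψ.right_inv (hDt hy)

omit [BorelSpace M] [T2Space M] in
theorem contDiffAt_return (hψ : IsVolumeChart μ ψ) (g : VolDiff d μ) {p : M} (hp : p ∈ ψ.source)
    (hp0 : ψ p = 0) {m : ℕ} (hgp : g.toPerm^[m] p = p) :
    ContDiffAt ℝ 1 (fun y => ψ (g.toPerm^[m] (ψ.symm y))) 0 := by
  have hsymm : ψ.symm 0 = p := by rw [← hp0, ψ.left_inv hp]
  have h0 : (0 : Euc d) ∈ ψ.target := hp0 ▸ ψ.map_source hp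
  rw [← contMDiffAt_iff_contDiffAt]
  refine ContMDiffAt.comp (I' := 𝓡 d) (0 : Euc d) (g := ψ) ?_ (ContMDiffAt.comp (I' := 𝓡 d) (0 : Euc d)
    (g.contMDiff.iterate m).contMDiffAt
    (hψ.contMDiffOn_symm.contMDiffAt (ψ.open_target.mem_nhds h0)))
  exact hψ.contMDiffOn.contMDiffAt (ψ.open_source.mem_nhds (by
    rwa [hsymm, hgp]))

omit [ChartedSpace (EuclideanSpace ℝ (Fin d)) M] [MeasurableSpace M] [BorelSpace M] in
/-- Around a periodic point with derivative of finite order there are round islands which return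
for the first time after `n * N` iterates. -/
theorem exists_island {g : M → M} (hg : Continuous g) {p : M} (hp : p ∈ ψ.source)
    (hp0 : ψ p = 0) {n N : ℕ} (hn : 0 < n) (hgp : g^[n] p = p)
    (hgn : ∀ i, 0 < i → i < n → g^[i] p ≠ p) {A : Module.End ℝ (Euc d)}
    (hA : HasFDerivAt (fun y => ψ (g^[n] (ψ.symm y))) (LinearMap.toContinuousLinearMap A) 0)
    (hN : ∀ j, 0 < j → j < N → A ^ j ≠ 1) {ρ : ℝ} (hρ : 0 ≤ ρ) :
    ∃ (q : Euc d) (r₀ : ℝ), 0 < r₀ ∧ ∀ r, 0 < r → r < r₀ →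
      ∀ x ∈ Metric.closedBall (0 : Euc d) ρ, ∀ x' ∈ Metric.closedBall (0 : Euc d) ρ,
        ∀ i, 0 < i → i < n * N → g^[i] (ψ.symm (r • (q + x))) ≠ ψ.symm (r • (q + x')) := by
  obtain ⟨R, hR, hRt, hdisj⟩ := exists_closedBall_iterate_ne hg hp hp0 (n * N)
  -- In a collision, `(A ^ j) q - q` would have norm at most `ρ + ‖A ^ j‖ * ρ + 1 / 2`, where `1 /
  -- 2` is the linearization error divided by `r`.
  obtain ⟨q, hq⟩ := exists_le_norm_pow_apply_sub A hN
    fun j => (‖LinearMap.toContinuousLinearMap (A ^ j)‖ + 1) * ρ + 1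
  set s := ‖q‖ + ρ + 1 with hs
  have hs0 : 0 < s := by positivity
  have hev : ∀ᶠ y in 𝓝 (0 : Euc d), ∀ j ∈ Finset.range N,
      ‖ψ (g^[n * j] (ψ.symm y)) - (A ^ j) y‖ ≤ 1 / (2 * s) * ‖y‖ := by
    refine (Filter.eventually_all_finset _).2 fun j _ => ?_
    have hsymm : ψ.symm 0 = p := by rw [← hp0, ψ.left_inv hp]
    have hper : g^[n * j] p = p :=
      (Function.IsPeriodicPt.mul_const (show Function.IsPeriodicPt g n p from hgp) j)
    have h1 := (hasFDerivAt_return_pow hg hp hp0 hgp hA j).isLittleO.def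
      (show 0 < 1 / (2 * s) by positivity)
    filter_upwards [h1] with y hy
    simpa [hsymm, hper, hp0] using hy
  obtain ⟨δ, hδ, hδb⟩ := Metric.nhds_basis_ball.mem_iff.1 hev
  refine ⟨q, min (R / s) (δ / s), by positivity, fun r hr hr₀ x hx x' hx' i hi him heq => ?_⟩
  have hrR : r * s < R := (lt_div_iff₀ hs0).1 (hr₀.trans_le (min_le_left _ _))
  have hrδ : r * s < δ := (lt_div_iff₀ hs0).1 (hr₀.trans_le (min_le_right _ _))
  have hnorm : ∀ z ∈ Metric.closedBall (0 : Euc d) ρ, ‖r • (q + z)‖ ≤ r * s := by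
    intro z hz
    rw [mem_closedBall_zero_iff] at hz
    rw [norm_smul, Real.norm_of_nonneg hr.le]
    exact mul_le_mul_of_nonneg_left ((norm_add_le _ _).trans (by linarith)) hr.le
  have hmem : ∀ z ∈ Metric.closedBall (0 : Euc d) ρ, r • (q + z) ∈ Metric.closedBall (0 : Euc d) R :=
    fun z hz => by
      rw [mem_closedBall_zero_iff]
      exact (hnorm z hz).trans hrR.le
  -- Times at which `p` does not return are excluded by the separation of balls; the others are
  -- multiples of `n`, where the linearization decides.
  by_cases hip : g^[i] p = p
  swap
  · exact hdisj i him hip _ (hmem x hx) _ (hmem x' hx') heq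
  have hmod : i % n = 0 := by
    by_contra h
    refine hgn _ (Nat.pos_of_ne_zero h) (Nat.mod_lt _ hn) ?_
    rw [Function.IsPeriodicPt.iterate_mod_apply hgp, hip]
  obtain ⟨j, rfl⟩ := Nat.dvd_of_mod_eq_zero hmod
  have hj0 : 0 < j := Nat.pos_of_mul_pos_left hi
  have hjN : j < N := lt_of_mul_lt_mul_left him (Nat.zero_le n)
  have h1 := hδb (a := r • (q + x)) (by
    rw [mem_ball_zero_iff]; exact (hnorm x hx).trans_lt hrδ) j (Finset.mem_range.2 hjN)
  rw [heq, ψ.right_inv (hRt (hmem x' hx')), map_smul, ← smul_sub, norm_smul,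
    Real.norm_of_nonneg hr.le] at h1
  have h2 : r * ‖q + x' - (A ^ j) (q + x)‖ ≤ r * (1 / 2) := by
    refine h1.trans ((mul_le_mul_of_nonneg_left (hnorm x hx) (by positivity)).trans_eq ?_)
    field_simp
  have h3 := le_of_mul_le_mul_left h2 hr
  have h4 := hq j hj0 hjN
  have h5 : ‖(A ^ j) x‖ ≤ ‖LinearMap.toContinuousLinearMap (A ^ j)‖ * ρ :=
    ((LinearMap.toContinuousLinearMap (A ^ j)).le_opNorm x).trans
      (mul_le_mul_of_nonneg_left (by simpa using hx) (norm_nonneg _))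
  have h6 : (A ^ j) q - q = x' - (A ^ j) x - (q + x' - (A ^ j) (q + x)) := by
    rw [map_add]; abel
  rw [h6] at h4
  have h7 := (norm_sub_le (x' - (A ^ j) x) (q + x' - (A ^ j) (q + x))).trans
    (add_le_add_left (norm_sub_le x' ((A ^ j) x)) _)
  rw [mem_closedBall_zero_iff] at hx'
  linarith

end ReturnMap

end WeakShadowing

namespace WeakShadowing

/-! ### A periodic cube -/

section Island

variable {d : ℕ} {M : Type*} [TopologicalSpace M] [T2Space M] [CompactSpace M]
  [ChartedSpace (EuclideanSpace ℝ (Fin d)) M] [MeasurableSpace M] [BorelSpace M] {μ : Measure M}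
  {ψ : OpenPartialHomeomorph M (Euc d)} [IsManifold (𝓡 d) ∞ M]

/-- A periodic point with derivative of finite order can be perturbed to a periodic open set,
whose orbit misses another open set. -/
theorem exists_periodic_isOpen (hd : 2 ≤ d) (hψ : IsVolumeChart μ ψ) {U : Set (VolDiff d μ)}
    (hU : IsOpen U) {p : M} (hp : p ∈ ψ.source) (hp0 : ψ p = 0) {n : ℕ} (hn : 0 < n)
    {A : Module.End ℝ (Euc d)} (hA : HasReturnDeriv U ψ p n A) (hfin : IsOfFinOrder A) :
    ∃ h ∈ U, ∃ V Z : Set M, IsOpen V ∧ IsOpen Z ∧ V.Nonempty ∧ Z.Nonempty ∧ ∃ m > 0,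
      h.toPerm^[m] '' V = V ∧ ∀ k < m, ∀ v ∈ V, h.toPerm^[k] v ∉ Z := by
  obtain ⟨g, hg, hgp, hgn, hgA⟩ := hA
  set N := orderOf A with hN
  have hN0 : 0 < N := hfin.orderOf_pos
  have hm0 : 0 < n * N := Nat.mul_pos hn hN0
  have hsymm : ψ.symm 0 = p := by rw [← hp0, ψ.left_inv hp]
  have h0 : (0 : Euc d) ∈ ψ.target := hp0 ▸ ψ.map_source hp
  have hper : g.toPerm^[n * N] p = p :=
    Function.IsPeriodicPt.mul_const (show Function.IsPeriodicPt g.toPerm n p from hgp) N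
  set ρ : ℝ := 2 * d + 5 with hρ
  have hρ0 : 0 < ρ := by positivity
  set T : Euc d → Euc d := fun y => ψ (g.toPerm^[n * N] (ψ.symm y)) with hT
  have hTd : HasFDerivAt T (ContinuousLinearMap.id ℝ (Euc d)) 0 := by
    have := hasFDerivAt_return_pow g.continuous hp hp0 hgp hgA N
    rw [hN, pow_orderOf_eq_one] at this
    exact this
  have hT0 : T 0 = 0 := by simp only [hT, hsymm, hper, hp0]
  have hcont : ContinuousAt (fun y => g.toPerm^[n * N] (ψ.symm y)) 0 :=
    (g.continuous.iterate _).continuousAt.comp (ψ.continuousAt_symm h0)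
  obtain ⟨R, hR, hRsub⟩ := Metric.nhds_basis_closedBall.mem_iff.1
    (inter_mem (ψ.open_target.mem_nhds h0)
      (hcont.eventually_mem (ψ.open_source.mem_nhds (by rwa [hsymm, hper]))))
  have hRt : Metric.closedBall 0 R ⊆ ψ.target := fun y hy => (hRsub hy).1
  have hRs : ∀ y ∈ Metric.closedBall (0 : Euc d) R, g.toPerm^[n * N] (ψ.symm y) ∈ ψ.source :=
    fun y hy => (hRsub hy).2
  have hK : IsCompact (Metric.closedBall (0 : Euc d) R) := isCompact_closedBall 0 R
  obtain ⟨ε, hε, hpert⟩ := exists_perturbation_mem hψ hK hRt hU hg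
  obtain ⟨η, hη, hcube⟩ := exists_preserving_unitCube hd
    (lt_min hε (by norm_num : (0 : ℝ) < 1 / 2))
  obtain ⟨q, r₁, hr₁, hisl⟩ := exists_island g.continuous hp hp0 hn hgp hgn hgA
    (N := N) (fun j hj hjN => pow_ne_one_of_lt_orderOf hj.ne' hjN) hρ0.le
  obtain ⟨r₂, hr₂, hresc⟩ := exists_rescaled_near (contDiffAt_return hψ g hp hp0 hper) hT0 hTd q
    hρ0 hη
  have hs0 : 0 < ‖q‖ + ρ := by positivity
  obtain ⟨r, hr, hrlt⟩ : ∃ r : ℝ, 0 < r ∧ r < min (min r₁ r₂) (R / (‖q‖ + ρ)) :=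
    exists_between (by positivity)
  have hrR : r * (‖q‖ + ρ) < R := (lt_div_iff₀ hs0).1 (hrlt.trans_le (min_le_right _ _))
  have hrr := hrlt.trans_le (min_le_left _ _)
  replace hisl := hisl r hr (hrr.trans_le (min_le_left _ _))
  obtain ⟨G, hGn, hGc, hTG⟩ := hresc r hr (hrr.trans_le (min_le_right _ _))
  set α : Euc d → Euc d := fun x => r • (q + x) with hα
  have hαinj : Function.Injective α := fun x y hxy =>
    add_left_cancel (smul_right_injective _ hr.ne' hxy)
  have hαR : ∀ x ∈ Metric.closedBall (0 : Euc d) ρ, α x ∈ Metric.closedBall (0 : Euc d) R := by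
    intro x hx
    rw [mem_closedBall_zero_iff] at hx ⊢
    rw [hα, norm_smul, Real.norm_of_nonneg hr.le]
    exact (mul_le_mul_of_nonneg_left ((norm_add_le _ _).trans (by linarith)) hr.le).trans hrR.le
  -- The return map preserves Lebesgue measure in the chart; the scaling factor is the same on both
  -- sides and cancels.
  have hvol : ∀ B, MeasurableSet B → B ⊆ Metric.closedBall (0 : Euc d) ρ →
      volume (G '' B) = volume B := by
    intro B hB hBρ
    have hαB : MeasurableSet (α '' B) :=
      (IsOpenEmbedding.of_continuous_injective_isOpenMap (by fun_prop) hαinj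
        (isOpenMap_smul_add q hr.ne')).measurableEmbedding.measurableSet_image.2 hB
    have hαBR : α '' B ⊆ Metric.closedBall 0 R := by
      rintro _ ⟨x, hx, rfl⟩
      exact hαR x (hBρ hx)
    have h1 := volume_image_return hψ g (n * N) hαB (hαBR.trans hRt) (fun y hy => hRs y (hαBR hy))
    have h2 : T '' (α '' B) = α '' (G '' B) := by
      rw [image_image, image_image]
      exact image_congr fun x hx => hTG x (hBρ hx)
    change volume (T '' (α '' B)) = _ at h1
    rw [h2, hα, volume_image_smul_add, volume_image_smul_add] at h1
    exact (ENNReal.mul_right_inj (by simpa using fun h => absurd h hr.ne') ENNReal.ofReal_ne_top).1 h1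
  obtain ⟨φ, hφ, hφcube⟩ := hcube G ⟨hGn, hGc⟩ hvol
  have hφ1 : min ε (1 / 2) < 1 := (min_le_right _ _).trans_lt (by norm_num)
  have hΦ := hφ.rescale q hr
  set Φ : Euc d → Euc d := fun y => r • (q + φ (r⁻¹ • y - q)) with hΦdef
  set K := α '' Metric.closedBall 0 ρ with hKdef
  have hKR : K ⊆ Metric.closedBall 0 R := by
    rintro _ ⟨x, hx, rfl⟩
    exact hαR x hx
  have hΦα : ∀ x, Φ (α x) = α (φ x) := fun x => by simp [hΦdef, hα, hr.ne']
  have hs : SupportedIn K Φ := hΦ.supportedIn hφ1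
  obtain ⟨h, hh, hhg⟩ := hpert Φ ((hΦ.mono (min_le_left _ _)).mono_set hKR)
  have hit := fun x hx => iterate_eq_iterate_comp (x := x) (n := n * N) hhg
    (hs.mapsTo_chartLift (hKR.trans hRt)) (fun x hx => chartLift_eq_self hs hx) (by
      rintro i hi him _ ⟨_, ⟨x, hx, rfl⟩, rfl⟩ ⟨_, ⟨x', hx', rfl⟩, hxx⟩
      exact hisl x hx x' hx' i hi him hxx.symm) hx
  have hcubeρ : unitCube d ⊆ Metric.closedBall 0 ρ := fun x hx => by
    rw [mem_closedBall_zero_iff]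
    linarith [norm_le_of_mem_unitCube hx, (Nat.cast_nonneg d : (0 : ℝ) ≤ d)]
  have hN' : ∀ x ∈ Metric.closedBall (0 : Euc d) ρ, ψ.symm (α x) ∈ ψ.symm '' K := fun x hx =>
    ⟨_, ⟨x, hx, rfl⟩, rfl⟩
  have hreturn : ∀ x ∈ unitCube d, h.toPerm^[n * N] (ψ.symm (α x)) = ψ.symm (α ((G ∘ φ) x)) := by
    intro x hx
    have hxρ := hcubeρ hx
    have hφx : φ x ∈ Metric.closedBall 0 ρ := hφ.mapsTo hφ1 hxρ
    have hαt := hRt (hαR x hxρ)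
    rw [hit _ (hN' x hxρ) _ hm0 le_rfl, chartLift_of_mem (ψ.map_target hαt), ψ.right_inv hαt, hΦα,
      Function.comp_apply, ← ψ.left_inv (hRs _ (hαR _ hφx))]
    exact congrArg ψ.symm (hTG _ hφx)
  have hopen : ∀ O, IsOpen O → O ⊆ Metric.closedBall (0 : Euc d) ρ →
      IsOpen (ψ.symm '' (α '' O)) := fun O hO hOρ =>
    ψ.isOpen_image_symm_of_subset_target ((isOpenMap_smul_add q hr.ne') O hO)
      ((image_mono hOρ).trans (hKR.trans hRt))
  -- The part of the island outside a ball containing the cube. The cube avoids it at time `0`, and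
  -- misses the whole island at the other times before `n * N`.
  set W : Set (Euc d) := Metric.ball 0 ρ \ Metric.closedBall 0 d with hW
  have hWρ : W ⊆ Metric.closedBall 0 ρ := sdiff_subset.trans Metric.ball_subset_closedBall
  refine ⟨h, hh, ψ.symm '' (α '' unitCube d), ψ.symm '' (α '' W), hopen _ isOpen_unitCube hcubeρ,
    hopen _ (Metric.isOpen_ball.sdiff Metric.isClosed_closedBall) hWρ, ?_, ?_, n * N, hm0, ?_, ?_⟩
  · have hne : (unitCube d).Nonempty := ⟨WithLp.toLp 2 fun _ => 1 / 2, fun i => by norm_num⟩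
    exact (hne.image _).image _
  · have : NeZero d := ⟨by omega⟩
    obtain ⟨x, hx⟩ := exists_norm_eq (Euc d) (show (0 : ℝ) ≤ d + 1 by positivity)
    refine (Set.Nonempty.image _ ?_).image _
    refine ⟨x, ?_, ?_⟩
    · rw [mem_ball_zero_iff, hx]
      linarith [(Nat.cast_nonneg d : (0 : ℝ) ≤ d)]
    · rw [mem_closedBall_zero_iff, hx]
      linarith
  · conv_rhs => rw [← hφcube]
    rw [image_image, image_image, image_image, image_image]
    exact image_congr hreturn
  · rintro k hk _ ⟨_, ⟨x, hx, rfl⟩, rfl⟩ ⟨_, ⟨w, hw, rfl⟩, hxw⟩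
    have hxρ := hcubeρ hx
    rcases Nat.eq_zero_or_pos k with rfl | hk0
    · have h1 := hαinj (ψ.symm.injOn (hRt (hαR w (hWρ hw))) (hRt (hαR x hxρ)) hxw)
      subst h1
      exact hw.2 (by simpa using norm_le_of_mem_unitCube hx)
    · rw [hit _ (hN' x hxρ) k hk0 hk.le, chartLift_of_mem (ψ.map_target (hRt (hαR x hxρ))),
        ψ.right_inv (hRt (hαR x hxρ)), hΦα] at hxw
      exact hisl _ (hφ.mapsTo hφ1 hxρ) w (hWρ hw) k hk0 hk hxw.symm

end Island

/-! ### A periodic set whose orbit misses an open set -/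

section Contradiction

variable {M : Type*}

theorem image_zpow_eq {h : Equiv.Perm M} {V : Set M} (hV : h '' V = V) (l : ℤ) :
    ⇑(h ^ l) '' V = V := by
  have h1 : ⇑h⁻¹ '' V = V := by
    conv_lhs => rw [← hV]
    rw [image_image]
    simp
  induction l using Int.induction_on with
  | zero => simp
  | succ i ih => rw [zpow_add_one, Equiv.Perm.coe_mul, image_comp, hV, ih]
  | pred i ih => rw [zpow_sub_one, Equiv.Perm.coe_mul, image_comp, h1, ih]

/-- Divide `j - i` by `m`: multiples of `m` preserve `V`, in both directions of time, and the
remainder `k < m` would take a point of `V` into `Z`. -/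
theorem not_exists_orbit_of_image_eq {h : Equiv.Perm M} {V Z : Set M} {m : ℕ} (hm : 0 < m)
    (hV : h^[m] '' V = V) (hZ : ∀ k < m, ∀ v ∈ V, h^[k] v ∉ Z) :
    ¬ ∃ (y : M) (i j : ℤ), (h ^ i) y ∈ V ∧ (h ^ j) y ∈ Z := by
  rintro ⟨y, i, j, hi, hj⟩
  have hm' : (m : ℤ) ≠ 0 := by exact_mod_cast hm.ne'
  obtain ⟨k, hk⟩ := Int.eq_ofNat_of_zero_le (Int.emod_nonneg (j - i) hm')
  have hkm : k < m := by
    have := Int.emod_lt_of_pos (j - i) (by exact_mod_cast hm : (0 : ℤ) < m)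
    rw [hk] at this
    exact_mod_cast this
  have hdec : j = k + m * ((j - i) / m) + i := by
    have := Int.emod_add_mul_ediv (j - i) m
    rw [hk] at this
    linarith
  have hVm : ⇑(h ^ m) '' V = V := by rwa [← Equiv.Perm.iterate_eq_pow]
  have hv : ((h ^ m) ^ ((j - i) / m)) ((h ^ i) y) ∈ V := by
    rw [← image_zpow_eq hVm ((j - i) / m)]
    exact ⟨_, hi, rfl⟩
  refine hZ k hkm _ hv ?_
  rw [Equiv.Perm.iterate_eq_pow, ← Equiv.Perm.mul_apply, ← Equiv.Perm.mul_apply, ← zpow_natCast,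
    ← zpow_natCast, ← zpow_mul, ← zpow_add, ← zpow_add, ← hdec]
  exact hj

end Contradiction

end WeakShadowing

theorem mainTheorem5 {d : ℕ} (hd : 2 ≤ d) {M : Type*} [MetricSpace M] [CompactSpace M]
    [ConnectedSpace M] [ChartedSpace (EuclideanSpace ℝ (Fin d)) M] [IsManifold (𝓡 d) ∞ M]
    [Bundle.RiemannianBundle (fun x : M => TangentSpace (𝓡 d) x)]
    [IsContMDiffRiemannianBundle (𝓡 d) ∞ (EuclideanSpace ℝ (Fin d))
      (fun x : M => TangentSpace (𝓡 d) x)]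
    [IsRiemannianManifold (𝓡 d) M]
    [MeasurableSpace M] [BorelSpace M]
    (Ω : WeakShadowing.VolumeForm d M) (μ : Measure M) (hμ : Ω.IsLebesgueMeasure μ)
    (f : WeakShadowing.VolDiff d μ)
    (U : Set (WeakShadowing.VolDiff d μ)) (hU : IsOpen U) (hfU : f ∈ U)
    (hshadow : ∀ g ∈ U, WeakShadowing.HasWeakShadowing g.toPerm) :
    ∀ g ∈ U, ∀ p : M, ¬ g.IsPeriodicWithTrivialRealSpectrum p := by
  open WeakShadowing in
  intro g hg p htriv
  have hchart := exists_isVolumeChart (by omega) Ω hμ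
  have := isLocallyFiniteMeasure_of_isVolumeChart hchart
  have := isOpenPosMeasure_of_isVolumeChart hchart
  -- By local finiteness and compactness; finiteness and positivity on open sets are what Poincaré
  -- recurrence needs.
  have : IsFiniteMeasure μ := inferInstance
  obtain ⟨ψ, hp, hp0, hψ⟩ := hchart p
  obtain ⟨n, hn, A, hA, i, j, hχ⟩ := exists_hasReturnDeriv_of_trivial hψ hg hp hp0 htriv
  obtain ⟨B, hB, N, hN, hBN⟩ :=
    (stableUnderTransvections_hasReturnDeriv hψ hU hp hp0 hn).exists_pow_eq_one hA hχ
  obtain ⟨h, hh, V, Z, hV, hZ, hV', hZ', m, hm, hmV, hmZ⟩ := exists_periodic_isOpen hd hψ hU hp hp0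
    hn hB (isOfFinOrder_iff_pow_eq_one.2 ⟨N, hN, hBN⟩)
  exact not_exists_orbit_of_image_eq hm hmV hmZ
    ((hshadow h hh).exists_orbit h.continuous h.measurePreserving hV hZ hV' hZ')
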